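/- Let $\alpha\in(0,1)$ and let $f(x,b)=(f_1(x,b),f_2(b))$ be a $C^{2+\alpha}$ absolutely partially hyperbolic skew product of $\mathbb T^4=\mathbb T^2\times\mathbb T^2$. That is: $f$, $f_2$ and every $f_1(\cdot,b)$ are $C^{2+\alpha}$ diffeomorphisms ($C^2$ with $\alpha$-Hölder second derivative, and the same for the inverse); $f_2$ is Anosov; and there are a continuous $Df$-invariant splitting $T\mathbb T^4=E^{ss}\oplus E^c\oplus E^{uu}$ in which $E^c=\ker D\pi_2$ is tangent to the fibers $\mathbb T^2\times\{b\}$, a (continuous) Riemannian metric, and constants $0<\chi^{ss}<1<\chi^{uu}$ with $\chi^{ss}<\chi^c_-\le\chi^c_+<\chi^{uu}$ such that, at every point $p$, $$\|Df(p)|_{E^{ss}}\|\le\chi^{ss},\qquad \chi^c_-\le m(Df(p)|_{E^c})\le\|Df(p)|_{E^c}\|\le\chi^c_+,\qquad \chi^{uu}\le m(Df(p)|_{E^{uu}}),$$ where $m(\cdot)$ is the co-norm. Let $W^{uu}(p)$ be the leaf through $p$ of the foliation tangent to $E^{uu}$, i.e. the set of points that can be joined to $p$ by a $C^1$ curve tangent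 to $E^{uu}$, and for $R>0$ let $W^{uu}_R(p)$ be the disc of radius $R$ centered at $p$ in $W^{uu}(p)$ (points joined to $p$ by such a curve of length at most $R$ in the given Riemannian metric). Assume that $f$ satisfies the $(2,\alpha)$-center unstable bunching condition $$\Big(\frac{\chi^c_+}{\chi^c_-}\Big)^2<\chi^{uu}\qquad\text{and}\qquad \frac{\chi^c_+}{(\chi^c_-)^2}<(\chi^{uu})^{\alpha}.$$ Then, for every $R>0$: 1. for all $p\in\mathbb T^4$ and $q\in W^{uu}_R(p)$ the unstable holonomy $H^u_{p,q}$ between the fibers of $p$ and $q$ is well defined: for every $x\in\mathbb T^2$ there is exactly one $y=:H^u_{p,q}(x)\in\mathbb T^2$ with $(y,\pi_2(q))\in W^{uu}(x,\pi_2(p))$; and $H^u_{p,q}$ is a $C^2$ diffeomorphism of $\mathbb T^2$; 2. $H^u_{p,q}$ varies continuously in the $C^2$ topology with $(p,q)\in\{(p,q)\in\mathbb T^4\times\mathbb T^4: q\in W^{uu}_R(p)\}$, and in particular its $C^2$ norm $\sup_{x}\max\{\|DH^u_{p,q}(x)\|,\|D^2H^u_{p,q}(x)\|\}$ is a continuous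 function of $(p,q)$ on that set. -/

import Mathlib

open Set Filter Topology

noncomputable section

namespace SkewProduct

/-! ### Flat tori and calculus on them -/

/-- The plane, with its Euclidean norm. -/
abbrev R2 := EuclideanSpace ℝ (Fin 2)

/-- The tangent space of the four-dimensional torus. -/
abbrev R4 := R2 × R2

/-- The torus `ℝ²/ℤ²`. -/
abbrev T2 := UnitAddTorus (Fin 2)

/-- The torus `𝕋⁴ = 𝕋² × 𝕋²`; the first factor is the fibre, the second one the base. -/
abbrev T4 := T2 × T2

/-- Notation class for the covering map `proj : E → X` of a torus `X` and for the section
`rep` of it that takes values in the fundamental domain `[-1/2, 1/2)ⁿ`.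
It is only used for `T2` and `T4`. -/
class FlatTorus (X : Type) (E : outParam Type) where
  proj : E → X
  rep : X → E

instance : FlatTorus T2 R2 where
  proj v := fun i => (v i : UnitAddCircle)
  rep x := WithLp.toLp 2 fun i => (AddCircle.equivIco (1 : ℝ) (-1 / 2) (x i) : ℝ)

instance : FlatTorus T4 R4 where
  proj v := (FlatTorus.proj v.1, FlatTorus.proj v.2)
  rep x := (FlatTorus.rep x.1, FlatTorus.rep x.2)

section Calculus

variable {X E Y F : Type} [AddCommGroup X] [NormedAddCommGroup E] [NormedSpace ℝ E]
  [FlatTorus X E] [AddCommGroup Y] [NormedAddCommGroup F] [NormedSpace ℝ F] [FlatTorus Y F]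

/-- The expression of a torus map near `p` in the charts `v ↦ p + proj v` around `p` and
`w ↦ f p + proj w` around `f p`; near `0` it is the lift of `f` that fixes `0`. -/
def localRep (f : X → Y) (p : X) : E → F :=
  fun v => FlatTorus.rep (f (p + FlatTorus.proj v) - f p)

/-- A torus map of class `Cⁿ`. -/
def IsCn (n : ℕ∞) (f : X → Y) : Prop :=
  ∀ p, ContDiffAt ℝ n (localRep f p) 0

/-- The derivative `Df(p)`, all tangent spaces being identified with the universal cover. -/
def D (f : X → Y) (p : X) : E →L[ℝ] F :=
  fderiv ℝ (localRep f p) 0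

/-- The second derivative `D²f(p)`, that is, the derivative at `p` of the vector-valued function
`Df` on the torus. -/
def D2 (f : X → Y) (p : X) : E →L[ℝ] E →L[ℝ] F :=
  fderiv ℝ (fun v : E => D f (p + FlatTorus.proj v)) 0

/-- A torus map of class `C^{2+α}`: of class `C²` with `α`-Hölder second derivative. -/
def IsC2Holder [Dist X] (α : ℝ) (f : X → Y) : Prop :=
  IsCn 2 f ∧ ∃ C : ℝ, ∀ p q, ‖D2 f p - D2 f q‖ ≤ C * dist p q ^ α

/-- A diffeomorphism of class `C^{2+α}`. -/
def IsC2HolderDiffeo [Dist X] (α : ℝ) (f : X ≃ X) : Prop :=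
  IsC2Holder α f ∧ IsC2Holder α f.symm

/-- A diffeomorphism of class `Cⁿ`. -/
def IsCnDiffeo (n : ℕ∞) (f : X ≃ X) : Prop :=
  IsCn n f ∧ IsCn n f.symm

end Calculus

/-- The `2`-jet of a torus map at `x`: value, first and second derivatives. -/
def jet2 (h : T2 → T2) (x : T2) : T2 × (R2 →L[ℝ] R2) × (R2 →L[ℝ] R2 →L[ℝ] R2) :=
  (h x, D h x, D2 h x)

/-- The `C²` norm of a self-map of `𝕋²`. -/
def c2Norm (h : T2 → T2) : ℝ :=
  ⨆ x, max ‖D h x‖ ‖D2 h x‖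

/-! ### Hyperbolicity -/

/-- An Anosov diffeomorphism of `𝕋²`. -/
def IsAnosov (g : Equiv.Perm T2) : Prop :=
  IsCnDiffeo 1 g ∧
  ∃ (Es Eu : T2 → Submodule ℝ R2) (C lam : ℝ), 0 < C ∧ 0 < lam ∧ lam < 1 ∧
    (∀ b, IsCompl (Es b) (Eu b)) ∧
    (∀ b, (Es b).map (D g b).toLinearMap = Es (g b)) ∧
    (∀ b, (Eu b).map (D g b).toLinearMap = Eu (g b)) ∧
    (∀ b, ∀ v ∈ Es b, ∀ n : ℕ, ‖D (g ^ n : Equiv.Perm T2) b v‖ ≤ C * lam ^ n * ‖v‖) ∧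
    (∀ b, ∀ v ∈ Eu b, ∀ n : ℕ, ‖D (g⁻¹ ^ n : Equiv.Perm T2) b v‖ ≤ C * lam ^ n * ‖v‖)

/-- A `C^{2+α}` skew product `f (x, b) = (f₁ (x, b), f₂ b)` of `𝕋² × 𝕋²`. -/
structure IsSkewProduct (α : ℝ) (f : T4 ≃ T4) (f₂ : T2 ≃ T2) : Prop where
  diffeo : IsC2HolderDiffeo α f
  base_diffeo : IsC2HolderDiffeo α f₂
  semiconj : ∀ p, (f p).2 = f₂ p.2
  fibre_diffeo : ∀ b, ∃ k : T2 ≃ T2, IsC2HolderDiffeo α k ∧ ∀ x, k x = (f (x, b)).1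

/-- A Riemannian metric on `𝕋⁴` (no regularity beyond continuity is required). -/
structure IsRiemannianMetric (g : T4 → R4 →L[ℝ] R4 →L[ℝ] ℝ) : Prop where
  continuous : Continuous g
  symm : ∀ p v w, g p v w = g p w v
  pos : ∀ p v, v ≠ 0 → 0 < g p v v

/-- The norm of a tangent vector `v` at `p`. -/
def gnorm (g : T4 → R4 →L[ℝ] R4 →L[ℝ] ℝ) (p : T4) (v : R4) : ℝ :=
  √(g p v v)

/-- `E` is a continuous subbundle of the tangent bundle of `𝕋⁴`: it is the family of ranges of a
continuous family of projections. -/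
def IsSubbundle (E : T4 → Submodule ℝ R4) : Prop :=
  ∃ P : T4 → R4 →L[ℝ] R4, Continuous P ∧
    (∀ p v, P p (P p v) = P p v) ∧ ∀ p, (P p).range = E p

/-- `f` is absolutely partially hyperbolic, with invariant splitting `Ess ⊕ Ec ⊕ Euu`, adapted
Riemannian metric `g` and constants `χss`, `χm = χ^c_-`, `χp = χ^c_+`, `χuu`. -/
structure IsAbsolutelyPartiallyHyperbolic (f : T4 ≃ T4) (g : T4 → R4 →L[ℝ] R4 →L[ℝ] ℝ)
    (Ess Ec Euu : T4 → Submodule ℝ R4) (χss χm χp χuu : ℝ) : Prop where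
  metric : IsRiemannianMetric g
  subbundle_ss : IsSubbundle Ess
  subbundle_c : IsSubbundle Ec
  subbundle_uu : IsSubbundle Euu
  splitting : ∀ p, DirectSum.IsInternal ![Ess p, Ec p, Euu p]
  invariant_ss : ∀ p, (Ess p).map (D f p).toLinearMap = Ess (f p)
  invariant_c : ∀ p, (Ec p).map (D f p).toLinearMap = Ec (f p)
  invariant_uu : ∀ p, (Euu p).map (D f p).toLinearMap = Euu (f p)
  ss_pos : 0 < χss
  ss_lt_one : χss < 1
  one_lt_uu : 1 < χuu
  ss_lt_m : χss < χm
  m_le_p : χm ≤ χp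
  p_lt_uu : χp < χuu
  norm_ss : ∀ p, ∀ v ∈ Ess p, gnorm g (f p) (D f p v) ≤ χss * gnorm g p v
  conorm_c : ∀ p, ∀ v ∈ Ec p, χm * gnorm g p v ≤ gnorm g (f p) (D f p v)
  norm_c : ∀ p, ∀ v ∈ Ec p, gnorm g (f p) (D f p v) ≤ χp * gnorm g p v
  conorm_uu : ∀ p, ∀ v ∈ Euu p, χuu * gnorm g p v ≤ gnorm g (f p) (D f p v)

/-- A partially hyperbolic skew product: a partially hyperbolic diffeomorphism that is a skew
product over an Anosov diffeomorphism and whose centre leaves are the fibres `𝕋² × {b}`. -/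
structure IsPartiallyHyperbolicSkewProduct (α : ℝ) (f : T4 ≃ T4) (f₂ : T2 ≃ T2)
    (g : T4 → R4 →L[ℝ] R4 →L[ℝ] ℝ) (Ess Ec Euu : T4 → Submodule ℝ R4)
    (χss χm χp χuu : ℝ) : Prop where
  skew : IsSkewProduct α f f₂
  anosov : IsAnosov f₂
  hyperbolic : IsAbsolutelyPartiallyHyperbolic f g Ess Ec Euu χss χm χp χuu
  centre : ∀ p, Ec p = LinearMap.ker (LinearMap.snd ℝ R2 R2)

/-- The `(2,α)`-center unstable bunching condition. -/
def CenterUnstableBunched (α χm χp χuu : ℝ) : Prop :=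
  (χp / χm) ^ 2 < χuu ∧ χp / χm ^ 2 < χuu ^ α

/-! ### Strong unstable leaves and holonomies -/

/-- `c : ℝ → ℝ⁴`, restricted to `[0,1]`, is the lift of a `C¹` curve in `𝕋⁴` from `p` to `q` that is
everywhere tangent to `E`. -/
structure IsTangentCurve (E : T4 → Submodule ℝ R4) (p q : T4) (c : ℝ → R4) : Prop where
  contDiff : ContDiff ℝ 1 c
  source : FlatTorus.proj (c 0) = p
  target : FlatTorus.proj (c 1) = q
  tangent : ∀ t ∈ Icc (0 : ℝ) 1, deriv c t ∈ E (FlatTorus.proj (c t))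

/-- The leaf through `p` of the foliation tangent to `E` (here `E = E^{uu}`). -/
def leaf (E : T4 → Submodule ℝ R4) (p : T4) : Set T4 :=
  {q | ∃ c, IsTangentCurve E p q c}

/-- The disc of radius `R` around `p` inside its leaf, for the length induced by `g`. -/
def leafDisc (g : T4 → R4 →L[ℝ] R4 →L[ℝ] ℝ) (E : T4 → Submodule ℝ R4) (R : ℝ) (p : T4) :
    Set T4 :=
  {q | ∃ c, IsTangentCurve E p q c ∧
    ∫ t in (0 : ℝ)..1, gnorm g (FlatTorus.proj (c t)) (deriv c t) ≤ R}

/-- `h` is the unstable holonomy from the fibre of `p` to the fibre of `q`: for each `x`, the point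
`(h x, q.2)` is the one and only point of the fibre of `q` on the strong unstable leaf of
`(x, p.2)`. -/
def IsHolonomy (Euu : T4 → Submodule ℝ R4) (p q : T4) (h : T2 → T2) : Prop :=
  ∀ x y, (y, q.2) ∈ leaf Euu (x, p.2) ↔ y = h x

end SkewProduct

end

open SkewProduct

set_option linter.unusedSectionVars false

noncomputable section

namespace SkewProduct

/-! The holonomy between the fibres over `b` and `b'` is built as the limit of the maps `transfer f
f₂ n b b'`: iterate backwards `n` times over `b`, jump to the fibre over the `n`-th preimage of `b'`
keeping the fibre coordinate, and iterate forwards. When `b` and `b'` are joined by the projection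
of an unstable curve, the jump has size O(χuu⁻ⁿ) (`BackwardClose`), while forward iteration expands
fibres by at most χpⁿ. Since χp < χuu, the limit exists uniformly (`exists_dist_transfer_le`).

The derivatives are controlled through the recursion `transfer_succ`, a graph transform. It
contracts differences of first derivatives by χp/χm and differences of second derivatives by χp/χm²
(`step_D`, `step_D2`), up to errors caused by the distance of base points. One backward step divides
the closeness ε of the base orbits by χuu. A bound linear in ε therefore reproduces itself if χp/χm
< χuu. The errors for second derivatives are only of order ε^α, because D²f is only Hölder, and the
bound closes if χp/χm² < χuu^α. These are the uses of the two bunching inequalities. The result is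
geometric convergence of 2-jets, uniform over ε ≤ R (`exists_dist_jet2_transfer_le`). Hence the
limit is C², its jets are jointly continuous, and exchanging `b` and `b'` inverts it.

It remains to identify the limit with the leaves. A point of the leaf of (x, b) has a backward orbit
asymptotic to that of (x, b) at rate χuu⁻ⁿ, so it must be the limit (`eq_transferLim_of_mem_leaf`).
Conversely, for an unstable curve from p to q, apply the transfer maps to x along its base
projection (`transferLim_mem_leaf`). The n-th curve has as velocity the image under Dfⁿ of a vector
of size O(χuu⁻ⁿ) that splits into centre and unstable parts: there is no stable part because the
base projection of `Euu` is constant along fibres (`exists_unstable_lift`). The centre part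
contributes O((χp/χuu)ⁿ), so velocities converge to unstable vectors and the limit curve is C¹ and
tangent to `Euu`. Neither the existence of the foliation nor unique integrability is presupposed. -/

/-- The laws relating the covering map and its section for a torus whose metric is the quotient
metric, up to constants. -/
class IsFlatTorus (X : Type) (E : outParam Type) [NormedAddCommGroup X] [NormedAddCommGroup E]
    [FlatTorus X E] : Prop where
  proj_add : ∀ v w : E, (FlatTorus.proj (v + w) : X) = FlatTorus.proj v + FlatTorus.proj w
  proj_rep : ∀ x : X, FlatTorus.proj (FlatTorus.rep x) = x
  rep_proj : ∀ v : E, ‖v‖ < 1 / 2 → FlatTorus.rep (FlatTorus.proj v : X) = v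
  norm_proj_le : ∀ v : E, ‖(FlatTorus.proj v : X)‖ ≤ ‖v‖
  norm_rep_le : ∀ x : X, ‖(FlatTorus.rep x : E)‖ ≤ 2 * ‖x‖

/-! ### The flat structures of `T2` and `T4` -/

theorem T2.proj_apply (v : R2) (i : Fin 2) :
    (FlatTorus.proj v : T2) i = (v i : UnitAddCircle) := rfl

theorem T2.rep_apply (x : T2) (i : Fin 2) :
    (FlatTorus.rep x : R2) i = (AddCircle.equivIco (1 : ℝ) (-1 / 2) (x i) : ℝ) := rfl

/-- The representative in [-1/2, 1/2) has minimal absolute value in its class. -/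
theorem abs_equivIco_eq_norm (y : UnitAddCircle) :
    |(AddCircle.equivIco (1 : ℝ) (-1 / 2) y : ℝ)| = ‖y‖ := by
  conv_rhs => rw [← AddCircle.coe_equivIco (p := (1 : ℝ)) (a := -1 / 2) (y := y)]
  have h := (AddCircle.equivIco (1 : ℝ) (-1 / 2) y).2
  refine ((AddCircle.norm_coe_eq_abs_iff (1 : ℝ) one_ne_zero).2 ?_).symm
  rw [abs_one, abs_le]
  constructor <;> linarith [h.1, h.2]

instance : IsFlatTorus T2 R2 where
  proj_add v w := by
    funext i
    simp [T2.proj_apply]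
  proj_rep x := by
    funext i
    rw [T2.proj_apply, T2.rep_apply, AddCircle.coe_equivIco]
  rep_proj v hv := by
    ext i
    rw [T2.rep_apply, T2.proj_apply]
    have h1 : |v i| < 1 / 2 := lt_of_le_of_lt (by simpa using PiLp.norm_apply_le v i) hv
    rw [abs_lt] at h1
    have h2 : v i ∈ Ico (-1 / 2 : ℝ) (-1 / 2 + 1) := ⟨by linarith, by linarith⟩
    rw [AddCircle.equivIco_coe_eq h2]
  norm_proj_le v := by
    refine (pi_norm_le_iff_of_nonneg (norm_nonneg _)).2 fun i => ?_
    refine le_trans ?_ (PiLp.norm_apply_le v i)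
    exact QuotientAddGroup.norm_mk_le_norm
  -- `T2` carries the supremum norm of its coordinates and `R2` the Euclidean one, which costs a
  -- factor √2 ≤ 2.
  norm_rep_le x := by
    rw [EuclideanSpace.norm_eq]
    refine Real.sqrt_le_iff.2 ⟨by positivity, ?_⟩
    have h : ∀ i, ‖(FlatTorus.rep x : R2) i‖ ^ 2 ≤ ‖x‖ ^ 2 := fun i => by
      rw [T2.rep_apply, Real.norm_eq_abs, abs_equivIco_eq_norm]
      exact pow_le_pow_left₀ (norm_nonneg _) (norm_le_pi_norm x i) 2
    rw [Fin.sum_univ_two]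
    nlinarith [h 0, h 1]

theorem T4.proj_eq (v : R4) :
    (FlatTorus.proj v : T4) = (FlatTorus.proj v.1, FlatTorus.proj v.2) := rfl

theorem T4.rep_eq (x : T4) : (FlatTorus.rep x : R4) = (FlatTorus.rep x.1, FlatTorus.rep x.2) := rfl

instance : IsFlatTorus T4 R4 where
  proj_add v w := by
    simp only [T4.proj_eq, Prod.fst_add, Prod.snd_add, IsFlatTorus.proj_add, Prod.mk_add_mk]
  proj_rep x := by
    simp only [T4.proj_eq, T4.rep_eq, IsFlatTorus.proj_rep]
  rep_proj v hv := by
    rw [Prod.norm_def, max_lt_iff] at hv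
    simp only [T4.proj_eq, T4.rep_eq]
    rw [IsFlatTorus.rep_proj _ hv.1, IsFlatTorus.rep_proj _ hv.2]
  norm_proj_le v := by
    simp only [T4.proj_eq, Prod.norm_def]
    exact max_le_max (IsFlatTorus.norm_proj_le _) (IsFlatTorus.norm_proj_le _)
  norm_rep_le x := by
    simp only [T4.rep_eq, Prod.norm_def]
    refine max_le ((IsFlatTorus.norm_rep_le _).trans ?_) ((IsFlatTorus.norm_rep_le _).trans ?_)
    · gcongr; exact le_max_left _ _
    · gcongr; exact le_max_right _ _

/-! ### C² calculus on flat tori -/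

section General

open FlatTorus

variable {X E Y F Z G : Type}
  [NormedAddCommGroup X] [NormedAddCommGroup E] [NormedSpace ℝ E] [FlatTorus X E] [IsFlatTorus X E]
  [NormedAddCommGroup Y] [NormedAddCommGroup F] [NormedSpace ℝ F] [FlatTorus Y F] [IsFlatTorus Y F]
  [NormedAddCommGroup Z] [NormedAddCommGroup G] [NormedSpace ℝ G] [FlatTorus Z G] [IsFlatTorus Z G]

theorem proj_zero : (proj (0 : E) : X) = 0 := by
  have h := IsFlatTorus.proj_add (X := X) (0 : E) 0
  simpa using h

theorem rep_zero : (rep (0 : X) : E) = 0 := by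
  rw [← proj_zero (X := X) (E := E), IsFlatTorus.rep_proj _ (by simp)]

theorem proj_neg (v : E) : (proj (-v) : X) = -proj v := by
  rw [eq_neg_iff_add_eq_zero, ← IsFlatTorus.proj_add, neg_add_cancel, proj_zero]

theorem proj_sub (v w : E) : (proj (v - w) : X) = proj v - proj w := by
  rw [sub_eq_add_neg, IsFlatTorus.proj_add, proj_neg, ← sub_eq_add_neg]

theorem lipschitz_proj : LipschitzWith 1 (proj : E → X) :=
  LipschitzWith.of_dist_le_mul fun v w => by
    rw [dist_eq_norm, dist_eq_norm, ← proj_sub]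
    simpa using IsFlatTorus.norm_proj_le (X := X) (v - w)

theorem continuous_proj : Continuous (proj : E → X) := lipschitz_proj.continuous

theorem rep_eq_of_proj_eq {x : X} {v : E} (h : proj v = x) (hv : ‖v‖ < 1 / 2) : rep x = v := by
  rw [← h, IsFlatTorus.rep_proj _ hv]

/-- Away from the cut locus `rep` is locally additive: the radii keep `rep x + rep (y - x)` inside
the ball of radius 1/2, where `proj` determines its lift. -/
theorem continuousAt_rep {x : X} (hx : ‖x‖ < 1 / 8) : ContinuousAt (rep : X → E) x := by
  rw [Metric.continuousAt_iff]
  intro ε hε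
  refine ⟨min (1 / 16) (ε / 2), by positivity, fun {y} hy => ?_⟩
  have h1 : ‖(rep x : E)‖ < 1 / 4 := (IsFlatTorus.norm_rep_le x).trans_lt (by linarith)
  rw [dist_eq_norm] at hy
  have h2 : ‖(rep (y - x) : E)‖ ≤ 2 * ‖y - x‖ := IsFlatTorus.norm_rep_le _
  have h5 := hy.trans_le (min_le_left _ _)
  have h6 := hy.trans_le (min_le_right _ _)
  have h3 : (rep y : E) = rep x + rep (y - x) := by
    refine rep_eq_of_proj_eq ?_ ?_
    · rw [IsFlatTorus.proj_add, IsFlatTorus.proj_rep, IsFlatTorus.proj_rep, add_sub_cancel]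
    · refine (norm_add_le _ _).trans_lt ?_
      linarith
  rw [h3, dist_eq_norm, add_sub_cancel_left]
  linarith

theorem continuousAt_rep_zero : ContinuousAt (rep : X → E) 0 := continuousAt_rep (by simp)

theorem add_proj_rep (x y : X) : x + proj (rep (y - x)) = y := by
  rw [IsFlatTorus.proj_rep, add_sub_cancel]

theorem proj_localRep (f : X → Y) (p : X) (v : E) :
    proj (localRep f p v) = f (p + proj v) - f p := IsFlatTorus.proj_rep _

theorem localRep_def (f : X → Y) (p : X) (v : E) :
    localRep f p v = rep (f (p + proj v) - f p) := rfl

theorem localRep_zero (f : X → Y) (p : X) : localRep f p (0 : E) = 0 := by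
  rw [localRep_def, proj_zero, add_zero, sub_self, rep_zero]

/-- No smallness is needed, since the inner `rep` is immediately undone by `proj`. The chain rules
below thus reduce to those of the plane. -/
theorem localRep_comp (f : Y → Z) (h : X → Y) (p : X) :
    localRep (f ∘ h) p = localRep f (h p) ∘ localRep h p := by
  funext v
  simp only [Function.comp, localRep_def, IsFlatTorus.proj_rep, add_sub_cancel]

theorem localRep_id : localRep (id : X → X) =
    fun _ v => rep (proj v : X) := by
  funext _ v
  simp [localRep_def]

theorem continuousAt_of_localRep {f : X → Y} {p : X} (h : ContinuousAt (localRep f p) 0) :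
    ContinuousAt f p := by
  have h1 : f = fun x => f p + proj (localRep f p (rep (x - p))) := by
    funext x
    rw [proj_localRep, add_proj_rep, add_sub_cancel]
  rw [h1]
  refine continuousAt_const.add (continuous_proj.continuousAt.comp' ?_)
  have h2 : ContinuousAt (fun x : X => (rep (x - p) : E)) p := by
    refine ContinuousAt.comp' (g := rep) ?_ (by fun_prop)
    simpa using continuousAt_rep_zero (X := X)
  refine ContinuousAt.comp' ?_ h2
  simpa [rep_zero] using h

theorem IsCn.differentiableAt {f : X → Y} {n : ℕ∞} (hf : IsCn n f) (hn : n ≠ 0) (p : X) :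
    DifferentiableAt ℝ (localRep f p) 0 :=
  (hf p).differentiableAt (by exact_mod_cast hn)

theorem IsCn.hasFDerivAt {f : X → Y} {n : ℕ∞} (hf : IsCn n f) (hn : n ≠ 0) (p : X) :
    HasFDerivAt (localRep f p) (D f p) 0 :=
  (hf.differentiableAt hn p).hasFDerivAt

theorem IsCn.continuous {f : X → Y} {n : ℕ∞} (hf : IsCn n f) : Continuous f :=
  continuous_iff_continuousAt.2 fun p => continuousAt_of_localRep (hf p).continuousAt

theorem IsCn.comp {f : Y → Z} {h : X → Y} {n : ℕ∞} (hf : IsCn n f) (hh : IsCn n h) :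
    IsCn n (f ∘ h) := fun p => by
  rw [localRep_comp]
  exact ContDiffAt.comp _ (by rw [localRep_zero]; exact hf _) (hh p)

theorem localRep_id_eventuallyEq (p : X) : localRep (id : X → X) p =ᶠ[𝓝 0] id := by
  filter_upwards [Metric.ball_mem_nhds (0 : E) (show (0 : ℝ) < 1 / 2 by norm_num)] with v hv
  rw [localRep_id]
  exact IsFlatTorus.rep_proj v (by simpa using hv)

theorem isCn_id (n : ℕ∞) : IsCn n (id : X → X) := fun p =>
  contDiffAt_id.congr_of_eventuallyEq (localRep_id_eventuallyEq p)

theorem D_id (p : X) : D (id : X → X) p = ContinuousLinearMap.id ℝ E := by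
  rw [D, (localRep_id_eventuallyEq p).fderiv_eq, fderiv_id]

theorem D_comp {f : Y → Z} {h : X → Y} {n : ℕ∞} (hf : IsCn n f) (hh : IsCn n h) (hn : n ≠ 0)
    (p : X) : D (f ∘ h) p = (D f (h p)).comp (D h p) := by
  rw [D, localRep_comp]
  refine HasFDerivAt.fderiv (HasFDerivAt.comp _ ?_ (hh.hasFDerivAt hn p))
  rw [localRep_zero]
  exact hf.hasFDerivAt hn _

/-- Near a point `v` at which a torus map has not moved far, its local representative is, up to
a translation, the local representative at the base point `p + proj v`. -/
theorem localRep_add {f : X → Y} {p : X} {v : E} (hv : ‖localRep f p v‖ < 1 / 4)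
    (hc : ContinuousAt (localRep f (p + proj v)) 0) :
    ∀ᶠ w in 𝓝 (0 : E), localRep f p (v + w) = localRep f p v + localRep f (p + proj v) w := by
  have h : ∀ᶠ w in 𝓝 (0 : E), ‖localRep f (p + proj v) w‖ < 1 / 4 := by
    refine hc.norm.eventually_lt continuousAt_const ?_
    rw [localRep_zero]
    norm_num
  filter_upwards [h] with w hw
  refine rep_eq_of_proj_eq ?_ ((norm_add_le _ _).trans_lt (by linarith))
  rw [IsFlatTorus.proj_add, proj_localRep, proj_localRep, IsFlatTorus.proj_add, ← add_assoc]
  abel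

/-- By `localRep_add` the charts at `p` and at `p + proj v` differ by translations near `v`, so
differentiability at chart centres yields differentiability off centre. -/
theorem hasFDerivAt_localRep {f : X → Y} {p : X} {v : E} {A : E →L[ℝ] F}
    (hv : ‖localRep f p v‖ < 1 / 4) (h : HasFDerivAt (localRep f (p + proj v)) A 0) :
    HasFDerivAt (localRep f p) A v := by
  have h1 : HasFDerivAt (fun w => localRep f p v + localRep f (p + proj v) (w - v)) A v := by
    have h2 : HasFDerivAt (fun w : E => w - v) (ContinuousLinearMap.id ℝ E) v :=
      (hasFDerivAt_id v).sub_const v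
    have h3 := HasFDerivAt.comp v (by simpa using h) h2
    exact h3.const_add _
  refine h1.congr_of_eventuallyEq ?_
  have h4 : Tendsto (fun w : E => w - v) (𝓝 v) (𝓝 0) := by
    have : ContinuousAt (fun w : E => w - v) v := by fun_prop
    simpa [ContinuousAt] using this
  filter_upwards [h4.eventually (localRep_add hv h.continuousAt)] with w hw
  simpa using hw

theorem eventually_norm_localRep_lt {f : X → Y} {p : X} (h : ContinuousAt (localRep f p) 0) :
    ∀ᶠ v in 𝓝 (0 : E), ‖localRep f p v‖ < 1 / 4 := by
  refine h.norm.eventually_lt continuousAt_const ?_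
  rw [localRep_zero]
  norm_num

theorem IsCn.fderiv_localRep_eventuallyEq {f : X → Y} {n : ℕ∞} (hf : IsCn n f) (hn : n ≠ 0)
    (p : X) : fderiv ℝ (localRep f p) =ᶠ[𝓝 0] fun v => D f (p + proj v) := by
  filter_upwards [eventually_norm_localRep_lt (hf p).continuousAt] with v hv
  exact (hasFDerivAt_localRep hv (hf.hasFDerivAt hn _)).fderiv

theorem IsCn.continuous_D {f : X → Y} {n : ℕ∞} (hf : IsCn n f) (hn : n ≠ 0) :
    Continuous (D f) := by
  refine continuous_iff_continuousAt.2 fun p => ?_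
  have h1 : ContinuousAt (fun v : E => D f (p + proj v)) 0 := by
    refine ContinuousAt.congr ?_ (hf.fderiv_localRep_eventuallyEq hn p)
    have := (hf p).fderiv_right (m := 0) (by
      simpa using Order.one_le_iff_pos.2 (by exact_mod_cast pos_iff_ne_zero.2 hn))
    exact this.continuousAt
  have h2 : D f = fun x => D f (p + proj (rep (x - p) : E)) := by
    funext x; rw [add_proj_rep]
  rw [h2]
  have h3 : ContinuousAt (fun x : X => (rep (x - p) : E)) p := by
    refine ContinuousAt.comp' (g := rep) ?_ (by fun_prop)
    simpa using continuousAt_rep_zero (X := X)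
  refine ContinuousAt.comp' (f := fun x : X => (rep (x - p) : E))
    (g := fun v : E => D f (p + proj v)) ?_ h3
  simpa [rep_zero] using h1

/-- `D f` takes values in a vector space, so its lift has no wrapping problem and is differentiable
on the whole cover. -/
theorem IsCn.hasFDerivAt_D {f : X → Y} (hf : IsCn 2 f) (p : X) (v : E) :
    HasFDerivAt (fun v : E => D f (p + proj v)) (D2 f (p + proj v)) v := by
  have key : ∀ p : X, HasFDerivAt (fun v : E => D f (p + proj v)) (D2 f p) 0 := fun p => by
    refine DifferentiableAt.hasFDerivAt ?_
    refine DifferentiableAt.congr_of_eventuallyEq ?_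
      (hf.fderiv_localRep_eventuallyEq two_ne_zero p).symm
    exact ((hf p).fderiv_right (m := 1) (by norm_num)).differentiableAt one_ne_zero
  have h2 : HasFDerivAt (fun w : E => w - v) (ContinuousLinearMap.id ℝ E) v :=
    (hasFDerivAt_id v).sub_const v
  have h3 := HasFDerivAt.comp v (g := fun w : E => D f (p + proj v + proj w))
    (by simpa using key (p + proj v)) h2
  refine (h3.congr_of_eventuallyEq (Eventually.of_forall fun w => ?_))
  simp only [Function.comp]
  rw [add_assoc, ← IsFlatTorus.proj_add, add_sub_cancel]

theorem D2_comp {f : Y → Z} {h : X → Y} (hf : IsCn 2 f) (hh : IsCn 2 h) (p : X) (u v : E) :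
    D2 (f ∘ h) p u v = D2 f (h p) (D h p u) (D h p v) + D f (h p) (D2 h p u v) := by
  have h1 : (fun v : E => D (f ∘ h) (p + proj v)) = fun v : E =>
      (D f (h p + proj (localRep h p v))).comp (D h (p + proj v)) := by
    funext v
    rw [D_comp hf hh two_ne_zero, proj_localRep, add_sub_cancel]
  have h2 : HasFDerivAt (fun v : E => D f (h p + proj (localRep h p v)))
      ((D2 f (h p)).comp (D h p)) 0 := by
    have h3 := hf.hasFDerivAt_D (h p) (localRep h p 0)
    have h4 := HasFDerivAt.comp (0 : E) h3 (hh.hasFDerivAt two_ne_zero p)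
    rw [localRep_zero, proj_zero, add_zero] at h4
    exact h4
  have h3 : HasFDerivAt (fun v : E => D h (p + proj v)) (D2 h p) 0 := by
    simpa [proj_zero] using hh.hasFDerivAt_D p 0
  have h4 := (h2.clm_comp h3).fderiv
  rw [D2, h1, h4]
  simp [localRep_zero, proj_zero, add_comm]

theorem D2_id (p : X) : D2 (id : X → X) p = 0 := by
  rw [D2]
  simp only [D_id]
  exact fderiv_const_apply _

/-- Data at chart centres suffices: translating the base point spreads `hA` to a neighbourhood and
`hB` to the whole cover, so the local derivative is the C¹ map `v ↦ A (p + proj v)`. -/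
theorem isC2_of_hasFDerivAt {f : X → Y} {A : X → E →L[ℝ] F} {B : X → E →L[ℝ] E →L[ℝ] F}
    (hA : ∀ p, HasFDerivAt (localRep f p) (A p) 0)
    (hB : ∀ p, HasFDerivAt (fun v : E => A (p + proj v)) (B p) 0) (hBc : Continuous B) :
    IsCn 2 f ∧ D f = A ∧ D2 f = B := by
  have hD : D f = A := funext fun p => (hA p).fderiv
  have hD2 : D2 f = B := funext fun p => by rw [D2, hD]; exact (hB p).fderiv
  refine ⟨fun p => ?_, hD, hD2⟩
  have h1 : ∀ᶠ v in 𝓝 (0 : E), HasFDerivAt (localRep f p) (A (p + proj v)) v := by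
    filter_upwards [eventually_norm_localRep_lt (hA p).continuousAt] with v hv
    exact hasFDerivAt_localRep hv (hA _)
  have hB' : ∀ v : E, HasFDerivAt (fun v : E => A (p + proj v)) (B (p + proj v)) v := fun v => by
    have h2 : HasFDerivAt (fun w : E => w - v) (ContinuousLinearMap.id ℝ E) v :=
      (hasFDerivAt_id v).sub_const v
    have h3 := HasFDerivAt.comp v (g := fun w : E => A (p + proj v + proj w))
      (by simpa using hB (p + proj v)) h2
    refine (h3.congr_of_eventuallyEq (Eventually.of_forall fun w => ?_))
    simp only [Function.comp]
    rw [add_assoc, ← IsFlatTorus.proj_add, add_sub_cancel]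
  have h2 : ContDiff ℝ 1 (fun v : E => A (p + proj v)) := by
    rw [contDiff_one_iff_fderiv]
    refine ⟨fun v => (hB' v).differentiableAt, ?_⟩
    have : fderiv ℝ (fun v : E => A (p + proj v)) = fun v => B (p + proj v) :=
      funext fun v => (hB' v).fderiv
    rw [this]
    exact hBc.comp (continuous_const.add continuous_proj)
  have h3 : ContDiffAt ℝ ((1 : ℕ) + 1) (localRep f p) 0 :=
    contDiffAt_succ_iff_hasFDerivAt.2 ⟨_, ⟨_, h1, fun _ h => h⟩, h2.contDiffAt⟩
  have e : (((1 : ℕ) : WithTop ℕ∞) + 1) = (((2 : ℕ∞) : WithTop ℕ∞)) := by norm_num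
  rw [e] at h3
  exact h3

/-- A `C²`-uniform limit of `C²` torus maps is `C²`, with the expected derivatives. -/
theorem isC2_of_tendstoUniformly {h : ℕ → X → Y} {h' : X → Y} {A : X → E →L[ℝ] F}
    {B : X → E →L[ℝ] E →L[ℝ] F} (hh : ∀ n, IsCn 2 (h n)) (hlim : TendstoUniformly h h' atTop)
    (hA : TendstoUniformly (fun n => D (h n)) A atTop)
    (hB : TendstoUniformly (fun n => D2 (h n)) B atTop) (hBc : Continuous B) :
    IsCn 2 h' ∧ D h' = A ∧ D2 h' = B := by
  have hc : Continuous h' :=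
    hlim.continuous (Eventually.of_forall fun n => (hh n).continuous).frequently
  refine isC2_of_hasFDerivAt (fun p => ?_) (fun p => ?_) hBc
  -- Three errors of 1/24 keep the increments of `h n` below 1/8 on one ball for all large `n`.
  -- Their lifts are then below 1/4, as `hasFDerivAt_localRep` requires, and `rep` is continuous at
  -- the limit increment.
  · have h1 : ∀ᶠ v in 𝓝 (0 : E), ‖h' (p + proj v) - h' p‖ < 1 / 24 := by
      have : ContinuousAt (fun v : E => ‖h' (p + proj v) - h' p‖) 0 := by
        have := continuous_proj (X := X) (E := E)
        fun_prop
      refine this.eventually_lt continuousAt_const ?_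
      simp [proj_zero]
    obtain ⟨δ, hδ, hball⟩ := Metric.eventually_nhds_iff_ball.1 h1
    obtain ⟨N, hN⟩ := (eventually_atTop.1
      (Metric.tendstoUniformly_iff.1 hlim (1 / 24) (by norm_num)))
    have h2 : ∀ n, ∀ v ∈ Metric.ball (0 : E) δ, ‖h (n + N) (p + proj v) - h (n + N) p‖ < 1 / 8 := by
      intro n v hv
      have a := hball v hv
      have b := hN (n + N) (Nat.le_add_left _ _) (p + proj v)
      have c := hN (n + N) (Nat.le_add_left _ _) p
      rw [dist_comm, dist_eq_norm] at b
      rw [dist_eq_norm] at c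
      have e : h (n + N) (p + proj v) - h (n + N) p = (h (n + N) (p + proj v) - h' (p + proj v)) +
          (h' (p + proj v) - h' p) + (h' p - h (n + N) p) := by abel
      rw [e]
      refine (norm_add₃_le).trans_lt ?_
      linarith
    have hsh : Tendsto (fun n : ℕ => n + N) atTop atTop := tendsto_add_atTop_nat N
    have key := hasFDerivAt_of_tendstoUniformlyOn (𝕜 := ℝ) (l := (atTop : Filter ℕ))
      (f := fun n => localRep (h (n + N)) p) (g := localRep h' p)
      (f' := fun n v => D (h (n + N)) (p + proj v)) (g' := fun v => A (p + proj v))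
      (x := (0 : E)) (s := Metric.ball (0 : E) δ) Metric.isOpen_ball ?_ ?_ ?_
      (Metric.mem_ball_self hδ)
    · simpa [proj_zero] using key
    · rw [Metric.tendstoUniformlyOn_iff]
      intro ε hε
      filter_upwards [hsh.eventually (Metric.tendstoUniformly_iff.1 hA ε hε)] with n hn v _
      exact hn _
    · intro n v hv
      refine hasFDerivAt_localRep ?_ ((hh _).hasFDerivAt two_ne_zero _)
      refine (IsFlatTorus.norm_rep_le _).trans_lt ?_
      linarith [h2 n v hv]
    · intro v hv
      have h3 := ((hlim.tendsto_at (p + proj v)).sub (hlim.tendsto_at p)).comp hsh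
      have h4 : ContinuousAt (rep : Y → F) (h' (p + proj v) - h' p) :=
        continuousAt_rep ((hball v hv).trans (by norm_num))
      exact h4.tendsto.comp h3
  · have key := hasFDerivAt_of_tendstoUniformlyOn (𝕜 := ℝ) (l := (atTop : Filter ℕ))
      (f := fun n v => D (h n) (p + proj v)) (g := fun v => A (p + proj v))
      (f' := fun n v => D2 (h n) (p + proj v)) (g' := fun v => B (p + proj v))
      (x := (0 : E)) (s := univ) isOpen_univ ?_ ?_ ?_ (mem_univ _)
    · simpa [proj_zero] using key
    · exact (hB.comp fun v : E => p + proj v).tendstoUniformlyOn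
    · intro n v _
      exact (hh n).hasFDerivAt_D p v
    · intro v _
      exact hA.tendsto_at _

/-- The mean value inequality on the cover, along `rep (p - q)`, whose length is at most twice the
distance. -/
theorem IsCn.norm_D_sub_le {f : X → Y} (hf : IsCn 2 f) {M : ℝ} (hM : ∀ p, ‖D2 f p‖ ≤ M)
    (p q : X) : ‖D f p - D f q‖ ≤ 2 * M * dist p q := by
  have h := Convex.norm_image_sub_le_of_norm_hasFDerivWithin_le
    (f := fun v : E => D f (q + proj v)) (f' := fun v => D2 f (q + proj v)) (s := univ) (C := M)
    (fun v _ => (hf.hasFDerivAt_D q v).hasFDerivWithinAt) (fun v _ => hM _) convex_univ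
    (mem_univ (0 : E)) (mem_univ (rep (p - q)))
  simp only [add_proj_rep, proj_zero, add_zero, sub_zero] at h
  refine h.trans ?_
  have h0 : 0 ≤ M := (norm_nonneg (D2 f p)).trans (hM p)
  rw [dist_eq_norm]
  nlinarith [IsFlatTorus.norm_rep_le (p - q)]

end General

/-! ### Velocities and lengths of curves in tori -/

section Curves

open FlatTorus

variable {X E Y F : Type}
  [NormedAddCommGroup X] [NormedAddCommGroup E] [NormedSpace ℝ E] [FlatTorus X E] [IsFlatTorus X E]
  [NormedAddCommGroup Y] [NormedAddCommGroup F] [NormedSpace ℝ F] [FlatTorus Y F] [IsFlatTorus Y F]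

/-- The curve `u` in a torus has velocity `u'` at time `t`. -/
def HasVelocityAt (u : ℝ → X) (u' : E) (t : ℝ) : Prop :=
  HasDerivAt (fun h : ℝ => (rep (u (t + h) - u t) : E)) u' 0

theorem HasDerivAt.hasVelocityAt {c : ℝ → E} {c' : E} {t : ℝ} (h : HasDerivAt c c' t) :
    HasVelocityAt (fun s => (proj (c s) : X)) c' t := by
  have h1 : HasDerivAt (fun s : ℝ => c (t + s) - c t) c' 0 := by
    have h2 : HasDerivAt c c' (t + 0) := by simpa using h
    exact (HasDerivAt.comp_const_add t 0 h2).sub_const _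
  refine h1.congr_of_eventuallyEq ?_
  have h3 : ∀ᶠ s in 𝓝 (0 : ℝ), ‖c (t + s) - c t‖ < 1 / 2 := by
    refine h1.continuousAt.norm.eventually_lt continuousAt_const ?_
    simp
  filter_upwards [h3] with s hs
  rw [← proj_sub, IsFlatTorus.rep_proj _ hs]

theorem HasVelocityAt.map {u : ℝ → X} {u' : E} {t : ℝ} (hu : HasVelocityAt u u' t) {f : X → Y}
    {n : ℕ∞} (hf : IsCn n f) (hn : n ≠ 0) :
    HasVelocityAt (fun s => f (u s)) (D f (u t) u') t := by
  have h1 : (fun h : ℝ => (rep (f (u (t + h)) - f (u t)) : F)) =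
      localRep f (u t) ∘ fun h : ℝ => (rep (u (t + h) - u t) : E) := by
    funext h
    simp only [Function.comp, localRep_def, add_proj_rep]
  rw [HasVelocityAt, h1]
  refine HasFDerivAt.comp_hasDerivAt (x := (0 : ℝ)) ?_ hu
  simpa [rep_zero] using hf.hasFDerivAt hn (u t)

theorem HasVelocityAt.snd {u : ℝ → T4} {u' : R4} {t : ℝ} (hu : HasVelocityAt u u' t) :
    HasVelocityAt (fun s => (u s).2) u'.2 t :=
  (ContinuousLinearMap.snd ℝ R2 R2).hasFDerivAt.comp_hasDerivAt (x := (0 : ℝ)) hu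

theorem hasVelocityAt_const (x : X) (t : ℝ) : HasVelocityAt (fun _ => x) 0 t := by
  simpa [HasVelocityAt, rep_zero] using hasDerivAt_const (0 : ℝ) (0 : E)

theorem HasVelocityAt.prodMk {u v : ℝ → T2} {u' v' : R2} {t : ℝ} (hu : HasVelocityAt u u' t)
    (hv : HasVelocityAt v v' t) :
    HasVelocityAt (fun s => ((u s, v s) : T4)) ((u', v') : R4) t :=
  HasDerivAt.prodMk hu hv

theorem HasVelocityAt.continuousAt {u : ℝ → X} {u' : E} {t : ℝ} (hu : HasVelocityAt u u' t) :
    ContinuousAt u t := by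
  have h1 : u = fun s => u t + proj ((fun h : ℝ => (rep (u (t + h) - u t) : E)) (s - t)) := by
    funext s
    simp [IsFlatTorus.proj_rep]
  rw [h1]
  refine continuousAt_const.add (continuous_proj.continuousAt.comp' ?_)
  refine ContinuousAt.comp' (f := fun s : ℝ => s - t)
    (g := fun h : ℝ => (rep (u (t + h) - u t) : E)) ?_ (by fun_prop)
  simpa using HasDerivAt.continuousAt hu

/-- The difference of the two sides has increments that are projections of o(h), so its norm has
zero derivative. This produces a lift of `u` from its velocity alone. -/
theorem eq_proj_integral [CompleteSpace E] {u : ℝ → X} {u' : ℝ → E}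
    (hu : ∀ t, HasVelocityAt u (u' t) t) (hc : Continuous u') {v : E} (hv : proj v = u 0) (t : ℝ) :
    u t = proj (v + ∫ s in (0 : ℝ)..t, u' s) := by
  set I : ℝ → E := fun t => v + ∫ s in (0 : ℝ)..t, u' s with hI
  have hId : ∀ t, HasDerivAt I (u' t) t := fun t =>
    (intervalIntegral.integral_hasDerivAt_right (hc.intervalIntegrable _ _)
      (hc.stronglyMeasurableAtFilter _ _) hc.continuousAt).const_add v
  set d : ℝ → X := fun t => u t - proj (I t) with hd
  have key : ∀ t, HasDerivAt (fun t => ‖d t‖) 0 t := by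
    intro t
    have h1 : HasDerivAt (fun h : ℝ => (rep (u (t + h) - u t) : E) - (I (t + h) - I t))
        (u' t - u' t) 0 := by
      refine HasDerivAt.sub (hu t) ?_
      have h2 : HasDerivAt I (u' t) (t + 0) := by simpa using hId t
      exact (HasDerivAt.comp_const_add t 0 h2).sub_const _
    rw [sub_self, hasDerivAt_iff_isLittleO] at h1
    have h3 : HasDerivAt (fun h : ℝ => ‖d (t + h)‖) 0 0 := by
      rw [hasDerivAt_iff_isLittleO]
      refine Asymptotics.IsBigO.trans_isLittleO ?_ h1
      refine Asymptotics.IsBigO.of_bound 1 (Eventually.of_forall fun h => ?_)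
      simp only [smul_zero, sub_zero, add_zero, sub_self, rep_zero, one_mul]
      have e : d (t + h) - d t = proj ((rep (u (t + h) - u t) : E) - (I (t + h) - I t)) := by
        rw [proj_sub, IsFlatTorus.proj_rep, proj_sub]
        simp only [hd]
        abel
      calc ‖‖d (t + h)‖ - ‖d t‖‖ ≤ ‖d (t + h) - d t‖ := abs_norm_sub_norm_le _ _
        _ ≤ _ := by rw [e]; exact IsFlatTorus.norm_proj_le _
    have h4 := HasDerivAt.comp_add_const t (-t) (f := fun h : ℝ => ‖d (t + h)‖) (f' := 0)
      (by simpa using h3)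
    simpa using h4
  have h0 : ‖d t‖ = ‖d 0‖ :=
    is_const_of_deriv_eq_zero (fun t => (key t).differentiableAt) (fun t => (key t).deriv) t 0
  have h1 : d 0 = 0 := by simp [hd, hI, hv]
  rw [h1, norm_zero, norm_eq_zero] at h0
  exact sub_eq_zero.1 h0

theorem dist_le_integral [CompleteSpace E] {u : ℝ → X} {u' : ℝ → E}
    (hu : ∀ t, HasVelocityAt u (u' t) t) (hc : Continuous u') {t : ℝ} (ht : 0 ≤ t) :
    dist (u 0) (u t) ≤ ∫ s in (0 : ℝ)..t, ‖u' s‖ := by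
  have h := eq_proj_integral hu hc (IsFlatTorus.proj_rep (u 0)) t
  rw [IsFlatTorus.proj_add, IsFlatTorus.proj_rep] at h
  rw [dist_comm, dist_eq_norm, h, add_sub_cancel_left]
  exact (IsFlatTorus.norm_proj_le _).trans
    (intervalIntegral.norm_integral_le_integral_norm ht)

/-- The projection of a straight segment joining two points of a torus. -/
theorem exists_segment (x y : X) : ∃ v : E, ‖v‖ ≤ 2 * dist x y ∧
    x + proj ((1 : ℝ) • v) = y ∧ ∀ t : ℝ, HasVelocityAt (fun s : ℝ => x + proj (s • v)) v t := by
  refine ⟨rep (y - x), ?_, ?_, fun t => ?_⟩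
  · rw [dist_comm, dist_eq_norm]
    exact IsFlatTorus.norm_rep_le _
  · rw [one_smul, add_proj_rep]
  · have h1 : HasDerivAt (fun s : ℝ => (rep x : E) + s • rep (y - x)) (rep (y - x)) t := by
      simpa using ((hasDerivAt_id t).smul_const (rep (y - x) : E)).const_add (rep x : E)
    have h2 := HasDerivAt.hasVelocityAt (X := X) h1
    simpa only [IsFlatTorus.proj_add, IsFlatTorus.proj_rep] using h2

/-- The image of a straight segment is measured by `dist_le_integral`; the factor 2 compares the
segment with the torus distance. -/
theorem dist_map_le [CompleteSpace F] {f : X → Y} {n : ℕ∞} (hf : IsCn n f) (hn : n ≠ 0) {M : ℝ}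
    (hM : ∀ p, ‖D f p‖ ≤ M) (x y : X) : dist (f x) (f y) ≤ 2 * M * dist x y := by
  obtain ⟨v, hv, h1, hvel⟩ := exists_segment x y
  have hc : Continuous fun s : ℝ => D f (x + proj (s • v)) v := by
    have h1 := hf.continuous_D hn
    have h2 := continuous_proj (X := X) (E := E)
    fun_prop
  have h := dist_le_integral (fun t => (hvel t).map hf hn) hc zero_le_one
  rw [h1, zero_smul, proj_zero, add_zero] at h
  have hM0 : 0 ≤ M := (norm_nonneg (D f x)).trans (hM x)
  have h3 : ∫ s in (0 : ℝ)..1, ‖D f (x + proj (s • v)) v‖ ≤ ∫ s in (0 : ℝ)..1, M * ‖v‖ := by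
    refine intervalIntegral.integral_mono_on zero_le_one (hc.norm.intervalIntegrable _ _)
      (by simp) fun s _ => ?_
    exact (ContinuousLinearMap.le_opNorm _ _).trans (by gcongr; exact hM _)
  simp only [intervalIntegral.integral_const, sub_zero, one_smul] at h3
  nlinarith

end Curves

/-! ### Fibre maps and transfer maps -/

/-- The map induced by `f` on the fibre over `b`, in the coordinate of the fibre. -/
def fibreMap (f : T4 → T4) (b : T2) (x : T2) : T2 := (f (x, b)).1

/-- The derivative of `f` along the fibres. -/
def fibreD (f : T4 → T4) (p : T4) : R2 →L[ℝ] R2 := D (fibreMap f p.2) p.1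

/-- The second derivative of `f` along the fibres. -/
def fibreD2 (f : T4 → T4) (p : T4) : R2 →L[ℝ] R2 →L[ℝ] R2 := D2 (fibreMap f p.2) p.1

/-- The map from the fibre over `b` to that over `b'` which goes `n` steps back, changes the fibre
without moving the fibre coordinate, and returns. -/
def transfer (f : T4 ≃ T4) (f₂ : T2 ≃ T2) (n : ℕ) (b b' : T2) (x : T2) : T2 :=
  (f^[n] ((f.symm^[n] (x, b)).1, f₂.symm^[n] b')).1

/-- The backward orbits of `b` and `b'` approach each other at the rate `χ⁻ⁿ`. -/
def BackwardClose (f₂ : T2 ≃ T2) (χ ε : ℝ) (b b' : T2) : Prop :=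
  ∀ n : ℕ, dist (f₂.symm^[n] b) (f₂.symm^[n] b') ≤ ε * χ⁻¹ ^ n

/-- Quantitative properties of the fibre maps of a skew product from which the convergence of
the transfer maps follows; `N` is a family of norms on the tangent spaces of the fibres. -/
structure FibreBounds (f : T4 ≃ T4) (f₂ : T2 ≃ T2) (N : T4 → R2 → ℝ) (α χm χp χuu K : ℝ) :
    Prop where
  semiconj : ∀ p, (f p).2 = f₂ p.2
  isCn : ∀ b, IsCn 2 (fibreMap f b)
  isCn_symm : ∀ b, IsCn 2 (fibreMap f.symm b)
  continuous : Continuous f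
  continuous_symm : Continuous f.symm
  continuous_base_symm : Continuous f₂.symm
  continuous_D : Continuous (fibreD f)
  continuous_D2 : Continuous (fibreD2 f)
  continuous_D_symm : Continuous (fibreD f.symm)
  continuous_D2_symm : Continuous (fibreD2 f.symm)
  α_pos : 0 < α
  α_le : α ≤ 1
  m_pos : 0 < χm
  m_le_p : χm ≤ χp
  one_lt_uu : 1 < χuu
  p_lt : χp / χuu < 1
  bunch₁ : χp / χm / χuu < 1
  bunch₂ : χp / χm ^ 2 / χuu ^ α < 1
  one_le_K : 1 ≤ K
  lip : ∀ x b b', dist (fibreMap f b x) (fibreMap f b' x) ≤ K * dist b b'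
  norm_D2 : ∀ p, ‖fibreD2 f p‖ ≤ K
  lip_D : ∀ p q, ‖fibreD f p - fibreD f q‖ ≤ K * dist p q
  holder_D2 : ∀ p q, ‖fibreD2 f p - fibreD2 f q‖ ≤ K * dist p q ^ α
  N_add : ∀ p v w, N p (v + w) ≤ N p v + N p w
  N_nonneg : ∀ p v, 0 ≤ N p v
  N_le : ∀ p v, N p v ≤ K * ‖v‖
  le_N : ∀ p v, ‖v‖ ≤ K * N p v
  N_D_le : ∀ p v, N (f p) (fibreD f p v) ≤ χp * N p v
  le_N_D : ∀ p v, χm * N p v ≤ N (f p) (fibreD f p v)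
  iterate_lip : ∀ (n : ℕ) y y' b,
    dist (f^[n] (y, b)).1 (f^[n] (y', b)).1 ≤ K * χp ^ n * dist y y'

section Transfer

variable {f : T4 ≃ T4} {f₂ : T2 ≃ T2}

theorem symm_semiconj (hs : ∀ p, (f p).2 = f₂ p.2) (p : T4) : (f.symm p).2 = f₂.symm p.2 := by
  rw [Equiv.eq_symm_apply, ← hs, Equiv.apply_symm_apply]

theorem iterate_snd (hs : ∀ p, (f p).2 = f₂ p.2) (n : ℕ) (p : T4) :
    (f^[n] p).2 = f₂^[n] p.2 := by
  induction n generalizing p with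
  | zero => rfl
  | succ n ih => rw [Function.iterate_succ_apply, ih, hs, Function.iterate_succ_apply]

theorem symm_iterate_iterate {β : Type} (e : β ≃ β) (n : ℕ) (p : β) : e.symm^[n] (e^[n] p) = p :=
  Function.LeftInverse.iterate e.left_inv n p

theorem iterate_symm_iterate {β : Type} (e : β ≃ β) (n : ℕ) (p : β) : e^[n] (e.symm^[n] p) = p :=
  Function.RightInverse.iterate e.right_inv n p

theorem transfer_zero (b b' x : T2) : transfer f f₂ 0 b b' x = x := rfl

theorem transfer_mk (hs : ∀ p, (f p).2 = f₂ p.2) (n : ℕ) (b b' x : T2) :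
    f^[n] ((f.symm^[n] (x, b)).1, f₂.symm^[n] b') = (transfer f f₂ n b b' x, b') :=
  Prod.ext rfl (by rw [iterate_snd hs, iterate_symm_iterate])

theorem fibreMap_mk (hs : ∀ p, (f p).2 = f₂ p.2) (b x : T2) :
    f (x, f₂.symm b) = (fibreMap f (f₂.symm b) x, b) :=
  Prod.ext rfl (by rw [hs, Equiv.apply_symm_apply])

theorem fibreMap_symm_mk (hs : ∀ p, (f p).2 = f₂ p.2) (b x : T2) :
    f.symm (x, b) = (fibreMap f.symm b x, f₂.symm b) :=
  Prod.ext rfl (symm_semiconj hs _)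

theorem fibreMap_fibreMap_symm (hs : ∀ p, (f p).2 = f₂ p.2) (b x : T2) :
    fibreMap f (f₂.symm b) (fibreMap f.symm b x) = x := by
  rw [fibreMap, ← fibreMap_symm_mk hs, Equiv.apply_symm_apply]

theorem fibreMap_symm_fibreMap (hs : ∀ p, (f p).2 = f₂ p.2) (b x : T2) :
    fibreMap f.symm b (fibreMap f (f₂.symm b) x) = x := by
  rw [fibreMap, ← fibreMap_mk hs, Equiv.symm_apply_apply]

/-- Peeling off the first backward and the last forward step gives the graph transform on which all
inductions run; the base points move to their preimages, which are closer by the factor χuu. -/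
theorem transfer_succ (hs : ∀ p, (f p).2 = f₂ p.2) (n : ℕ) (b b' : T2) :
    transfer f f₂ (n + 1) b b' = fibreMap f (f₂.symm b') ∘
      (transfer f f₂ n (f₂.symm b) (f₂.symm b') ∘ fibreMap f.symm b) := by
  funext x
  simp only [Function.comp]
  rw [transfer, Function.iterate_succ_apply', Function.iterate_succ_apply, fibreMap_symm_mk hs,
    Function.iterate_succ_apply, transfer_mk hs]
  rfl

/-- Removing the inverse fibre map allows differentiation without estimates on derivatives of
`f.symm`. -/
theorem transfer_succ_comp (hs : ∀ p, (f p).2 = f₂ p.2) (n : ℕ) (b b' : T2) :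
    transfer f f₂ (n + 1) b b' ∘ fibreMap f (f₂.symm b) =
      fibreMap f (f₂.symm b') ∘ transfer f f₂ n (f₂.symm b) (f₂.symm b') := by
  rw [transfer_succ hs]
  funext x
  simp only [Function.comp, fibreMap_symm_fibreMap hs]

/-- Comparisons of transfer maps are made at time `-n`, where the base points are very close, and
then carried forward by `f^[n]`. -/
theorem transfer_add (hs : ∀ p, (f p).2 = f₂ p.2) (m n : ℕ) (b b' x : T2) :
    transfer f f₂ (m + n) b b' x =
      (f^[n] (transfer f f₂ m (f₂.symm^[n] b) (f₂.symm^[n] b') (f.symm^[n] (x, b)).1,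
        f₂.symm^[n] b')).1 := by
  have h : (f.symm^[n] (x, b)).2 = f₂.symm^[n] b := iterate_snd (symm_semiconj hs) n _
  rw [transfer, add_comm m n, Function.iterate_add_apply, ← transfer_mk hs, ← h,
    add_comm n m, Function.iterate_add_apply f.symm, Function.iterate_add_apply f₂.symm]

theorem transfer_transfer (hs : ∀ p, (f p).2 = f₂ p.2) (n : ℕ) (b b' x : T2) :
    transfer f f₂ n b' b (transfer f f₂ n b b' x) = x := by
  have h : (f.symm^[n] (x, b)).2 = f₂.symm^[n] b := iterate_snd (symm_semiconj hs) n _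
  rw [transfer, ← transfer_mk hs, symm_iterate_iterate, ← h]
  exact congrArg Prod.fst (iterate_symm_iterate f n (x, b))

theorem BackwardClose.nonneg {χ ε : ℝ} {b b' : T2} (h : BackwardClose f₂ χ ε b b') : 0 ≤ ε := by
  simpa using dist_nonneg.trans (h 0)

theorem BackwardClose.symm {χ ε : ℝ} {b b' : T2} (h : BackwardClose f₂ χ ε b b') :
    BackwardClose f₂ χ ε b' b := fun n => by
  rw [dist_comm]
  exact h n

theorem BackwardClose.iterate {χ ε : ℝ} {b b' : T2} (h : BackwardClose f₂ χ ε b b') (n : ℕ) :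
    BackwardClose f₂ χ (ε * χ⁻¹ ^ n) (f₂.symm^[n] b) (f₂.symm^[n] b') := fun m => by
  rw [← Function.iterate_add_apply, ← Function.iterate_add_apply, mul_assoc, ← pow_add, add_comm n]
  exact h _

theorem BackwardClose.shift {χ ε : ℝ} {b b' : T2} (h : BackwardClose f₂ χ ε b b') :
    BackwardClose f₂ χ (ε / χ) (f₂.symm b) (f₂.symm b') := by
  simpa [div_eq_mul_inv] using h.iterate 1

end Transfer

/-! ### Jets of the transfer maps and one-step contraction -/

namespace FibreBounds

variable {f : T4 ≃ T4} {f₂ : T2 ≃ T2} {N : T4 → R2 → ℝ} {α χm χp χuu K : ℝ}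

theorem isCn_transfer (h : FibreBounds f f₂ N α χm χp χuu K) (n : ℕ) (b b' : T2) :
    IsCn 2 (transfer f f₂ n b b') := by
  induction n generalizing b b' with
  | zero => exact isCn_id 2
  | succ n ih =>
    rw [transfer_succ h.semiconj]
    exact (h.isCn _).comp ((ih _ _).comp (h.isCn_symm _))

theorem D_transfer_succ_apply (h : FibreBounds f f₂ N α χm χp χuu K) (n : ℕ) (b b' x : T2)
    (v : R2) :
    D (transfer f f₂ (n + 1) b b') (fibreMap f (f₂.symm b) x) (fibreD f (x, f₂.symm b) v) =
      fibreD f (transfer f f₂ n (f₂.symm b) (f₂.symm b') x, f₂.symm b')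
        (D (transfer f f₂ n (f₂.symm b) (f₂.symm b')) x v) := by
  have h1 := congrArg (fun φ => D φ x v) (transfer_succ_comp h.semiconj n b b')
  rw [D_comp (h.isCn_transfer _ _ _) (h.isCn _) two_ne_zero,
    D_comp (h.isCn _) (h.isCn_transfer _ _ _) two_ne_zero] at h1
  exact h1

/-- Both sides of `transfer_succ_comp` are differentiated twice; the subtracted term is the
curvature of the inner fibre map on the left. -/
theorem D2_transfer_succ_apply (h : FibreBounds f f₂ N α χm χp χuu K) (n : ℕ) (b b' x : T2)
    (u v : R2) :
    D2 (transfer f f₂ (n + 1) b b') (fibreMap f (f₂.symm b) x) (fibreD f (x, f₂.symm b) u)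
        (fibreD f (x, f₂.symm b) v) =
      fibreD f (transfer f f₂ n (f₂.symm b) (f₂.symm b') x, f₂.symm b')
        (D2 (transfer f f₂ n (f₂.symm b) (f₂.symm b')) x u v) +
      fibreD2 f (transfer f f₂ n (f₂.symm b) (f₂.symm b') x, f₂.symm b')
        (D (transfer f f₂ n (f₂.symm b) (f₂.symm b')) x u)
        (D (transfer f f₂ n (f₂.symm b) (f₂.symm b')) x v) -
      D (transfer f f₂ (n + 1) b b') (fibreMap f (f₂.symm b) x)
        (fibreD2 f (x, f₂.symm b) u v) := by
  have h1 := congrArg (fun φ => D2 φ x u v) (transfer_succ_comp h.semiconj n b b')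
  rw [D2_comp (h.isCn_transfer _ _ _) (h.isCn _), D2_comp (h.isCn _) (h.isCn_transfer _ _ _)] at h1
  rw [eq_sub_iff_add_eq, add_comm (fibreD f _ _)]
  exact h1

/-- Joint continuity in both base points and the fibre point is what the uniform limit inherits. It
propagates through the recursion by the chain rules. -/
theorem continuous_jet2_transfer (h : FibreBounds f f₂ N α χm χp χuu K) (n : ℕ) :
    Continuous fun z : (T2 × T2) × T2 => jet2 (transfer f f₂ n z.1.1 z.1.2) z.2 := by
  induction n with
  | zero =>
    have e : ∀ b b' : T2, transfer f f₂ 0 b b' = id := fun _ _ => rfl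
    simp only [jet2, e, D_id, D2_id, id]
    fun_prop
  | succ n ih =>
    set s : (T2 × T2) × T2 → (T2 × T2) × T2 := fun z =>
      ((f₂.symm z.1.1, f₂.symm z.1.2), fibreMap f.symm z.1.1 z.2) with hs
    have hsc : Continuous s := by
      have h1 := h.continuous_base_symm
      have h2 := h.continuous_symm
      simp only [hs, fibreMap]
      fun_prop
    have hj := ih.comp hsc
    have h0 : Continuous fun z => transfer f f₂ n (s z).1.1 (s z).1.2 (s z).2 := hj.fst
    have h1 : Continuous fun z => D (transfer f f₂ n (s z).1.1 (s z).1.2) (s z).2 := hj.snd.fst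
    have h2 : Continuous fun z => D2 (transfer f f₂ n (s z).1.1 (s z).1.2) (s z).2 := hj.snd.snd
    set q : (T2 × T2) × T2 → T4 := fun z =>
      (transfer f f₂ n (s z).1.1 (s z).1.2 (s z).2, (s z).1.2) with hq
    have hqc : Continuous q := h0.prodMk (by fun_prop)
    have hr : Continuous fun z : (T2 × T2) × T2 => ((z.2, z.1.1) : T4) := by fun_prop
    have a1 : Continuous fun z => fibreD f (q z) := h.continuous_D.comp hqc
    have a2 : Continuous fun z => fibreD2 f (q z) := h.continuous_D2.comp hqc
    have a3 : Continuous fun z : (T2 × T2) × T2 => fibreD f.symm (z.2, z.1.1) :=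
      h.continuous_D_symm.comp hr
    have a4 : Continuous fun z : (T2 × T2) × T2 => fibreD2 f.symm (z.2, z.1.1) :=
      h.continuous_D2_symm.comp hr
    refine Continuous.prodMk ?_ (Continuous.prodMk ?_ ?_)
    · simp only [transfer_succ h.semiconj]
      exact (h.continuous.comp hqc).fst
    · have e : ∀ z : (T2 × T2) × T2, D (transfer f f₂ (n + 1) z.1.1 z.1.2) z.2 =
          (fibreD f (q z)).comp ((D (transfer f f₂ n (s z).1.1 (s z).1.2) (s z).2).comp
            (fibreD f.symm (z.2, z.1.1))) := fun z => by
        rw [transfer_succ h.semiconj, D_comp (h.isCn _) ((h.isCn_transfer _ _ _).comp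
          (h.isCn_symm _)) two_ne_zero, D_comp (h.isCn_transfer _ _ _) (h.isCn_symm _) two_ne_zero]
        rfl
      simp only [e]
      exact a1.clm_comp (h1.clm_comp a3)
    · have e : ∀ (z : (T2 × T2) × T2) (u v : R2),
          D2 (transfer f f₂ (n + 1) z.1.1 z.1.2) z.2 u v =
          fibreD2 f (q z) (D (transfer f f₂ n (s z).1.1 (s z).1.2) (s z).2
              (fibreD f.symm (z.2, z.1.1) u)) (D (transfer f f₂ n (s z).1.1 (s z).1.2) (s z).2
              (fibreD f.symm (z.2, z.1.1) v)) +
            fibreD f (q z) (D2 (transfer f f₂ n (s z).1.1 (s z).1.2) (s z).2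
              (fibreD f.symm (z.2, z.1.1) u) (fibreD f.symm (z.2, z.1.1) v) +
              D (transfer f f₂ n (s z).1.1 (s z).1.2) (s z).2
                (fibreD2 f.symm (z.2, z.1.1) u v)) := fun z u v => by
        rw [transfer_succ h.semiconj, D2_comp (h.isCn _) ((h.isCn_transfer _ _ _).comp
          (h.isCn_symm _)), D_comp (h.isCn_transfer _ _ _) (h.isCn_symm _) two_ne_zero,
          D2_comp (h.isCn_transfer _ _ _) (h.isCn_symm _)]
        rfl
      refine continuous_clm_apply.2 fun u => continuous_clm_apply.2 fun v => ?_
      simp only [e]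
      fun_prop

/-- The positive conorm gives injectivity, and the dimension is finite. The step estimates need it
to write any vector over `f p` as an image and then divide by the conorm. -/
theorem fibreD_surjective (h : FibreBounds f f₂ N α χm χp χuu K) (p : T4) :
    Function.Surjective (fibreD f p) := by
  have hinj : Function.Injective (fibreD f p) := by
    refine (injective_iff_map_eq_zero _).2 fun v hv => ?_
    have h1 := h.le_N_D p v
    have h2 := h.N_le (f p) (fibreD f p v)
    rw [hv] at h1 h2
    rw [norm_zero, mul_zero] at h2
    have h3 : N p v ≤ 0 := by
      have := h.m_pos
      by_contra hn
      push Not at hn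
      nlinarith [mul_pos this hn]
    have h4 := h.le_N p v
    have h5 : ‖v‖ ≤ 0 := h4.trans (mul_nonpos_of_nonneg_of_nonpos
      (zero_le_one.trans h.one_le_K) h3)
    exact norm_le_zero_iff.1 h5
  exact (LinearMap.injective_iff_surjective (f := (fibreD f p).toLinearMap)).1 hinj

theorem norm_le_of_N_le (h : FibreBounds f f₂ N α χm χp χuu K) {p q : T4} {S : R2 →L[ℝ] R2}
    {e : ℝ} (he : 0 ≤ e) (hS : ∀ v, N q (S v) ≤ e * N p v) : ‖S‖ ≤ K ^ 2 * e := by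
  have hK := zero_le_one.trans h.one_le_K
  refine ContinuousLinearMap.opNorm_le_bound _ (by positivity) fun v => ?_
  calc ‖S v‖ ≤ K * N q (S v) := h.le_N _ _
    _ ≤ K * (e * (K * ‖v‖)) := by
      gcongr
      exact (hS v).trans (by gcongr; exact h.N_le _ _)
    _ = _ := by ring

theorem norm_le_of_N_le₂ (h : FibreBounds f f₂ N α χm χp χuu K) {p q : T4}
    {S : R2 →L[ℝ] R2 →L[ℝ] R2} {e : ℝ} (he : 0 ≤ e)
    (hS : ∀ u v, N q (S u v) ≤ e * N p u * N p v) : ‖S‖ ≤ K ^ 3 * e := by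
  have hK := zero_le_one.trans h.one_le_K
  refine ContinuousLinearMap.opNorm_le_bound₂ _ (by positivity) fun u v => ?_
  calc ‖S u v‖ ≤ K * N q (S u v) := h.le_N _ _
    _ ≤ K * (e * (K * ‖u‖) * (K * ‖v‖)) := by
      gcongr
      refine (hS u v).trans ?_
      have := h.N_nonneg p u
      have := h.N_nonneg p v
      gcongr
      · exact h.N_le _ _
      · exact h.N_le _ _
    _ = _ := by ring

/-- One step of the graph transform contracts the distance of two candidate derivatives, up to
an error due to the distance `δ` of the base points. -/
theorem step_D (h : FibreBounds f f₂ N α χm χp χuu K) {p q r : T4} {S T S' T' : R2 →L[ℝ] R2}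
    {e M δ : ℝ} (hM : ‖T‖ ≤ M) (hδ : dist q r ≤ δ)
    (he : ∀ v, N q (S v - T v) ≤ e * N p v)
    (hS : ∀ v, S' (fibreD f p v) = fibreD f q (S v))
    (hT : ∀ v, T' (fibreD f p v) = fibreD f r (T v)) (w : R2) :
    N (f q) (S' w - T' w) ≤ (χp * e + K ^ 3 * M * δ) / χm * N (f p) w := by
  obtain ⟨v, rfl⟩ := h.fibreD_surjective p w
  have hK := zero_le_one.trans h.one_le_K
  have hχp : 0 ≤ χp := h.m_pos.le.trans h.m_le_p
  have hM0 : 0 ≤ M := (norm_nonneg _).trans hM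
  have hδ0 : 0 ≤ δ := dist_nonneg.trans hδ
  have hc : 0 ≤ χp * e * N p v + K ^ 3 * M * δ * N p v := by
    have h1 := (h.N_nonneg q (S v - T v)).trans (he v)
    have h2 := h.N_nonneg p v
    have h3 : 0 ≤ χp * (e * N p v) := by positivity
    have h4 : 0 ≤ K ^ 3 * M * δ * N p v := by positivity
    linarith
  -- Contracted difference at the same base point, plus the effect of moving the base point from `r`
  -- to `q`.
  have e1 : S' (fibreD f p v) - T' (fibreD f p v) =
      fibreD f q (S v - T v) + (fibreD f q - fibreD f r) (T v) := by
    rw [hS, hT, map_sub]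
    simp
  have e2 : ‖(fibreD f q - fibreD f r) (T v)‖ ≤ K * δ * (M * (K * N p v)) := by
    refine (ContinuousLinearMap.le_opNorm _ _).trans ?_
    gcongr
    · exact (h.lip_D _ _).trans (by gcongr)
    · refine (ContinuousLinearMap.le_opNorm _ _).trans ?_
      gcongr
      exact h.le_N _ _
  have e3 : N (f q) (S' (fibreD f p v) - T' (fibreD f p v)) ≤
      χp * e * N p v + K ^ 3 * M * δ * N p v := by
    rw [e1]
    refine (h.N_add _ _ _).trans (add_le_add ?_ ?_)
    · refine (h.N_D_le _ _).trans ?_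
      rw [mul_assoc]
      gcongr
      exact he v
    · refine (h.N_le _ _).trans ?_
      calc K * ‖(fibreD f q - fibreD f r) (T v)‖ ≤ K * (K * δ * (M * (K * N p v))) := by gcongr
        _ = _ := by ring
  refine e3.trans ?_
  have h5 := h.le_N_D p v
  have hm := h.m_pos
  rw [div_mul_eq_mul_div, le_div_iff₀ hm]
  -- No sign is assumed for `e`: a vector with `N p v ≠ 0` forces the numerator to be nonnegative,
  -- and otherwise both sides vanish.
  by_cases hNv : N p v = 0
  · rw [hNv] at hc ⊢
    simp only [mul_zero, add_zero, zero_mul]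
    have hw : N (f p) (fibreD f p v) = 0 :=
      le_antisymm ((h.N_D_le p v).trans (by rw [hNv, mul_zero])) (h.N_nonneg _ _)
    rw [hw, mul_zero]
  · have h6 : 0 < N p v := lt_of_le_of_ne (h.N_nonneg _ _) (Ne.symm hNv)
    have h7 : 0 ≤ χp * e + K ^ 3 * M * δ := by
      have : 0 ≤ (χp * e + K ^ 3 * M * δ) * N p v := by linarith
      exact nonneg_of_mul_nonneg_left this h6
    nlinarith [mul_le_mul_of_nonneg_left h5 h7]

/-- The analogue of `step_D` for second derivatives; `κ` bounds all the error terms. -/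
theorem step_D2 (h : FibreBounds f f₂ N α χm χp χuu K) {p q r : T4} {S T S' T' : R2 →L[ℝ] R2}
    {S2 T2 S2' T2' : R2 →L[ℝ] R2 →L[ℝ] R2} {e M κ : ℝ} (he0 : 0 ≤ e) (hM1 : 1 ≤ M)
    (hSM : ‖S‖ ≤ M) (hTM : ‖T‖ ≤ M) (hT2M : ‖T2‖ ≤ M)
    (hδ : dist q r ≤ κ) (hδα : dist q r ^ α ≤ κ) (hST : ‖S - T‖ ≤ κ) (hST' : ‖S' - T'‖ ≤ κ)
    (he : ∀ u v, N q (S2 u v - T2 u v) ≤ e * N p u * N p v)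
    (hS : ∀ u v, S2' (fibreD f p u) (fibreD f p v) =
      fibreD f q (S2 u v) + fibreD2 f q (S u) (S v) - S' (fibreD2 f p u v))
    (hT : ∀ u v, T2' (fibreD f p u) (fibreD f p v) =
      fibreD f r (T2 u v) + fibreD2 f r (T u) (T v) - T' (fibreD2 f p u v)) (w₁ w₂ : R2) :
    N (f q) (S2' w₁ w₂ - T2' w₁ w₂) ≤
      (χp * e + 5 * K ^ 4 * M ^ 2 * κ) / χm ^ 2 * N (f p) w₁ * N (f p) w₂ := by
  obtain ⟨u, rfl⟩ := h.fibreD_surjective p w₁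
  obtain ⟨v, rfl⟩ := h.fibreD_surjective p w₂
  have hK1 := h.one_le_K
  have hK := zero_le_one.trans hK1
  have hM0 : 0 ≤ M := zero_le_one.trans hM1
  have hχp : 0 ≤ χp := h.m_pos.le.trans h.m_le_p
  have hκ : 0 ≤ κ := dist_nonneg.trans hδ
  have hu := h.N_nonneg p u
  have hv := h.N_nonneg p v
  -- Only the first term involves the unknown second derivatives at a common base point. The five
  -- others vary one factor at a time; each is at most M²·K·κ·‖u‖·‖v‖, whence the 5.
  have e1 : S2' (fibreD f p u) (fibreD f p v) - T2' (fibreD f p u) (fibreD f p v) =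
      fibreD f q (S2 u v - T2 u v) + ((fibreD f q - fibreD f r) (T2 u v) +
        fibreD2 f q ((S - T) u) (S v) + fibreD2 f q (T u) ((S - T) v) +
        (fibreD2 f q - fibreD2 f r) (T u) (T v) - (S' - T') (fibreD2 f p u v)) := by
    rw [hS, hT]
    simp only [map_sub, sub_apply]
    abel
  have b1 : ‖(fibreD f q - fibreD f r) (T2 u v)‖ ≤ K * κ * (M * ‖u‖ * ‖v‖) := by
    refine (ContinuousLinearMap.le_opNorm _ _).trans ?_
    gcongr
    · exact (h.lip_D _ _).trans (by gcongr)
    · exact (ContinuousLinearMap.le_opNorm₂ _ _ _).trans (by gcongr)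
  have b2 : ‖fibreD2 f q ((S - T) u) (S v)‖ ≤ K * (κ * ‖u‖) * (M * ‖v‖) := by
    refine (ContinuousLinearMap.le_opNorm₂ _ _ _).trans ?_
    gcongr
    · exact h.norm_D2 _
    · exact (ContinuousLinearMap.le_opNorm _ _).trans (by gcongr)
    · exact (ContinuousLinearMap.le_opNorm _ _).trans (by gcongr)
  have b3 : ‖fibreD2 f q (T u) ((S - T) v)‖ ≤ K * (M * ‖u‖) * (κ * ‖v‖) := by
    refine (ContinuousLinearMap.le_opNorm₂ _ _ _).trans ?_
    gcongr
    · exact h.norm_D2 _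
    · exact (ContinuousLinearMap.le_opNorm _ _).trans (by gcongr)
    · exact (ContinuousLinearMap.le_opNorm _ _).trans (by gcongr)
  have b4 : ‖(fibreD2 f q - fibreD2 f r) (T u) (T v)‖ ≤ K * κ * (M * ‖u‖) * (M * ‖v‖) := by
    refine (ContinuousLinearMap.le_opNorm₂ _ _ _).trans ?_
    gcongr
    · exact (h.holder_D2 _ _).trans (by gcongr)
    · exact (ContinuousLinearMap.le_opNorm _ _).trans (by gcongr)
    · exact (ContinuousLinearMap.le_opNorm _ _).trans (by gcongr)
  have b5 : ‖(S' - T') (fibreD2 f p u v)‖ ≤ κ * (K * ‖u‖ * ‖v‖) := by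
    refine (ContinuousLinearMap.le_opNorm _ _).trans ?_
    gcongr
    refine (ContinuousLinearMap.le_opNorm₂ _ _ _).trans ?_
    gcongr
    exact h.norm_D2 _
  set t := K * κ * (‖u‖ * ‖v‖) with ht
  have ht0 : 0 ≤ t := by positivity
  have hMM : M ≤ M ^ 2 := by nlinarith
  have h1M : 1 ≤ M ^ 2 := by nlinarith
  have m1 := mul_le_mul_of_nonneg_right hMM ht0
  have m2 := mul_le_mul_of_nonneg_right h1M ht0
  have err : ‖(fibreD f q - fibreD f r) (T2 u v) +
        fibreD2 f q ((S - T) u) (S v) + fibreD2 f q (T u) ((S - T) v) +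
        (fibreD2 f q - fibreD2 f r) (T u) (T v) - (S' - T') (fibreD2 f p u v)‖ ≤
      5 * M ^ 2 * t := by
    refine (norm_sub_le _ _).trans ?_
    have := norm_add₃_le (a := (fibreD f q - fibreD f r) (T2 u v))
      (b := fibreD2 f q ((S - T) u) (S v)) (c := fibreD2 f q (T u) ((S - T) v))
    have := norm_add_le ((fibreD f q - fibreD f r) (T2 u v) +
        fibreD2 f q ((S - T) u) (S v) + fibreD2 f q (T u) ((S - T) v))
        ((fibreD2 f q - fibreD2 f r) (T u) (T v))
    have c1 : K * κ * (M * ‖u‖ * ‖v‖) = M * t := by ring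
    have c2 : K * (κ * ‖u‖) * (M * ‖v‖) = M * t := by ring
    have c3 : K * (M * ‖u‖) * (κ * ‖v‖) = M * t := by ring
    have c4 : K * κ * (M * ‖u‖) * (M * ‖v‖) = M ^ 2 * t := by ring
    have c5 : κ * (K * ‖u‖ * ‖v‖) = t := by ring
    linarith
  have e3 : N (f q) (S2' (fibreD f p u) (fibreD f p v) - T2' (fibreD f p u) (fibreD f p v)) ≤
      (χp * e + 5 * K ^ 4 * M ^ 2 * κ) * (N p u * N p v) := by
    rw [e1, add_mul]
    refine (h.N_add _ _ _).trans (add_le_add ?_ ?_)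
    · refine (h.N_D_le _ _).trans ?_
      have := he u v
      calc χp * N q (S2 u v - T2 u v) ≤ χp * (e * N p u * N p v) := by gcongr
        _ = _ := by ring
    · refine (h.N_le _ _).trans ?_
      have := h.le_N p u
      have := h.le_N p v
      calc K * _ ≤ K * (5 * M ^ 2 * t) := by gcongr
        _ ≤ K * (5 * M ^ 2 * (K * κ * ((K * N p u) * (K * N p v)))) := by
          rw [ht]; gcongr
        _ = _ := by ring
  refine e3.trans ?_
  have hm := h.m_pos
  have h5 := h.le_N_D p u
  have h6 := h.le_N_D p v
  have h7 := h.N_nonneg (f p) (fibreD f p u)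
  rw [mul_assoc (_ / _), div_mul_eq_mul_div, le_div_iff₀ (by positivity), mul_assoc (_ + _)]
  refine mul_le_mul_of_nonneg_left ?_ (by positivity)
  calc N p u * N p v * χm ^ 2 = (χm * N p u) * (χm * N p v) := by ring
    _ ≤ _ := by gcongr

end FibreBounds

/-! ### Geometric convergence of the transfer maps and of their derivatives -/

namespace FibreBounds

variable {f : T4 ≃ T4} {f₂ : T2 ≃ T2} {N : T4 → R2 → ℝ} {α χm χp χuu K : ℝ}

theorem p_pos (h : FibreBounds f f₂ N α χm χp χuu K) : 0 < χp := h.m_pos.trans_le h.m_le_p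

theorem uu_pos (h : FibreBounds f f₂ N α χm χp χuu K) : 0 < χuu := zero_lt_one.trans h.one_lt_uu

theorem div_uu_le (h : FibreBounds f f₂ N α χm χp χuu K) {ε : ℝ} (hε : 0 ≤ ε) : ε / χuu ≤ ε :=
  div_le_self hε h.one_lt_uu.le

theorem dist_transfer_succ_le (h : FibreBounds f f₂ N α χm χp χuu K) (n : ℕ) {ε : ℝ} {b b' : T2}
    (hb : BackwardClose f₂ χuu ε b b') (x : T2) :
    dist (transfer f f₂ n b b' x) (transfer f f₂ (n + 1) b b' x) ≤
      K ^ 2 * ε * (χp / χuu) ^ n := by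
  have hK := zero_le_one.trans h.one_le_K
  have hp := h.p_pos
  have hu := h.uu_pos
  have hε := hb.nonneg
  have e0 := transfer_add h.semiconj 0 n b b' x
  have e1 := transfer_add h.semiconj 1 n b b' x
  rw [zero_add, transfer_zero] at e0
  rw [add_comm] at e1
  rw [e0, e1]
  refine (h.iterate_lip _ _ _ _).trans ?_
  set z := (f.symm^[n] (x, b)).1
  set c := f₂.symm^[n] b with hc
  set c' := f₂.symm^[n] b'
  have h1 : dist z (transfer f f₂ 1 c c' z) ≤ K * (ε * χuu⁻¹ ^ n) := by
    rw [transfer_succ h.semiconj]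
    simp only [Function.comp, transfer_zero]
    -- Both points become images of the same fibre coordinate over two nearby base points, so only
    -- the dependence of the fibre map on the base matters.
    conv_lhs => rw [← fibreMap_fibreMap_symm h.semiconj c z, fibreMap_symm_fibreMap h.semiconj]
    refine (h.lip _ _ _).trans ?_
    gcongr
    have h2 := (hb.iterate n).shift 0
    simp only [Function.iterate_zero, id, pow_zero, mul_one] at h2
    exact h2.trans (h.div_uu_le (by positivity))
  calc K * χp ^ n * dist z (transfer f f₂ 1 c c' z)
      ≤ K * χp ^ n * (K * (ε * χuu⁻¹ ^ n)) := by gcongr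
    _ = _ := by rw [div_pow, inv_pow]; field_simp

/-- Uniform convergence of the transfer maps, at a geometric rate. -/
theorem exists_dist_transfer_le (h : FibreBounds f f₂ N α χm χp χuu K) :
    ∃ C, 1 ≤ C ∧ ∀ (m n : ℕ) (ε : ℝ) (b b' x : T2), BackwardClose f₂ χuu ε b b' →
      dist (transfer f f₂ (m + n) b b' x) (transfer f f₂ n b b' x) ≤
        C * (χp / χuu) ^ n * ε := by
  have hK1 := h.one_le_K
  have hK := zero_le_one.trans hK1
  have hp := h.p_pos
  have hu := h.uu_pos
  set ρ := χp / χuu with hρ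
  have hρ0 : 0 ≤ ρ := by positivity
  have hρ1 : ρ < 1 := h.p_lt
  have hρ2 : 0 < 1 - ρ := sub_pos.2 hρ1
  -- Summing the geometric series bounds the distance to the identity linearly in ε. At time `-n`
  -- this ε is ε·χuu⁻ⁿ, which beats the expansion χpⁿ.
  have hbd : ∀ (m : ℕ) (ε : ℝ) (b b' x : T2), BackwardClose f₂ χuu ε b b' →
      dist (transfer f f₂ m b b' x) x ≤ K ^ 2 * ε * (1 - ρ)⁻¹ := by
    intro m ε b b' x hb
    have hε := hb.nonneg
    have h1 := dist_le_range_sum_of_dist_le (f := fun k => transfer f f₂ k b b' x)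
      (d := fun k => K ^ 2 * ε * ρ ^ k) m (fun {k} _ => h.dist_transfer_succ_le k hb x)
    rw [transfer_zero, dist_comm, ← Finset.mul_sum] at h1
    refine h1.trans ?_
    gcongr
    rw [← tsum_geometric_of_lt_one hρ0 hρ1]
    exact (summable_geometric_of_lt_one hρ0 hρ1).sum_le_tsum _ fun _ _ => by positivity
  refine ⟨K ^ 3 * (1 - ρ)⁻¹, ?_, fun m n ε b b' x hb => ?_⟩
  · have : 1 ≤ (1 - ρ)⁻¹ := (one_le_inv₀ hρ2).2 (by linarith)
    exact one_le_mul_of_one_le_of_one_le (one_le_pow₀ hK1) this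
  · have e0 := transfer_add h.semiconj 0 n b b' x
    rw [zero_add, transfer_zero] at e0
    rw [e0, transfer_add h.semiconj]
    refine (h.iterate_lip _ _ _ _).trans ?_
    have h1 := hbd m _ _ _ (f.symm^[n] (x, b)).1 (hb.iterate n)
    calc K * χp ^ n * _ ≤ K * χp ^ n * (K ^ 2 * (ε * χuu⁻¹ ^ n) * (1 - ρ)⁻¹) := by gcongr
      _ = _ := by rw [hρ, div_pow, inv_pow]; field_simp

/-- The identity solves the same recursion with equal source and target base orbits, so it can be
compared with the transfer maps by `step_D`. Linearity of the bound in ε supplies the factor χuu⁻¹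
that makes the recursion contract. -/
theorem exists_D_transfer_sub_id_le (h : FibreBounds f f₂ N α χm χp χuu K) :
    ∃ B, 0 ≤ B ∧ ∀ (n : ℕ) (ε : ℝ) (b b' x : T2), BackwardClose f₂ χuu ε b b' → ∀ v,
      N (transfer f f₂ n b b' x, b') (D (transfer f f₂ n b b') x v - v) ≤
        B * ε * N (x, b) v := by
  obtain ⟨C, hC1, hC⟩ := h.exists_dist_transfer_le
  have hK1 := h.one_le_K
  have hK := zero_le_one.trans hK1
  have hp := h.p_pos
  have hm := h.m_pos
  have hu := h.uu_pos
  have hθ : 0 < 1 - χp / χm / χuu := sub_pos.2 h.bunch₁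
  -- This is the fixed point of B ↦ θB + K³(C+1)/χm with θ = χp/(χm·χuu).
  refine ⟨K ^ 3 * (C + 1) / χm / (1 - χp / χm / χuu), by positivity, fun n => ?_⟩
  set B := K ^ 3 * (C + 1) / χm / (1 - χp / χm / χuu) with hB
  induction n with
  | zero =>
    intro ε b b' x hb v
    have hε := hb.nonneg
    have e : transfer f f₂ 0 b b' = id := rfl
    rw [e, D_id]
    have h1 := h.N_le (x, b') (0 : R2)
    have h2 := h.N_nonneg (x, b) v
    rw [norm_zero, mul_zero] at h1
    simp only [id, ContinuousLinearMap.coe_id', sub_self]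
    exact h1.trans (by positivity)
  | succ n ih =>
    intro ε b b' x hb v
    have hε := hb.nonneg
    set x0 := fibreMap f.symm b x with hx0
    have hx : fibreMap f (f₂.symm b) x0 = x := fibreMap_fibreMap_symm h.semiconj b x
    have hsh := hb.shift
    have h1 := h.step_D (p := (x0, f₂.symm b))
      (q := (transfer f f₂ n (f₂.symm b) (f₂.symm b') x0, f₂.symm b')) (r := (x0, f₂.symm b))
      (S := D (transfer f f₂ n (f₂.symm b) (f₂.symm b')) x0)
      (T := ContinuousLinearMap.id ℝ R2) (S' := D (transfer f f₂ (n + 1) b b') x)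
      (T' := ContinuousLinearMap.id ℝ R2) (e := B * (ε / χuu)) (M := 1) (δ := (C + 1) * ε)
      ContinuousLinearMap.norm_id_le ?_ ?_ ?_ (fun _ => rfl) v
    · rw [fibreMap_mk h.semiconj, fibreMap_mk h.semiconj, hx] at h1
      have e1 : fibreMap f (f₂.symm b') (transfer f f₂ n (f₂.symm b) (f₂.symm b') x0) =
          transfer f f₂ (n + 1) b b' x := by
        rw [transfer_succ h.semiconj]; rfl
      rw [e1] at h1
      refine h1.trans_eq ?_
      congr 1
      have e2 : (1 - χp / χm / χuu) * B = K ^ 3 * (C + 1) / χm := by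
        rw [hB, mul_div_cancel₀ _ hθ.ne']
      calc (χp * (B * (ε / χuu)) + K ^ 3 * 1 * ((C + 1) * ε)) / χm
          = (χp / χm / χuu * B + K ^ 3 * (C + 1) / χm) * ε := by field_simp
        _ = B * ε := by rw [← e2]; ring
    · rw [Prod.dist_eq]
      have h2 := hC n 0 _ _ _ x0 hsh
      rw [pow_zero, mul_one, add_zero, transfer_zero] at h2
      have h3 := hsh 0
      simp only [Function.iterate_zero, id, pow_zero, mul_one] at h3
      have h4 := h.div_uu_le hε
      refine max_le ?_ ?_
      · refine h2.trans ?_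
        nlinarith
      · rw [dist_comm]
        refine h3.trans ?_
        nlinarith
    · exact fun v => ih _ _ _ _ hsh v
    · intro v
      rw [← hx]
      exact h.D_transfer_succ_apply n b b' x0 v

theorem exists_norm_D_transfer_le (h : FibreBounds f f₂ N α χm χp χuu K) {R : ℝ} (hR : 0 ≤ R) :
    ∃ M, 1 ≤ M ∧ ∀ (n : ℕ) (ε : ℝ) (b b' x : T2), BackwardClose f₂ χuu ε b b' → ε ≤ R →
      ‖D (transfer f f₂ n b b') x‖ ≤ M ∧
        ‖D (transfer f f₂ n b b') x - ContinuousLinearMap.id ℝ R2‖ ≤ M * ε := by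
  obtain ⟨B, hB0, hB⟩ := h.exists_D_transfer_sub_id_le
  have hK1 := h.one_le_K
  refine ⟨1 + K ^ 2 * B + K ^ 2 * B * R, ?_, fun n ε b b' x hb hεR => ?_⟩
  · have : 0 ≤ K ^ 2 * B := by positivity
    nlinarith [mul_nonneg this hR]
  have hε := hb.nonneg
  have h1 : ‖D (transfer f f₂ n b b') x - ContinuousLinearMap.id ℝ R2‖ ≤ K ^ 2 * (B * ε) :=
    h.norm_le_of_N_le (p := (x, b)) (q := (transfer f f₂ n b b' x, b')) (by positivity)
      fun v => hB n ε b b' x hb v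
  have h0 : 0 ≤ K ^ 2 * B := by positivity
  constructor
  · have h2 := norm_le_norm_sub_add (D (transfer f f₂ n b b') x) (ContinuousLinearMap.id ℝ R2)
    have h3 := ContinuousLinearMap.norm_id_le (𝕜 := ℝ) (E := R2)
    nlinarith [mul_le_mul_of_nonneg_left hεR h0]
  · nlinarith [mul_nonneg (mul_nonneg h0 hR) hε]

/-- Exponential convergence of the first derivatives of the transfer maps. -/
theorem exists_D_transfer_sub_le (h : FibreBounds f f₂ N α χm χp χuu K) {R : ℝ} (hR : 0 ≤ R) :
    ∃ C σ, 0 ≤ C ∧ χp / χuu < σ ∧ σ < 1 ∧ ∀ (m n : ℕ) (ε : ℝ) (b b' x : T2),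
      BackwardClose f₂ χuu ε b b' → ε ≤ R → ∀ v,
      N (transfer f f₂ (m + n) b b' x, b')
        (D (transfer f f₂ (m + n) b b') x v - D (transfer f f₂ n b b') x v) ≤
        C * σ ^ n * ε * N (x, b) v := by
  obtain ⟨C, hC1, hC⟩ := h.exists_dist_transfer_le
  obtain ⟨B, hB0, hB⟩ := h.exists_D_transfer_sub_id_le
  obtain ⟨M, hM1, hM⟩ := h.exists_norm_D_transfer_le hR
  have hK1 := h.one_le_K
  have hK := zero_le_one.trans hK1
  have hM0 := zero_le_one.trans hM1
  have hC0 := zero_le_one.trans hC1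
  have hp := h.p_pos
  have hm := h.m_pos
  have hu := h.uu_pos
  -- The rate must exceed the contraction factor strictly, to absorb the error, and also χp/χuu, the
  -- rate at which the base points converge.
  obtain ⟨σ, hσ, hσ1⟩ := exists_between (max_lt h.bunch₁ h.p_lt)
  have hσθ : 0 < σ - χp / χm / χuu := sub_pos.2 ((le_max_left _ _).trans_lt hσ)
  have hσρ := (le_max_right _ _).trans_lt hσ
  have hρ0 : 0 ≤ χp / χuu := by positivity
  have hσ0 : 0 ≤ σ := hρ0.trans hσρ.le
  set c := K ^ 3 * M * C / χm with hc
  have hc0 : 0 ≤ c := by positivity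
  refine ⟨B + c / (σ - χp / χm / χuu), σ, by positivity, hσρ, hσ1, fun m n => ?_⟩
  -- `A ≥ B` starts the induction, and θA + c ≤ σA with θ = χp/(χm·χuu) continues it.
  set A := B + c / (σ - χp / χm / χuu) with hA
  have hA0 : 0 ≤ A := by positivity
  have hAB : B ≤ A := le_add_of_nonneg_right (by positivity)
  have hAc : c ≤ A * (σ - χp / χm / χuu) := by
    rw [hA, add_mul, div_mul_cancel₀ _ hσθ.ne']
    exact le_add_of_nonneg_left (by positivity)
  induction n with
  | zero =>
    intro ε b b' x hb _ v
    have hε := hb.nonneg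
    have e : transfer f f₂ 0 b b' = id := rfl
    rw [e, D_id, add_zero, pow_zero, mul_one]
    refine (hB m ε b b' x hb v).trans ?_
    have := h.N_nonneg (x, b) v
    gcongr
  | succ n ih =>
    intro ε b b' x hb hεR v
    have hε := hb.nonneg
    set x0 := fibreMap f.symm b x with hx0
    have hx : fibreMap f (f₂.symm b) x0 = x := fibreMap_fibreMap_symm h.semiconj b x
    have hsh := hb.shift
    have hεR' : ε / χuu ≤ R := (h.div_uu_le hε).trans hεR
    have h1 := h.step_D (p := (x0, f₂.symm b))
      (q := (transfer f f₂ (m + n) (f₂.symm b) (f₂.symm b') x0, f₂.symm b'))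
      (r := (transfer f f₂ n (f₂.symm b) (f₂.symm b') x0, f₂.symm b'))
      (S := D (transfer f f₂ (m + n) (f₂.symm b) (f₂.symm b')) x0)
      (T := D (transfer f f₂ n (f₂.symm b) (f₂.symm b')) x0)
      (S' := D (transfer f f₂ (m + (n + 1)) b b') x)
      (T' := D (transfer f f₂ (n + 1) b b') x) (e := A * σ ^ n * (ε / χuu)) (M := M)
      (δ := C * σ ^ n * ε) (hM _ _ _ _ _ hsh hεR').1 ?_ ?_ ?_ ?_ v
    · rw [fibreMap_mk h.semiconj, fibreMap_mk h.semiconj, hx] at h1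
      have e1 : fibreMap f (f₂.symm b') (transfer f f₂ (m + n) (f₂.symm b) (f₂.symm b') x0) =
          transfer f f₂ (m + (n + 1)) b b' x := by
        rw [← add_assoc, transfer_succ h.semiconj]; rfl
      rw [e1] at h1
      refine h1.trans (mul_le_mul_of_nonneg_right ?_ (h.N_nonneg _ _))
      calc (χp * (A * σ ^ n * (ε / χuu)) + K ^ 3 * M * (C * σ ^ n * ε)) / χm
          = (χp / χm / χuu * A + c) * (σ ^ n * ε) := by rw [hc]; field_simp
        _ ≤ (A * σ) * (σ ^ n * ε) := by
          gcongr
          linarith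
        _ = _ := by ring
    · rw [Prod.dist_eq, dist_self, max_eq_left dist_nonneg]
      refine (hC m n _ _ _ x0 hsh).trans ?_
      have := h.div_uu_le hε
      gcongr
    · exact fun v => ih _ _ _ _ hsh hεR' v
    · intro v
      rw [← hx]
      exact h.D_transfer_succ_apply (m + n) b b' x0 v
    · intro v
      rw [← hx]
      exact h.D_transfer_succ_apply n b b' x0 v

/-- On bounded ε, Lipschitz errors are absorbed into Hölder errors, so that all terms of `step_D2`
scale as ε^α. -/
theorem le_rpow_mul (h : FibreBounds f f₂ N α χm χp χuu K) {ε R : ℝ} (hε : 0 ≤ ε) (hR : ε ≤ R) :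
    ε ≤ R ^ (1 - α) * ε ^ α := by
  rcases hε.eq_or_lt with rfl | hε'
  · rw [Real.zero_rpow h.α_pos.ne', mul_zero]
  · calc ε = ε ^ (1 - α) * ε ^ α := by rw [← Real.rpow_add hε']; simp
      _ ≤ _ := by
        gcongr
        exact sub_nonneg.2 h.α_le

theorem rpow_mul_le (h : FibreBounds f f₂ N α χm χp χuu K) {δ C ε : ℝ} (hδ0 : 0 ≤ δ) (hC : 1 ≤ C)
    (hε : 0 ≤ ε) (hδ : δ ≤ C * ε) : δ ^ α ≤ C * ε ^ α := by
  have hC0 := zero_le_one.trans hC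
  calc δ ^ α ≤ (C * ε) ^ α := Real.rpow_le_rpow hδ0 hδ h.α_pos.le
    _ = C ^ α * ε ^ α := Real.mul_rpow hC0 hε
    _ ≤ C * ε ^ α := by
      gcongr
      exact Real.rpow_le_self_of_one_le hC h.α_le

/-- Comparison with the identity again, whose second derivative is zero. The bound has order ε^α, so
a backward step gains χuu^(-α), and `bunch₂` closes the recursion. -/
theorem exists_D2_transfer_le (h : FibreBounds f f₂ N α χm χp χuu K) {R : ℝ} (hR : 0 ≤ R) :
    ∃ B, 0 ≤ B ∧ ∀ (n : ℕ) (ε : ℝ) (b b' x : T2), BackwardClose f₂ χuu ε b b' → ε ≤ R → ∀ u v,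
      N (transfer f f₂ n b b' x, b') (D2 (transfer f f₂ n b b') x u v) ≤
        B * ε ^ α * N (x, b) u * N (x, b) v := by
  obtain ⟨C, hC1, hC⟩ := h.exists_dist_transfer_le
  obtain ⟨M, hM1, hM⟩ := h.exists_norm_D_transfer_le hR
  have hK1 := h.one_le_K
  have hK := zero_le_one.trans hK1
  have hM0 := zero_le_one.trans hM1
  have hC0 := zero_le_one.trans hC1
  have hp := h.p_pos
  have hm := h.m_pos
  have hu := h.uu_pos
  have hθ : 0 < 1 - χp / χm ^ 2 / χuu ^ α := sub_pos.2 h.bunch₂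
  have hRα : 0 ≤ R ^ (1 - α) := by positivity
  -- One constant for all errors: the summand 1 serves the Hölder error, and R^(1-α) the errors
  -- linear in ε.
  set c := (C + 1 + M) * (1 + R ^ (1 - α)) with hc
  have hc0 : 0 ≤ c := by positivity
  refine ⟨5 * K ^ 4 * M ^ 2 * c / χm ^ 2 / (1 - χp / χm ^ 2 / χuu ^ α), by positivity, fun n => ?_⟩
  set B := 5 * K ^ 4 * M ^ 2 * c / χm ^ 2 / (1 - χp / χm ^ 2 / χuu ^ α) with hB
  have hB0 : 0 ≤ B := by positivity
  induction n with
  | zero =>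
    intro ε b b' x hb _ u v
    have hε := hb.nonneg
    have e : transfer f f₂ 0 b b' = id := rfl
    rw [e, D2_id]
    have h1 := h.N_le (x, b') (0 : R2)
    have h2 := h.N_nonneg (x, b) v
    have h3 := h.N_nonneg (x, b) u
    rw [norm_zero, mul_zero] at h1
    simp only [id, zero_apply]
    exact h1.trans (by positivity)
  | succ n ih =>
    intro ε b b' x hb hεR u v
    have hε := hb.nonneg
    set x0 := fibreMap f.symm b x with hx0
    have hx : fibreMap f (f₂.symm b) x0 = x := fibreMap_fibreMap_symm h.semiconj b x
    have hsh := hb.shift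
    have hεε := h.div_uu_le hε
    have hεR' : ε / χuu ≤ R := hεε.trans hεR
    have hεα : 0 ≤ ε ^ α := by positivity
    have hεp := h.le_rpow_mul hε hεR
    have hδ : dist ((transfer f f₂ n (f₂.symm b) (f₂.symm b') x0, f₂.symm b') : T4)
        (x0, f₂.symm b) ≤ (C + 1) * ε := by
      rw [Prod.dist_eq]
      have h2 := hC n 0 _ _ _ x0 hsh
      rw [pow_zero, mul_one, add_zero, transfer_zero] at h2
      have h3 := hsh 0
      simp only [Function.iterate_zero, id, pow_zero, mul_one] at h3
      refine max_le ?_ ?_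
      · refine h2.trans ?_
        nlinarith
      · rw [dist_comm]
        refine h3.trans ?_
        nlinarith
    have hsplit : ∀ {t : ℝ}, 0 ≤ t → t ≤ C + 1 + M → t * ε ≤ c * ε ^ α := by
      intro t ht0 ht
      calc t * ε ≤ t * (R ^ (1 - α) * ε ^ α) := by gcongr
        _ ≤ (C + 1 + M) * ((1 + R ^ (1 - α)) * ε ^ α) := by gcongr; linarith
        _ = _ := by rw [hc]; ring
    have h1 := h.step_D2 (p := (x0, f₂.symm b))
      (q := (transfer f f₂ n (f₂.symm b) (f₂.symm b') x0, f₂.symm b')) (r := (x0, f₂.symm b))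
      (S := D (transfer f f₂ n (f₂.symm b) (f₂.symm b')) x0)
      (T := ContinuousLinearMap.id ℝ R2) (S' := D (transfer f f₂ (n + 1) b b') x)
      (T' := ContinuousLinearMap.id ℝ R2)
      (S2 := D2 (transfer f f₂ n (f₂.symm b) (f₂.symm b')) x0) (T2 := 0)
      (S2' := D2 (transfer f f₂ (n + 1) b b') x) (T2' := 0)
      (e := B * (ε / χuu) ^ α) (M := M) (κ := c * ε ^ α) (by positivity) hM1
      (hM _ _ _ _ _ hsh hεR').1 (ContinuousLinearMap.norm_id_le.trans hM1)
      (ContinuousLinearMap.opNorm_zero.trans_le hM0)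
      ?_ ?_ ?_ ?_ ?_ ?_ ?_ u v
    · rw [fibreMap_mk h.semiconj, fibreMap_mk h.semiconj, hx] at h1
      have e1 : fibreMap f (f₂.symm b') (transfer f f₂ n (f₂.symm b) (f₂.symm b') x0) =
          transfer f f₂ (n + 1) b b' x := by
        rw [transfer_succ h.semiconj]; rfl
      rw [e1] at h1
      simp only [zero_apply, sub_zero] at h1
      refine h1.trans_eq ?_
      congr 2
      have e2 : (1 - χp / χm ^ 2 / χuu ^ α) * B = 5 * K ^ 4 * M ^ 2 * c / χm ^ 2 := by
        rw [hB, mul_div_cancel₀ _ hθ.ne']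
      have hua : 0 < χuu ^ α := by positivity
      rw [Real.div_rpow hε hu.le]
      calc (χp * (B * (ε ^ α / χuu ^ α)) + 5 * K ^ 4 * M ^ 2 * (c * ε ^ α)) / χm ^ 2
          = (χp / χm ^ 2 / χuu ^ α * B + 5 * K ^ 4 * M ^ 2 * c / χm ^ 2) * ε ^ α := by
            field_simp
        _ = B * ε ^ α := by rw [← e2]; ring
    · exact hδ.trans (hsplit (by positivity) (by linarith))
    · refine (h.rpow_mul_le dist_nonneg (by linarith) hε hδ).trans ?_
      rw [hc]
      gcongr
      nlinarith
    · refine (hM _ _ _ _ _ hsh hεR').2.trans (le_trans ?_ (hsplit hM0 (by linarith)))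
      gcongr
    · exact (hM _ _ _ _ _ hb hεR).2.trans (hsplit hM0 (by linarith))
    · intro u v
      simp only [zero_apply, sub_zero]
      exact ih _ _ _ _ hsh hεR' u v
    · intro u v
      rw [← hx]
      exact h.D2_transfer_succ_apply n b b' x0 u v
    · intro u v
      simp

/-- Exponential convergence of the second derivatives of the transfer maps. -/
theorem exists_D2_transfer_sub_le (h : FibreBounds f f₂ N α χm χp χuu K) {R : ℝ} (hR : 0 ≤ R) :
    ∃ C σ, 0 ≤ C ∧ 0 ≤ σ ∧ σ < 1 ∧ ∀ (m n : ℕ) (ε : ℝ) (b b' x : T2),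
      BackwardClose f₂ χuu ε b b' → ε ≤ R → ∀ u v,
      N (transfer f f₂ (m + n) b b' x, b')
        (D2 (transfer f f₂ (m + n) b b') x u v - D2 (transfer f f₂ n b b') x u v) ≤
        C * σ ^ n * ε ^ α * N (x, b) u * N (x, b) v := by
  obtain ⟨C, hC1, hC⟩ := h.exists_dist_transfer_le
  obtain ⟨B, hB0, hB⟩ := h.exists_D2_transfer_le hR
  obtain ⟨M', hM1', hM'⟩ := h.exists_norm_D_transfer_le hR
  obtain ⟨C₁, σ₁, hC₁0, hσ₁ρ, hσ₁1, hC₁⟩ := h.exists_D_transfer_sub_le hR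
  have hK1 := h.one_le_K
  have hK := zero_le_one.trans hK1
  have hC0 := zero_le_one.trans hC1
  have hp := h.p_pos
  have hm := h.m_pos
  have hu := h.uu_pos
  have hρ0 : 0 ≤ χp / χuu := by positivity
  have hσ₁0 : 0 ≤ σ₁ := hρ0.trans hσ₁ρ.le
  have hσ₁α : σ₁ ^ α < 1 := Real.rpow_lt_one hσ₁0 hσ₁1 h.α_pos
  have hσ₁α' : σ₁ ≤ σ₁ ^ α := Real.self_le_rpow_of_le_one hσ₁0 hσ₁1.le h.α_le
  -- `step_D2` takes a single bound for the first and second derivatives.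
  set M := M' + K ^ 3 * (B * R ^ α) with hMdef
  have hMB0 : 0 ≤ K ^ 3 * (B * R ^ α) := by positivity
  have hM1 : 1 ≤ M := by linarith
  have hM0 := zero_le_one.trans hM1
  have hMM : M' ≤ M := by linarith
  -- Base points differ by O(σ₁ⁿ ε), so the Hölder errors decay only like (σ₁^α)ⁿ; the rate must
  -- dominate σ₁^α and not merely σ₁.
  obtain ⟨σ, hσ, hσ1⟩ := exists_between (max_lt h.bunch₂ hσ₁α)
  have hσθ : 0 < σ - χp / χm ^ 2 / χuu ^ α := sub_pos.2 ((le_max_left _ _).trans_lt hσ)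
  have hσα := ((le_max_right _ _).trans_lt hσ).le
  have hσσ₁ := hσ₁α'.trans hσα
  have hσ0 : 0 ≤ σ := hσ₁0.trans hσσ₁
  have hRα : 0 ≤ R ^ (1 - α) := by positivity
  set c := (C + K ^ 2 * C₁) * (1 + R ^ (1 - α)) with hc
  have hc0 : 0 ≤ c := by positivity
  set c' := 5 * K ^ 4 * M ^ 2 * c / χm ^ 2 with hc'
  have hc'0 : 0 ≤ c' := by positivity
  refine ⟨B + c' / (σ - χp / χm ^ 2 / χuu ^ α), σ, by positivity, hσ0, hσ1, fun m n => ?_⟩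
  set A := B + c' / (σ - χp / χm ^ 2 / χuu ^ α) with hA
  have hA0 : 0 ≤ A := by positivity
  have hAB : B ≤ A := le_add_of_nonneg_right (by positivity)
  have hAc : c' ≤ A * (σ - χp / χm ^ 2 / χuu ^ α) := by
    rw [hA, add_mul, div_mul_cancel₀ _ hσθ.ne']
    exact le_add_of_nonneg_left (by positivity)
  induction n with
  | zero =>
    intro ε b b' x hb hεR u v
    have hε := hb.nonneg
    have e : transfer f f₂ 0 b b' = id := rfl
    rw [e, D2_id, add_zero, pow_zero, mul_one]
    simp only [zero_apply, sub_zero]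
    refine (hB m ε b b' x hb hεR u v).trans ?_
    have := h.N_nonneg (x, b) v
    have := h.N_nonneg (x, b) u
    gcongr
  | succ n ih =>
    intro ε b b' x hb hεR u v
    have hε := hb.nonneg
    set x0 := fibreMap f.symm b x with hx0
    have hx : fibreMap f (f₂.symm b) x0 = x := fibreMap_fibreMap_symm h.semiconj b x
    have hsh := hb.shift
    have hεε := h.div_uu_le hε
    have hε'0 := hsh.nonneg
    have hεR' : ε / χuu ≤ R := hεε.trans hεR
    have hεα : 0 ≤ ε ^ α := by positivity
    have hεp := h.le_rpow_mul hε hεR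
    have hσ₁n : σ₁ ^ n ≤ σ ^ n := pow_le_pow_left₀ hσ₁0 hσσ₁ n
    have hδ : dist ((transfer f f₂ (m + n) (f₂.symm b) (f₂.symm b') x0, f₂.symm b') : T4)
        (transfer f f₂ n (f₂.symm b) (f₂.symm b') x0, f₂.symm b') ≤ C * (σ₁ ^ n * ε) := by
      rw [Prod.dist_eq, dist_self, max_eq_left dist_nonneg]
      refine (hC m n _ _ _ x0 hsh).trans ?_
      rw [mul_assoc]
      gcongr
    have hsplit : ∀ {t : ℝ}, 0 ≤ t → t ≤ C + K ^ 2 * C₁ →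
        t * (σ₁ ^ n * ε) ≤ c * (σ ^ n * ε ^ α) := by
      intro t ht0 ht
      calc t * (σ₁ ^ n * ε) ≤ t * (σ ^ n * (R ^ (1 - α) * ε ^ α)) := by gcongr
        _ ≤ (C + K ^ 2 * C₁) * (σ ^ n * ((1 + R ^ (1 - α)) * ε ^ α)) := by gcongr; linarith
        _ = _ := by rw [hc]; ring
    have h1 := h.step_D2 (p := (x0, f₂.symm b))
      (q := (transfer f f₂ (m + n) (f₂.symm b) (f₂.symm b') x0, f₂.symm b'))
      (r := (transfer f f₂ n (f₂.symm b) (f₂.symm b') x0, f₂.symm b'))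
      (S := D (transfer f f₂ (m + n) (f₂.symm b) (f₂.symm b')) x0)
      (T := D (transfer f f₂ n (f₂.symm b) (f₂.symm b')) x0)
      (S' := D (transfer f f₂ (m + (n + 1)) b b') x)
      (T' := D (transfer f f₂ (n + 1) b b') x)
      (S2 := D2 (transfer f f₂ (m + n) (f₂.symm b) (f₂.symm b')) x0)
      (T2 := D2 (transfer f f₂ n (f₂.symm b) (f₂.symm b')) x0)
      (S2' := D2 (transfer f f₂ (m + (n + 1)) b b') x)
      (T2' := D2 (transfer f f₂ (n + 1) b b') x)
      (e := A * σ ^ n * (ε / χuu) ^ α) (M := M) (κ := c * (σ ^ n * ε ^ α)) (by positivity) hM1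
      ((hM' _ _ _ _ _ hsh hεR').1.trans hMM) ((hM' _ _ _ _ _ hsh hεR').1.trans hMM)
      ?_ ?_ ?_ ?_ ?_ ?_ ?_ ?_ u v
    · rw [fibreMap_mk h.semiconj, fibreMap_mk h.semiconj, hx] at h1
      have e1 : fibreMap f (f₂.symm b') (transfer f f₂ (m + n) (f₂.symm b) (f₂.symm b') x0) =
          transfer f f₂ (m + (n + 1)) b b' x := by
        rw [← add_assoc, transfer_succ h.semiconj]; rfl
      rw [e1] at h1
      refine h1.trans ?_
      have := h.N_nonneg (x, b) v
      have := h.N_nonneg (x, b) u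
      gcongr
      have hua : 0 < χuu ^ α := by positivity
      rw [Real.div_rpow hε hu.le]
      calc (χp * (A * σ ^ n * (ε ^ α / χuu ^ α)) +
            5 * K ^ 4 * M ^ 2 * (c * (σ ^ n * ε ^ α))) / χm ^ 2
          = (χp / χm ^ 2 / χuu ^ α * A + c') * (σ ^ n * ε ^ α) := by rw [hc']; field_simp
        _ ≤ (A * σ) * (σ ^ n * ε ^ α) := by
          gcongr
          linarith
        _ = _ := by ring
    · refine (h.norm_le_of_N_le₂ (p := (x0, f₂.symm b)) (by positivity)
        (hB n _ _ _ x0 hsh hεR')).trans ?_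
      have : (ε / χuu) ^ α ≤ R ^ α := Real.rpow_le_rpow hε'0 hεR' h.α_pos.le
      have : K ^ 3 * (B * (ε / χuu) ^ α) ≤ K ^ 3 * (B * R ^ α) := by gcongr
      linarith
    · exact hδ.trans (hsplit hC0 (le_add_of_nonneg_right (by positivity)))
    · refine (h.rpow_mul_le dist_nonneg hC1 (by positivity) hδ).trans ?_
      rw [Real.mul_rpow (by positivity) hε, ← Real.rpow_natCast, ← Real.rpow_mul hσ₁0,
        mul_comm (n : ℝ), Real.rpow_mul hσ₁0, Real.rpow_natCast]
      have : (σ₁ ^ α) ^ n ≤ σ ^ n := pow_le_pow_left₀ (by positivity) hσα n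
      have hcc : C ≤ c := by
        rw [hc]
        have : 0 ≤ K ^ 2 * C₁ := by positivity
        nlinarith
      gcongr
    · refine (h.norm_le_of_N_le (p := (x0, f₂.symm b)) (by positivity)
        fun v => hC₁ m n _ _ _ x0 hsh hεR' v).trans ?_
      refine le_trans ?_ (hsplit (t := K ^ 2 * C₁) (by positivity)
        (le_add_of_nonneg_left hC0))
      calc K ^ 2 * (C₁ * σ₁ ^ n * (ε / χuu)) ≤ K ^ 2 * (C₁ * σ₁ ^ n * ε) := by gcongr
        _ = _ := by ring
    · refine (h.norm_le_of_N_le (p := (x, b)) (by positivity)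
        fun v => hC₁ m (n + 1) _ _ _ x hb hεR v).trans ?_
      refine le_trans ?_ (hsplit (t := K ^ 2 * C₁) (by positivity)
        (le_add_of_nonneg_left hC0))
      have : σ₁ ^ (n + 1) ≤ σ₁ ^ n := pow_le_pow_of_le_one hσ₁0 hσ₁1.le n.le_succ
      calc K ^ 2 * (C₁ * σ₁ ^ (n + 1) * ε) ≤ K ^ 2 * (C₁ * σ₁ ^ n * ε) := by gcongr
        _ = _ := by ring
    · exact fun u v => ih _ _ _ _ hsh hεR' u v
    · intro u v
      rw [← hx]
      exact h.D2_transfer_succ_apply (m + n) b b' x0 u v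
    · intro u v
      rw [← hx]
      exact h.D2_transfer_succ_apply n b b' x0 u v

end FibreBounds

/-! ### The limit of the transfer maps -/

/-- The space of `2`-jets of self-maps of `𝕋²`. -/
abbrev Jet := T2 × (R2 →L[ℝ] R2) × (R2 →L[ℝ] R2 →L[ℝ] R2)

/-- The limit of the transfer maps: the unstable holonomy from the fibre over `b` to that over
`b'`. -/
def transferLim (f : T4 ≃ T4) (f₂ : T2 ≃ T2) (b b' : T2) (x : T2) : T2 :=
  limUnder atTop fun n => transfer f f₂ n b b' x

namespace FibreBounds

variable {f : T4 ≃ T4} {f₂ : T2 ≃ T2} {N : T4 → R2 → ℝ} {α χm χp χuu K : ℝ}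

theorem exists_dist_jet2_transfer_le (h : FibreBounds f f₂ N α χm χp χuu K) {R : ℝ} (hR : 0 ≤ R) :
    ∃ C σ, 0 ≤ σ ∧ σ < 1 ∧ ∀ (m n : ℕ) (b b' x : T2), BackwardClose f₂ χuu R b b' →
      dist (jet2 (transfer f f₂ (m + n) b b') x) (jet2 (transfer f f₂ n b b') x) ≤ C * σ ^ n := by
  obtain ⟨C₀, hC₀1, hC₀⟩ := h.exists_dist_transfer_le
  obtain ⟨C₁, σ₁, hC₁0, hσ₁ρ, hσ₁1, hC₁⟩ := h.exists_D_transfer_sub_le hR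
  obtain ⟨C₂, σ₂, hC₂0, hσ₂0, hσ₂1, hC₂⟩ := h.exists_D2_transfer_sub_le hR
  have hK := zero_le_one.trans h.one_le_K
  have hp := h.p_pos
  have hu := h.uu_pos
  have hρ0 : 0 ≤ χp / χuu := by positivity
  have hσ₁0 : 0 ≤ σ₁ := hρ0.trans hσ₁ρ.le
  have a₀ : 0 ≤ C₀ * R := mul_nonneg (zero_le_one.trans hC₀1) hR
  have a₁ : 0 ≤ K ^ 2 * C₁ * R := by positivity
  have a₂ : 0 ≤ K ^ 3 * C₂ * R ^ α := by positivity
  refine ⟨C₀ * R + K ^ 2 * C₁ * R + K ^ 3 * C₂ * R ^ α, max σ₁ σ₂, hσ₁0.trans (le_max_left _ _),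
    max_lt hσ₁1 hσ₂1, fun m n b b' x hb => ?_⟩
  have b₁ : σ₁ ^ n ≤ max σ₁ σ₂ ^ n := pow_le_pow_left₀ hσ₁0 (le_max_left _ _) n
  have b₀ : (χp / χuu) ^ n ≤ max σ₁ σ₂ ^ n := (pow_le_pow_left₀ hρ0 hσ₁ρ.le n).trans b₁
  have b₂ : σ₂ ^ n ≤ max σ₁ σ₂ ^ n := pow_le_pow_left₀ hσ₂0 (le_max_right _ _) n
  have hs : 0 ≤ max σ₁ σ₂ ^ n := (pow_nonneg hσ₂0 n).trans b₂
  have d₀ : dist (transfer f f₂ (m + n) b b' x) (transfer f f₂ n b b' x) ≤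
      C₀ * R * max σ₁ σ₂ ^ n := by
    refine (hC₀ m n R b b' x hb).trans ?_
    nlinarith
  have d₁ : ‖D (transfer f f₂ (m + n) b b') x - D (transfer f f₂ n b b') x‖ ≤
      K ^ 2 * C₁ * R * max σ₁ σ₂ ^ n := by
    refine (h.norm_le_of_N_le (p := (x, b)) (by positivity)
      fun v => hC₁ m n R b b' x hb le_rfl v).trans ?_
    nlinarith
  have d₂ : ‖D2 (transfer f f₂ (m + n) b b') x - D2 (transfer f f₂ n b b') x‖ ≤
      K ^ 3 * C₂ * R ^ α * max σ₁ σ₂ ^ n := by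
    refine (h.norm_le_of_N_le₂ (p := (x, b)) (by positivity)
      fun u v => hC₂ m n R b b' x hb le_rfl u v).trans ?_
    nlinarith
  have t₀ := mul_nonneg a₀ hs
  have t₁ := mul_nonneg a₁ hs
  have t₂ := mul_nonneg a₂ hs
  rw [jet2, jet2, Prod.dist_eq, Prod.dist_eq]
  refine max_le ?_ (max_le ?_ ?_)
  · refine d₀.trans ?_
    linarith
  · rw [dist_eq_norm]
    refine d₁.trans ?_
    linarith
  · refine (dist_eq_norm (D2 (transfer f f₂ (m + n) b b') x)
      (D2 (transfer f f₂ n b b') x)).trans_le (d₂.trans ?_)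
    linarith

theorem tendstoUniformlyOn_jet2_transfer (h : FibreBounds f f₂ N α χm χp χuu K) {R : ℝ}
    (hR : 0 ≤ R) :
    TendstoUniformlyOn
      (fun (n : ℕ) (z : (T2 × T2) × T2) => jet2 (transfer f f₂ n z.1.1 z.1.2) z.2)
      (fun z => jet2 (transferLim f f₂ z.1.1 z.1.2) z.2) atTop
      {z | BackwardClose f₂ χuu R z.1.1 z.1.2} ∧
    ∀ b b', BackwardClose f₂ χuu R b b' → IsCn 2 (transferLim f f₂ b b') := by
  obtain ⟨C, σ, hσ0, hσ1, hC⟩ := h.exists_dist_jet2_transfer_le hR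
  set S : Set ((T2 × T2) × T2) := {z | BackwardClose f₂ χuu R z.1.1 z.1.2} with hS
  have hlim0 : Tendsto (fun n : ℕ => C * σ ^ n) atTop (𝓝 0) := by
    simpa using (tendsto_pow_atTop_nhds_zero_of_lt_one hσ0 hσ1).const_mul C
  have hUC : UniformCauchySeqOn
      (fun (n : ℕ) (z : (T2 × T2) × T2) => jet2 (transfer f f₂ n z.1.1 z.1.2) z.2) atTop S := by
    refine (Metric.uniformCauchySeqOn_iff (α := Jet) (β := ℕ)).2 fun ε hε => ?_
    obtain ⟨n₀, hn₀⟩ := eventually_atTop.1 (hlim0.eventually (gt_mem_nhds (half_pos hε)))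
    refine ⟨n₀, fun m hm n hn z hz => ?_⟩
    have h1 := hC (m - n₀) n₀ _ _ z.2 hz
    have h2 := hC (n - n₀) n₀ _ _ z.2 hz
    rw [Nat.sub_add_cancel hm] at h1
    rw [Nat.sub_add_cancel hn] at h2
    have h3 := dist_triangle_right (jet2 (transfer f f₂ m z.1.1 z.1.2) z.2)
      (jet2 (transfer f f₂ n z.1.1 z.1.2) z.2) (jet2 (transfer f f₂ n₀ z.1.1 z.1.2) z.2)
    have h4 := hn₀ n₀ le_rfl
    linarith
  -- The limit jet is chosen pointwise; off `S` an arbitrary value is used.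
  have hex : ∀ z : (T2 × T2) × T2, ∃ j, z ∈ S →
      Tendsto (fun n => jet2 (transfer f f₂ n z.1.1 z.1.2) z.2) atTop (𝓝 j) := fun z => by
    by_cases hz : z ∈ S
    · obtain ⟨j, hj⟩ := cauchySeq_tendsto_of_complete (hUC.cauchySeq hz)
      exact ⟨j, fun _ => hj⟩
    · exact ⟨jet2 id 0, fun h => absurd h hz⟩
  choose J hJ using hex
  have hTU := hUC.tendstoUniformlyOn_of_tendsto hJ
  -- A limit of jets need not a priori be a jet: the value component defines `transferLim`, and
  -- `isC2_of_tendstoUniformly` identifies the other two with its derivatives.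
  have key : ∀ b b', BackwardClose f₂ χuu R b b' → IsCn 2 (transferLim f f₂ b b') ∧
      ∀ x, jet2 (transferLim f f₂ b b') x = J ((b, b'), x) := by
    intro b b' hb
    have hU : TendstoUniformly (fun (n : ℕ) x => jet2 (transfer f f₂ n b b') x)
        (fun x => J ((b, b'), x)) atTop := by
      have h1 := hTU.comp fun x : T2 => ((b, b'), x)
      have h2 : (fun x : T2 => ((b, b'), x)) ⁻¹' S = univ := eq_univ_of_forall fun _ => hb
      rw [h2, tendstoUniformlyOn_univ] at h1
      exact h1
    have hJc : Continuous fun x => J ((b, b'), x) := by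
      refine hU.continuous (Eventually.of_forall fun n => ?_).frequently
      exact (h.continuous_jet2_transfer n).comp
        (continuous_const.prodMk continuous_id : Continuous fun x : T2 => ((b, b'), x))
    have e0 : transferLim f f₂ b b' = fun x => (J ((b, b'), x)).1 := funext fun x =>
      (hU.tendsto_at x).fst_nhds.limUnder_eq
    have hU0 : TendstoUniformly (fun (n : ℕ) => transfer f f₂ n b b') (transferLim f f₂ b b')
        atTop := by
      rw [e0]
      exact uniformContinuous_fst.comp_tendstoUniformly hU
    have hU1 := (uniformContinuous_fst.comp uniformContinuous_snd).comp_tendstoUniformly hU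
    have hU2 := (uniformContinuous_snd.comp uniformContinuous_snd).comp_tendstoUniformly hU
    obtain ⟨c0, c1, c2⟩ := isC2_of_tendstoUniformly (fun n => h.isCn_transfer n b b') hU0 hU1 hU2
      hJc.snd.snd
    refine ⟨c0, fun x => ?_⟩
    rw [jet2, c1, c2, e0]
    rfl
  refine ⟨hTU.congr_right fun z hz => ((key _ _ hz).2 z.2).symm, fun b b' hb => (key b b' hb).1⟩

theorem tendstoUniformly_transfer (h : FibreBounds f f₂ N α χm χp χuu K) {R : ℝ} {b b' : T2}
    (hb : BackwardClose f₂ χuu R b b') :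
    TendstoUniformly (fun n => transfer f f₂ n b b') (transferLim f f₂ b b') atTop := by
  have h1 := (h.tendstoUniformlyOn_jet2_transfer hb.nonneg).1.comp fun x : T2 => ((b, b'), x)
  have h2 : (fun x : T2 => ((b, b'), x)) ⁻¹' {z | BackwardClose f₂ χuu R z.1.1 z.1.2} = univ :=
    eq_univ_of_forall fun _ => hb
  rw [h2, tendstoUniformlyOn_univ] at h1
  exact uniformContinuous_fst.comp_tendstoUniformly h1

theorem isCn_transferLim (h : FibreBounds f f₂ N α χm χp χuu K) {R : ℝ} {b b' : T2}
    (hb : BackwardClose f₂ χuu R b b') : IsCn 2 (transferLim f f₂ b b') :=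
  (h.tendstoUniformlyOn_jet2_transfer hb.nonneg).2 b b' hb

/-- At each finite time the two transfer maps are exactly inverse. Uniform convergence of the outer
one allows passage to the limit in the composition. -/
theorem transferLim_transferLim (h : FibreBounds f f₂ N α χm χp χuu K) {R : ℝ} {b b' : T2}
    (hb : BackwardClose f₂ χuu R b b') (x : T2) :
    transferLim f f₂ b' b (transferLim f f₂ b b' x) = x := by
  have h1 := (h.tendstoUniformly_transfer hb).tendsto_at x
  have h2 := (h.tendstoUniformly_transfer hb.symm).tendsto_comp
    (h.isCn_transferLim hb.symm).continuous.continuousAt h1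
  simp only [transfer_transfer h.semiconj] at h2
  exact tendsto_nhds_unique h2 tendsto_const_nhds |>.symm ▸ rfl

theorem continuousOn_jet2_transferLim (h : FibreBounds f f₂ N α χm χp χuu K) {R : ℝ}
    (hR : 0 ≤ R) :
    ContinuousOn (fun z : (T2 × T2) × T2 => jet2 (transferLim f f₂ z.1.1 z.1.2) z.2)
      {z | BackwardClose f₂ χuu R z.1.1 z.1.2} :=
  (h.tendstoUniformlyOn_jet2_transfer hR).1.continuousOn
    (Eventually.of_forall fun n => (h.continuous_jet2_transfer n).continuousOn).frequently

/-- The limit of the transfer maps as a bijection. -/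
def transferEquiv (h : FibreBounds f f₂ N α χm χp χuu K) {R : ℝ} {b b' : T2}
    (hb : BackwardClose f₂ χuu R b b') : T2 ≃ T2 where
  toFun := transferLim f f₂ b b'
  invFun := transferLim f f₂ b' b
  left_inv := h.transferLim_transferLim hb
  right_inv := h.transferLim_transferLim hb.symm

theorem isCnDiffeo_transferEquiv (h : FibreBounds f f₂ N α χm χp χuu K) {R : ℝ} {b b' : T2}
    (hb : BackwardClose f₂ χuu R b b') : IsCnDiffeo 2 (h.transferEquiv hb) :=
  ⟨h.isCn_transferLim hb, h.isCn_transferLim hb.symm⟩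

end FibreBounds

/-! ### From joint continuity of jets to continuity in the C² topology -/

/-- Currying gives a continuous map into continuous functions on a compact space; the maximum is the
product norm and the supremum is the norm of that function space. -/
theorem continuous_iSup_max_norm {Z X V W : Type} [TopologicalSpace Z] [TopologicalSpace X]
    [CompactSpace X] [NormedAddCommGroup V] [NormedAddCommGroup W] {F : Z × X → V} {G : Z × X → W}
    (hF : Continuous F) (hG : Continuous G) :
    Continuous fun z => ⨆ x, max ‖F (z, x)‖ ‖G (z, x)‖ := by
  refine (ContinuousMap.curry ⟨fun w => (F w, G w), hF.prodMk hG⟩).continuous.norm.congr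
    fun z => ?_
  rw [ContinuousMap.norm_eq_iSup_norm]
  rfl

/-- A family of torus maps whose `2`-jets depend continuously on all variables is continuous in
the `C²` topology, and so is its `C²` norm. -/
theorem continuousOn_c2 {Z : Type} [TopologicalSpace Z] {S : Set Z} {H : Z → T2 → T2}
    (hH : ContinuousOn (fun z : Z × T2 => jet2 (H z.1) z.2) (S ×ˢ univ)) :
    (∀ z ∈ S, TendstoUniformly (fun z' => jet2 (H z')) (jet2 (H z)) (𝓝[S] z)) ∧
      ContinuousOn (fun z => c2Norm (H z)) S := by
  have hc : Continuous fun w : S × T2 => jet2 (H w.1) w.2 :=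
    hH.comp_continuous (f := fun w : S × T2 => ((w.1 : Z), w.2)) (by fun_prop)
      fun w => ⟨w.1.2, mem_univ _⟩
  constructor
  · intro z hz
    -- Since `T2` is compact, continuity of the curried map is uniform convergence of jets.
    have h1 := (ContinuousMap.curry ⟨_, hc⟩).continuous.tendsto (⟨z, hz⟩ : S)
    have h2 := (ContinuousMap.tendsto_iff_tendstoUniformly (β := Jet)).1 h1
    rw [nhdsWithin_eq_map_subtype_coe hz]
    exact fun u hu => eventually_map.2 (h2 u hu)
  · rw [continuousOn_iff_continuous_domRestrict]
    have h2 := continuous_iSup_max_norm (F := fun w : S × T2 => D (H w.1) w.2)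
      (G := fun w : S × T2 => D2 (H w.1) w.2) hc.snd.fst hc.snd.snd
    exact h2

/-! ### Riemannian norms -/

section Metric

variable {g : T4 → R4 →L[ℝ] R4 →L[ℝ] ℝ}

theorem gnorm_nonneg (p : T4) (v : R4) : 0 ≤ gnorm g p v := Real.sqrt_nonneg _

theorem IsRiemannianMetric.apply_nonneg (hg : IsRiemannianMetric g) (p : T4) (v : R4) :
    0 ≤ g p v v := by
  by_cases hv : v = 0
  · simp [hv]
  · exact (hg.pos p v hv).le

/-- The quadratic polynomial t ↦ g(v + tw, v + tw) is nonnegative, so its discriminant is not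
positive. -/
theorem IsRiemannianMetric.apply_sq_le (hg : IsRiemannianMetric g) (p : T4) (v w : R4) :
    g p v w ^ 2 ≤ g p v v * g p w w := by
  have h : ∀ t : ℝ, 0 ≤ g p w w * (t * t) + 2 * g p v w * t + g p v v := fun t => by
    have h1 := hg.apply_nonneg p (v + t • w)
    simp only [map_add, map_smul, add_apply, smul_apply, smul_eq_mul,
      hg.symm p w v] at h1
    linarith
  have h2 := discrim_le_zero h
  rw [discrim] at h2
  nlinarith

theorem IsRiemannianMetric.gnorm_add_le (hg : IsRiemannianMetric g) (p : T4) (v w : R4) :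
    gnorm g p (v + w) ≤ gnorm g p v + gnorm g p w := by
  have hv := hg.apply_nonneg p v
  have hw := hg.apply_nonneg p w
  have h1 : g p v w ≤ √(g p v v) * √(g p w w) := by
    rw [← Real.sqrt_mul hv]
    exact Real.le_sqrt_of_sq_le (hg.apply_sq_le p v w)
  refine Real.sqrt_le_iff.2 ⟨add_nonneg (Real.sqrt_nonneg _) (Real.sqrt_nonneg _), ?_⟩
  rw [add_sq, gnorm, gnorm, Real.sq_sqrt hv, Real.sq_sqrt hw]
  simp only [map_add, add_apply, hg.symm p w v]
  linarith

theorem gnorm_smul (p : T4) (c : ℝ) (v : R4) : gnorm g p (c • v) = |c| * gnorm g p v := by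
  rw [gnorm, gnorm, map_smul, map_smul, smul_apply, smul_eq_mul, smul_eq_mul,
    ← mul_assoc, Real.sqrt_mul (mul_self_nonneg c), Real.sqrt_mul_self_eq_abs]

theorem IsRiemannianMetric.continuous_gnorm (hg : IsRiemannianMetric g) :
    Continuous fun z : T4 × R4 => gnorm g z.1 z.2 := by
  have := hg.continuous
  unfold gnorm
  fun_prop

/-- The norm attains a positive minimum and a maximum on the compact product of the torus and the
unit sphere; homogeneity does the rest. -/
theorem IsRiemannianMetric.exists_equiv (hg : IsRiemannianMetric g) :
    ∃ K, 1 ≤ K ∧ ∀ p v, gnorm g p v ≤ K * ‖v‖ ∧ ‖v‖ ≤ K * gnorm g p v := by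
  set S : Set (T4 × R4) := univ ×ˢ Metric.sphere (0 : R4) 1 with hS
  have hc : IsCompact S := isCompact_univ.prod (isCompact_sphere _ _)
  have hne : S.Nonempty := by
    obtain ⟨v, hv⟩ := NormedSpace.sphere_nonempty (E := R4) (x := 0) (r := 1) |>.2 zero_le_one
    exact ⟨(0, v), mem_univ _, hv⟩
  obtain ⟨z, hz, hmin⟩ := hc.exists_isMinOn hne hg.continuous_gnorm.continuousOn
  obtain ⟨w, hw, hmax⟩ := hc.exists_isMaxOn hne hg.continuous_gnorm.continuousOn
  have hzpos : 0 < gnorm g z.1 z.2 := by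
    refine Real.sqrt_pos.2 (hg.pos _ _ ?_)
    rintro h
    have := hz.2
    rw [h] at this
    simp at this
  set m := gnorm g z.1 z.2
  set M := gnorm g w.1 w.2
  have hM : 0 ≤ M := gnorm_nonneg _ _
  refine ⟨1 + M + m⁻¹, by have := inv_pos.2 hzpos; linarith, fun p v => ?_⟩
  by_cases hv : v = 0
  · subst hv
    simp [gnorm]
  have hv' : 0 < ‖v‖ := norm_pos_iff.2 hv
  have hmem : ((p, ‖v‖⁻¹ • v) : T4 × R4) ∈ S := by
    refine ⟨mem_univ _, ?_⟩
    rw [mem_sphere_zero_iff_norm, norm_smul, norm_inv, norm_norm, inv_mul_cancel₀ hv'.ne']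
  have h1 : m ≤ gnorm g p (‖v‖⁻¹ • v) := hmin hmem
  have h2 : gnorm g p (‖v‖⁻¹ • v) ≤ M := hmax hmem
  rw [gnorm_smul, abs_of_pos (inv_pos.2 hv')] at h1 h2
  have h3 : m * ‖v‖ ≤ gnorm g p v := by
    have := mul_le_mul_of_nonneg_left h1 hv'.le
    rw [mul_inv_cancel_left₀ hv'.ne'] at this
    linarith
  have h4 : gnorm g p v ≤ M * ‖v‖ := by
    have := mul_le_mul_of_nonneg_left h2 hv'.le
    rw [mul_inv_cancel_left₀ hv'.ne'] at this
    linarith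
  have hi := inv_pos.2 hzpos
  constructor
  · nlinarith
  · have h5 : ‖v‖ ≤ m⁻¹ * gnorm g p v := by
      rw [le_inv_mul_iff₀ hzpos]
      exact h3
    have := gnorm_nonneg (g := g) p v
    nlinarith

end Metric

/-! ### Iterates and invariant subbundles -/

section Iterate

variable {X E : Type} [NormedAddCommGroup X] [NormedAddCommGroup E] [NormedSpace ℝ E]
  [FlatTorus X E] [IsFlatTorus X E]

theorem IsCn.iterate {F : X → X} {n : ℕ∞} (hF : IsCn n F) (k : ℕ) : IsCn n F^[k] := by
  induction k with
  | zero => exact isCn_id n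
  | succ k ih =>
    rw [Function.iterate_succ']
    exact hF.comp ih

theorem D_iterate_succ_apply {F : X → X} {n : ℕ∞} (hF : IsCn n F) (hn : n ≠ 0) (k : ℕ) (p : X)
    (v : E) : D F^[k + 1] p v = D F (F^[k] p) (D F^[k] p v) := by
  rw [Function.iterate_succ', D_comp hF (hF.iterate k) hn]
  rfl

theorem D_iterate_zero_apply {F : X → X} (p : X) (v : E) : D F^[0] p v = v := by
  rw [Function.iterate_zero, D_id]
  rfl

theorem D_symm_apply_D {F : X ≃ X} {n : ℕ∞} (hF : IsCn n F) (hF' : IsCn n F.symm) (hn : n ≠ 0)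
    (p : X) (v : E) : D F.symm (F p) (D F p v) = v := by
  have h := D_comp hF' hF hn p
  rw [Equiv.symm_comp_self, D_id] at h
  exact (congrArg (fun L => L v) h).symm

theorem D_iterate_apply_D_symm_iterate {F : X ≃ X} {n : ℕ∞} (hF : IsCn n F)
    (hF' : IsCn n F.symm) (hn : n ≠ 0) (k : ℕ) (p : X) (v : E) :
    D F^[k] (F.symm^[k] p) (D F.symm^[k] p v) = v := by
  have h := D_comp (hF.iterate k) (hF'.iterate k) hn p
  have e : F^[k] ∘ F.symm^[k] = id := funext fun x => iterate_symm_iterate F k x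
  rw [e, D_id] at h
  exact (congrArg (fun L => L v) h).symm

theorem D_iterate_mem {F : X → X} {n : ℕ∞} (hF : IsCn n F) (hn : n ≠ 0)
    {E' : X → Submodule ℝ E} (hE : ∀ p, ∀ v ∈ E' p, D F p v ∈ E' (F p)) (k : ℕ) (p : X) {v : E}
    (hv : v ∈ E' p) : D F^[k] p v ∈ E' (F^[k] p) := by
  induction k with
  | zero =>
    rw [D_iterate_zero_apply]
    exact hv
  | succ k ih =>
    rw [D_iterate_succ_apply hF hn, Function.iterate_succ_apply']
    exact hE _ _ ih

theorem D_iterate_bound {F : X → X} {n : ℕ∞} (hF : IsCn n F) (hn : n ≠ 0)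
    {E' : X → Submodule ℝ E} (hE : ∀ p, ∀ v ∈ E' p, D F p v ∈ E' (F p)) {ν : X → E → ℝ} {lam : ℝ}
    (hlam : 0 ≤ lam) (hν : ∀ p, ∀ v ∈ E' p, ν (F p) (D F p v) ≤ lam * ν p v) (k : ℕ) (p : X) {v : E}
    (hv : v ∈ E' p) : ν (F^[k] p) (D F^[k] p v) ≤ lam ^ k * ν p v := by
  induction k with
  | zero =>
    rw [D_iterate_zero_apply, pow_zero, one_mul]
    exact le_rfl
  | succ k ih =>
    rw [D_iterate_succ_apply hF hn, Function.iterate_succ_apply']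
    refine (hν _ _ (D_iterate_mem hF hn hE k p hv)).trans ?_
    rw [pow_succ', mul_assoc]
    gcongr

/-- The reverse form of `D_iterate_bound`, used for backward iterates of stable vectors, which grow.
-/
theorem D_iterate_bound' {F : X → X} {n : ℕ∞} (hF : IsCn n F) (hn : n ≠ 0)
    {E' : X → Submodule ℝ E} (hE : ∀ p, ∀ v ∈ E' p, D F p v ∈ E' (F p)) {ν : X → E → ℝ} {lam : ℝ}
    (hlam : 0 ≤ lam) (hν : ∀ p, ∀ v ∈ E' p, ν p v ≤ lam * ν (F p) (D F p v)) (k : ℕ) (p : X) {v : E}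
    (hv : v ∈ E' p) : ν p v ≤ lam ^ k * ν (F^[k] p) (D F^[k] p v) := by
  induction k with
  | zero =>
    rw [D_iterate_zero_apply, pow_zero, one_mul]
    exact le_rfl
  | succ k ih =>
    rw [D_iterate_succ_apply hF hn, Function.iterate_succ_apply']
    refine ih.trans ?_
    rw [pow_succ, mul_assoc]
    gcongr
    exact hν _ _ (D_iterate_mem hF hn hE k p hv)

end Iterate

/-- Curves tangent to an invariant subbundle are stretched at most by the growth rate of the
subbundle. -/
theorem dist_iterate_le {F : T4 → T4} {n : ℕ∞} (hF : IsCn n F) (hn : n ≠ 0)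
    {E' : T4 → Submodule ℝ R4} (hE : ∀ p, ∀ v ∈ E' p, D F p v ∈ E' (F p))
    {g : T4 → R4 →L[ℝ] R4 →L[ℝ] ℝ} (hg : IsRiemannianMetric g) {lam : ℝ} (hlam : 0 ≤ lam)
    (hν : ∀ p, ∀ v ∈ E' p, gnorm g (F p) (D F p v) ≤ lam * gnorm g p v) {K : ℝ} (hK0 : 0 ≤ K)
    (hK : ∀ p v, ‖v‖ ≤ K * gnorm g p v) {u : ℝ → T4} {u' : ℝ → R4}
    (hu : ∀ t, HasVelocityAt u (u' t) t) (hc : Continuous u')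
    (hmem : ∀ t ∈ Icc (0 : ℝ) 1, u' t ∈ E' (u t)) (k : ℕ) {t : ℝ} (ht : t ∈ Icc (0 : ℝ) 1) :
    dist (F^[k] (u 0)) (F^[k] (u t)) ≤
      K * lam ^ k * ∫ s in (0 : ℝ)..1, gnorm g (u s) (u' s) := by
  have huc : Continuous u := continuous_iff_continuousAt.2 fun t => (hu t).continuousAt
  have hgc : Continuous fun s => gnorm g (u s) (u' s) :=
    hg.continuous_gnorm.comp (huc.prodMk hc)
  have hDc : Continuous fun s => D F^[k] (u s) (u' s) := by
    have h1 := (hF.iterate k).continuous_D hn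
    have h2 : Continuous fun s => D F^[k] (u s) := h1.comp huc
    exact h2.clm_apply hc
  have h1 := dist_le_integral (fun s => (hu s).map (hF.iterate k) hn) hDc ht.1
  refine h1.trans ?_
  have h2 : ∫ s in (0 : ℝ)..t, ‖D F^[k] (u s) (u' s)‖ ≤
      ∫ s in (0 : ℝ)..t, K * lam ^ k * gnorm g (u s) (u' s) := by
    refine intervalIntegral.integral_mono_on ht.1 (hDc.norm.intervalIntegrable _ _)
      ((continuous_const.mul hgc).intervalIntegrable _ _) fun s hs => ?_
    refine (hK (F^[k] (u s)) _).trans ?_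
    rw [mul_assoc]
    gcongr
    exact D_iterate_bound hF hn hE (ν := gnorm g) hlam hν k _ (hmem s ⟨hs.1, hs.2.trans ht.2⟩)
  refine h2.trans ?_
  rw [intervalIntegral.integral_const_mul]
  gcongr
  exact intervalIntegral.integral_mono_interval le_rfl ht.1 ht.2
    (Eventually.of_forall fun s => gnorm_nonneg _ _) (hgc.intervalIntegrable _ _)

/-! ### Projections along a continuous splitting -/

section Splitting

variable {Ess Ec Euu : T4 → Submodule ℝ R4}

theorem exists_decomposition {A B C : Submodule ℝ R4} (h : DirectSum.IsInternal ![A, B, C])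
    (v : R4) : ∃ a ∈ A, ∃ b ∈ B, ∃ c ∈ C, a + b + c = v := by
  obtain ⟨x, hx⟩ := h.2 v
  refine ⟨(x 0 : R4), (x 0).2, (x 1 : R4), (x 1).2, (x 2 : R4), (x 2).2, ?_⟩
  rw [← hx]
  conv_rhs => rw [← DirectSum.sum_univ_of x]
  rw [map_sum, Fin.sum_univ_three]
  simp only [DirectSum.coeAddMonoidHom_of]

theorem eq_zero_of_decomposition {A B C : Submodule ℝ R4} (h : DirectSum.IsInternal ![A, B, C])
    {a b c : R4} (ha : a ∈ A) (hb : b ∈ B) (hc : c ∈ C) (h0 : a + b + c = 0) :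
    a = 0 ∧ b = 0 ∧ c = 0 := by
  set V : Fin 3 → Submodule ℝ R4 := ![A, B, C] with hV
  have h1 : DirectSum.of (fun i => V i) 0 ⟨a, ha⟩ + DirectSum.of (fun i => V i) 1 ⟨b, hb⟩ +
      DirectSum.of (fun i => V i) 2 ⟨c, hc⟩ = 0 := by
    refine h.1 ?_
    rw [map_zero, map_add, map_add, DirectSum.coeAddMonoidHom_of, DirectSum.coeAddMonoidHom_of,
      DirectSum.coeAddMonoidHom_of]
    exact h0
  have h2 : ∀ i, (DirectSum.of (fun i => V i) 0 ⟨a, ha⟩ + DirectSum.of (fun i => V i) 1 ⟨b, hb⟩ +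
      DirectSum.of (fun i => V i) 2 ⟨c, hc⟩) i = 0 := fun i => by rw [h1]; rfl
  refine ⟨?_, ?_, ?_⟩
  · have := h2 0
    simp only [DirectSum.add_apply, DirectSum.of_eq_same, ne_eq, Fin.reduceEq, not_false_eq_true,
      DirectSum.of_eq_of_ne, add_zero] at this
    exact congrArg Subtype.val this
  · have := h2 1
    simp only [DirectSum.add_apply, DirectSum.of_eq_same, ne_eq, Fin.reduceEq, not_false_eq_true,
      DirectSum.of_eq_of_ne, add_zero, zero_add] at this
    exact congrArg Subtype.val this
  · have := h2 2
    simp only [DirectSum.add_apply, DirectSum.of_eq_same, ne_eq, Fin.reduceEq, not_false_eq_true,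
      DirectSum.of_eq_of_ne, add_zero, zero_add] at this
    exact congrArg Subtype.val this

theorem decomposition_unique {A B C : Submodule ℝ R4} (h : DirectSum.IsInternal ![A, B, C])
    {a b c a' b' c' : R4} (ha : a ∈ A) (hb : b ∈ B) (hc : c ∈ C) (ha' : a' ∈ A) (hb' : b' ∈ B)
    (hc' : c' ∈ C) (h0 : a + b + c = a' + b' + c') : a = a' ∧ b = b' ∧ c = c' := by
  have h1 := eq_zero_of_decomposition h (A.sub_mem ha ha') (B.sub_mem hb hb') (C.sub_mem hc hc')
    (by rw [← sub_eq_zero] at h0; rw [← h0]; abel)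
  exact ⟨sub_eq_zero.1 h1.1, sub_eq_zero.1 h1.2.1, sub_eq_zero.1 h1.2.2⟩

/-- The projections associated with a continuous splitting are continuous. -/
theorem exists_continuous_projections (hs : IsSubbundle Ess) (hc : IsSubbundle Ec)
    (hu : IsSubbundle Euu) (hsplit : ∀ p, DirectSum.IsInternal ![Ess p, Ec p, Euu p]) :
    ∃ πs πc πu : T4 → R4 →L[ℝ] R4, Continuous πs ∧ Continuous πc ∧ Continuous πu ∧
      ∀ p v, πs p v ∈ Ess p ∧ πc p v ∈ Ec p ∧ πu p v ∈ Euu p ∧ πs p v + πc p v + πu p v = v := by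
  obtain ⟨Ps, hPs, hPs', hPsE⟩ := hs
  obtain ⟨Pc, hPc, hPc', hPcE⟩ := hc
  obtain ⟨Pu, hPu, hPu', hPuE⟩ := hu
  have ms : ∀ p v, Ps p v ∈ Ess p := fun p v => by rw [← hPsE]; exact ⟨v, rfl⟩
  have mc : ∀ p v, Pc p v ∈ Ec p := fun p v => by rw [← hPcE]; exact ⟨v, rfl⟩
  have mu : ∀ p v, Pu p v ∈ Euu p := fun p v => by rw [← hPuE]; exact ⟨v, rfl⟩
  -- The splitting makes Ψ surjective, and the three summands are determined by their sum, so the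
  -- projections may be read off from any right inverse of Ψ.
  set Ψ : T4 → (R4 × R4 × R4) →L[ℝ] R4 := fun p =>
    (Ps p).comp (ContinuousLinearMap.fst ℝ R4 (R4 × R4)) +
      ((Pc p).comp (ContinuousLinearMap.fst ℝ R4 R4) +
        (Pu p).comp (ContinuousLinearMap.snd ℝ R4 R4)).comp
          (ContinuousLinearMap.snd ℝ R4 (R4 × R4)) with hΨ
  have hΨa : ∀ p w, Ψ p w = Ps p w.1 + Pc p w.2.1 + Pu p w.2.2 := fun p w => by
    simp [hΨ, add_assoc]
  have hΨc : Continuous Ψ := by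
    refine Continuous.add (hPs.clm_comp continuous_const) (Continuous.clm_comp
      (Continuous.add (hPc.clm_comp continuous_const) (hPu.clm_comp continuous_const))
      continuous_const)
  have hsurj : ∀ p, Function.Surjective (Ψ p) := fun p v => by
    obtain ⟨a, ha, b, hb, c, hc, e⟩ := exists_decomposition (hsplit p) v
    rw [← hPsE] at ha
    rw [← hPcE] at hb
    rw [← hPuE] at hc
    obtain ⟨a, rfl⟩ := ha
    obtain ⟨b, rfl⟩ := hb
    obtain ⟨c, rfl⟩ := hc
    exact ⟨(a, b, c), by rw [hΨa]; exact e⟩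
  have hinv : ∀ p, ∃ Q : R4 →L[ℝ] R4 × R4 × R4, ∀ v, Ψ p (Q v) = v := fun p => by
    obtain ⟨Q, hQ⟩ := ContinuousLinearMap.exists_rightInverse_of_surjective (Ψ p)
      (LinearMap.range_eq_top.2 (hsurj p))
    exact ⟨Q, fun v => congrArg (fun L => L v) hQ⟩
  choose Q hQ using hinv
  -- The chosen right inverse `Q` need not vary continuously. Near `p₀` it is replaced by `Q p₀`
  -- corrected by the inverse of `Ψ p ∘ Q p₀`, which is close to the identity; uniqueness of the
  -- summands makes the projections agree.
  have hloc : ∀ p₀, ∃ Q' : T4 → R4 →L[ℝ] R4 × R4 × R4, ContinuousAt Q' p₀ ∧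
      ∀ᶠ p in 𝓝 p₀, ∀ v, Ψ p (Q' p v) = v := fun p₀ => by
    set A : T4 → R4 →L[ℝ] R4 := fun p => (Ψ p).comp (Q p₀) with hA
    have hAc : Continuous A := hΨc.clm_comp continuous_const
    have hA0 : A p₀ = 1 := ContinuousLinearMap.ext fun v => hQ p₀ v
    refine ⟨fun p => (Q p₀).comp (Ring.inverse (A p)), ?_, ?_⟩
    · refine ContinuousAt.clm_comp continuousAt_const ?_
      refine ContinuousAt.comp' (g := Ring.inverse) ?_ hAc.continuousAt
      rw [hA0]
      exact NormedRing.inverse_continuousAt 1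
    · have h1 : ∀ᶠ p in 𝓝 p₀, IsUnit (A p) := by
        refine hAc.continuousAt.eventually (Units.isOpen.mem_nhds ?_)
        rw [hA0]
        exact isUnit_one
      filter_upwards [h1] with p hp v
      exact congrArg (fun L : R4 →L[ℝ] R4 => L v) (Ring.mul_inverse_cancel _ hp)
  have huniq : ∀ p w w', Ψ p w = Ψ p w' → Ps p w.1 = Ps p w'.1 ∧ Pc p w.2.1 = Pc p w'.2.1 ∧
      Pu p w.2.2 = Pu p w'.2.2 := fun p w w' h => by
    rw [hΨa, hΨa] at h
    exact decomposition_unique (hsplit p) (ms _ _) (mc _ _) (mu _ _) (ms _ _) (mc _ _) (mu _ _) h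
  refine ⟨fun p => (Ps p).comp ((ContinuousLinearMap.fst ℝ R4 (R4 × R4)).comp (Q p)),
    fun p => (Pc p).comp (((ContinuousLinearMap.fst ℝ R4 R4).comp
      (ContinuousLinearMap.snd ℝ R4 (R4 × R4))).comp (Q p)),
    fun p => (Pu p).comp (((ContinuousLinearMap.snd ℝ R4 R4).comp
      (ContinuousLinearMap.snd ℝ R4 (R4 × R4))).comp (Q p)), ?_, ?_, ?_, fun p v =>
    ⟨ms _ _, mc _ _, mu _ _, ?_⟩⟩
  · refine continuous_iff_continuousAt.2 fun p₀ => ?_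
    obtain ⟨Q', hQ'c, hQ'⟩ := hloc p₀
    refine ContinuousAt.congr (f := fun p =>
      (Ps p).comp ((ContinuousLinearMap.fst ℝ R4 (R4 × R4)).comp (Q' p))) ?_ ?_
    · exact hPs.continuousAt.clm_comp (continuousAt_const.clm_comp hQ'c)
    · filter_upwards [hQ'] with p hp
      exact ContinuousLinearMap.ext fun v => (huniq p _ _ ((hp v).trans (hQ p v).symm)).1
  · refine continuous_iff_continuousAt.2 fun p₀ => ?_
    obtain ⟨Q', hQ'c, hQ'⟩ := hloc p₀
    refine ContinuousAt.congr (f := fun p => (Pc p).comp (((ContinuousLinearMap.fst ℝ R4 R4).comp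
      (ContinuousLinearMap.snd ℝ R4 (R4 × R4))).comp (Q' p))) ?_ ?_
    · exact hPc.continuousAt.clm_comp (continuousAt_const.clm_comp hQ'c)
    · filter_upwards [hQ'] with p hp
      exact ContinuousLinearMap.ext fun v => (huniq p _ _ ((hp v).trans (hQ p v).symm)).2.1
  · refine continuous_iff_continuousAt.2 fun p₀ => ?_
    obtain ⟨Q', hQ'c, hQ'⟩ := hloc p₀
    refine ContinuousAt.congr (f := fun p => (Pu p).comp (((ContinuousLinearMap.snd ℝ R4 R4).comp
      (ContinuousLinearMap.snd ℝ R4 (R4 × R4))).comp (Q' p))) ?_ ?_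
    · exact hPu.continuousAt.clm_comp (continuousAt_const.clm_comp hQ'c)
    · filter_upwards [hQ'] with p hp
      exact ContinuousLinearMap.ext fun v => (huniq p _ _ ((hp v).trans (hQ p v).symm)).2.2
  · exact (hΨa p (Q p v)).symm.trans (hQ p v)

end Splitting

/-! ### Continuity and boundedness from Hölder bounds and compactness -/

theorem continuous_of_norm_sub_le_rpow {X V : Type} [PseudoMetricSpace X] [NormedAddCommGroup V]
    {F : X → V} {C α : ℝ} (hα : 0 < α) (h : ∀ p q, ‖F p - F q‖ ≤ C * dist p q ^ α) :
    Continuous F := by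
  refine continuous_iff_continuousAt.2 fun q => ?_
  rw [ContinuousAt, tendsto_iff_norm_sub_tendsto_zero]
  refine squeeze_zero (fun _ => norm_nonneg _) (fun p => h p q) ?_
  have h1 : Continuous fun p => C * dist p q ^ α :=
    continuous_const.mul ((continuous_id.dist continuous_const).rpow_const fun _ => Or.inr hα.le)
  have h2 := h1.tendsto q
  simpa [Real.zero_rpow hα.ne'] using h2

theorem exists_norm_le_of_continuous {X V : Type} [TopologicalSpace X] [CompactSpace X]
    [NormedAddCommGroup V] {F : X → V} (hF : Continuous F) : ∃ M, ∀ p, ‖F p‖ ≤ M := by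
  obtain ⟨M, hM⟩ := isCompact_univ.exists_bound_of_continuousOn hF.continuousOn
  exact ⟨M, fun p => hM p (mem_univ p)⟩

theorem IsC2Holder.continuous_D2 {α : ℝ} (hα : 0 < α) {F : T4 → T4} (hF : IsC2Holder α F) :
    Continuous (D2 F) := by
  obtain ⟨C, hC⟩ := hF.2
  exact continuous_of_norm_sub_le_rpow (V := R4 →L[ℝ] R4 →L[ℝ] R4) (F := D2 F) hα hC

/-! ### Derivatives along the fibres -/

section Fibre

theorem localRep_fibreMap (F : T4 → T4) (p : T4) (v : R2) :
    localRep (fibreMap F p.2) p.1 v = (localRep F p (v, 0)).1 := by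
  rw [localRep_def, localRep_def, T4.rep_eq, T4.proj_eq]
  simp only [fibreMap, proj_zero, Prod.fst_sub]
  have : ((p.1 + FlatTorus.proj v, p.2) : T4) = p + (FlatTorus.proj v, 0) :=
    Prod.ext rfl (by simp)
  rw [this]

theorem fibreD_eq {F : T4 → T4} {n : ℕ∞} (hF : IsCn n F) (hn : n ≠ 0) (p : T4) :
    fibreD F p = (ContinuousLinearMap.fst ℝ R2 R2).comp
      ((D F p).comp (ContinuousLinearMap.inl ℝ R2 R2)) := by
  refine HasFDerivAt.fderiv ?_
  have e : localRep (fibreMap F p.2) p.1 = fun v => (localRep F p (v, 0)).1 :=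
    funext (localRep_fibreMap F p)
  rw [e]
  have h1 : HasFDerivAt (fun v : R2 => localRep F p (v, 0))
      ((D F p).comp (ContinuousLinearMap.inl ℝ R2 R2)) 0 :=
    HasFDerivAt.comp (0 : R2) (g := localRep F p) (f := fun v : R2 => ((v, 0) : R4))
      (hF.hasFDerivAt hn p) (ContinuousLinearMap.inl ℝ R2 R2).hasFDerivAt
  exact (ContinuousLinearMap.fst ℝ R2 R2).hasFDerivAt.comp (0 : R2) h1

theorem fibreD_apply {F : T4 → T4} {n : ℕ∞} (hF : IsCn n F) (hn : n ≠ 0) (p : T4) (v : R2) :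
    fibreD F p v = (D F p (v, 0)).1 := by
  rw [fibreD_eq hF hn]
  rfl

theorem fibreD2_apply {F : T4 → T4} (hF : IsCn 2 F) (p : T4) (u v : R2) :
    fibreD2 F p u v = (D2 F p (u, 0) (v, 0)).1 := by
  have e : (fun w : R2 => D (fibreMap F p.2) (p.1 + FlatTorus.proj w)) = fun w : R2 =>
      (ContinuousLinearMap.fst ℝ R2 R2).comp
        ((D F (p + FlatTorus.proj ((w, 0) : R4))).comp (ContinuousLinearMap.inl ℝ R2 R2)) := by
    funext w
    rw [← fibreD_eq hF two_ne_zero]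
    have : p + FlatTorus.proj ((w, 0) : R4) = (p.1 + FlatTorus.proj w, p.2) := by
      rw [T4.proj_eq]
      exact Prod.ext rfl (by simp [proj_zero])
    rw [this]
    rfl
  have h1 : HasFDerivAt (fun w : R2 => D F (p + FlatTorus.proj ((w, 0) : R4)))
      ((D2 F p).comp (ContinuousLinearMap.inl ℝ R2 R2)) 0 := by
    have h2 := HasFDerivAt.comp (0 : R2) (f := fun w : R2 => ((w, 0) : R4))
      (hF.hasFDerivAt_D p ((0 : R2), (0 : R2)))
      (ContinuousLinearMap.inl ℝ R2 R2).hasFDerivAt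
    have h0 : p + FlatTorus.proj (((0 : R2), (0 : R2)) : R4) = p := by
      have : (((0 : R2), (0 : R2)) : R4) = 0 := rfl
      rw [this, proj_zero, add_zero]
    rw [h0] at h2
    exact h2
  have h3 := (hasFDerivAt_const (ContinuousLinearMap.fst ℝ R2 R2) (0 : R2)).clm_comp
    (h1.clm_comp (hasFDerivAt_const (ContinuousLinearMap.inl ℝ R2 R2) (0 : R2)))
  rw [fibreD2, D2, e, h3.fderiv]
  simp

theorem norm_prodMk_zero (v : R2) : ‖((v, 0) : R4)‖ = ‖v‖ := by
  rw [Prod.norm_def, norm_zero, max_eq_left (norm_nonneg _)]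

theorem norm_fibreD_sub_le {F : T4 → T4} (hF : IsCn 2 F) (p q : T4) :
    ‖fibreD F p - fibreD F q‖ ≤ ‖D F p - D F q‖ := by
  refine ContinuousLinearMap.opNorm_le_bound _ (norm_nonneg _) fun v => ?_
  rw [sub_apply, fibreD_apply hF two_ne_zero, fibreD_apply hF two_ne_zero, ← Prod.fst_sub,
    ← sub_apply]
  refine (norm_fst_le _).trans ((ContinuousLinearMap.le_opNorm _ _).trans_eq ?_)
  rw [norm_prodMk_zero]

theorem norm_fibreD2_sub_le {F : T4 → T4} (hF : IsCn 2 F) (p q : T4) :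
    ‖fibreD2 F p - fibreD2 F q‖ ≤ ‖D2 F p - D2 F q‖ := by
  refine ContinuousLinearMap.opNorm_le_bound₂ _ (norm_nonneg (D2 F p - D2 F q)) fun u v => ?_
  rw [sub_apply, sub_apply, fibreD2_apply hF, fibreD2_apply hF, ← Prod.fst_sub]
  refine (norm_fst_le _).trans (((D2 F p - D2 F q).le_opNorm₂ (u, 0) (v, 0)).trans_eq ?_)
  rw [norm_prodMk_zero, norm_prodMk_zero]

theorem norm_fibreD2_le {F : T4 → T4} (hF : IsCn 2 F) (p : T4) : ‖fibreD2 F p‖ ≤ ‖D2 F p‖ := by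
  refine ContinuousLinearMap.opNorm_le_bound₂ _ (norm_nonneg (D2 F p)) fun u v => ?_
  rw [fibreD2_apply hF]
  refine (norm_fst_le _).trans (((D2 F p).le_opNorm₂ (u, 0) (v, 0)).trans_eq ?_)
  rw [norm_prodMk_zero, norm_prodMk_zero]

theorem continuous_fibreD {F : T4 → T4} (hF : IsCn 2 F) : Continuous (fibreD F) := by
  have e : fibreD F = fun p => (ContinuousLinearMap.fst ℝ R2 R2).comp
      ((D F p).comp (ContinuousLinearMap.inl ℝ R2 R2)) := funext (fibreD_eq hF two_ne_zero)
  rw [e]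
  exact continuous_const.clm_comp ((hF.continuous_D two_ne_zero).clm_comp continuous_const)

theorem continuous_fibreD2 {F : T4 → T4} (hF : IsCn 2 F) (hc : Continuous (D2 F)) :
    Continuous (fibreD2 F) := by
  refine continuous_clm_apply.2 fun u => continuous_clm_apply.2 fun v => ?_
  simp only [fibreD2_apply hF]
  exact ((hc.clm_apply continuous_const).clm_apply continuous_const).fst

theorem D_snd {F : T4 → T4} {G : T2 → T2} {n m : ℕ∞} (hF : IsCn n F) (hG : IsCn m G)
    (hn : n ≠ 0) (hm : m ≠ 0) (hs : ∀ p, (F p).2 = G p.2) (p : T4) (v : R4) :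
    (D F p v).2 = D G p.2 v.2 := by
  have e : (fun v : R4 => (localRep F p v).2) = fun v : R4 => localRep G p.2 v.2 := by
    funext v
    rw [localRep_def, localRep_def, T4.rep_eq]
    simp only [Prod.snd_sub, hs]
    rfl
  have h1 : HasFDerivAt (fun v : R4 => (localRep F p v).2)
      ((ContinuousLinearMap.snd ℝ R2 R2).comp (D F p)) 0 :=
    (ContinuousLinearMap.snd ℝ R2 R2).hasFDerivAt.comp (0 : R4) (hF.hasFDerivAt hn p)
  have h2 : HasFDerivAt (fun v : R4 => localRep G p.2 v.2)
      ((D G p.2).comp (ContinuousLinearMap.snd ℝ R2 R2)) 0 :=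
    HasFDerivAt.comp (0 : R4) (g := localRep G p.2) (by simpa using hG.hasFDerivAt hm p.2)
      (ContinuousLinearMap.snd ℝ R2 R2).hasFDerivAt
  rw [e] at h1
  exact congrArg (fun L => L v) (h1.unique h2)

end Fibre

/-! ### The fibre bounds of a bunched skew product -/

section Main

variable {α : ℝ} {f : T4 ≃ T4} {f₂ : T2 ≃ T2} {g : T4 → R4 →L[ℝ] R4 →L[ℝ] ℝ}
  {Ess Ec Euu : T4 → Submodule ℝ R4} {χss χm χp χuu : ℝ}

namespace IsPartiallyHyperbolicSkewProduct

theorem isCn (hf : IsPartiallyHyperbolicSkewProduct α f f₂ g Ess Ec Euu χss χm χp χuu) :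
    IsCn 2 f := hf.skew.diffeo.1.1

theorem isCn_symm (hf : IsPartiallyHyperbolicSkewProduct α f f₂ g Ess Ec Euu χss χm χp χuu) :
    IsCn 2 f.symm := hf.skew.diffeo.2.1

theorem mem_centre (hf : IsPartiallyHyperbolicSkewProduct α f f₂ g Ess Ec Euu χss χm χp χuu)
    {p : T4} {v : R4} : v ∈ Ec p ↔ v.2 = 0 := by
  rw [hf.centre, LinearMap.mem_ker]
  rfl

theorem D_mem_c (hf : IsPartiallyHyperbolicSkewProduct α f f₂ g Ess Ec Euu χss χm χp χuu)
    (p : T4) (v : R4) (hv : v ∈ Ec p) : D f p v ∈ Ec (f p) := by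
  rw [← hf.hyperbolic.invariant_c p]
  exact ⟨v, hv, rfl⟩

theorem D_mem_uu (hf : IsPartiallyHyperbolicSkewProduct α f f₂ g Ess Ec Euu χss χm χp χuu)
    (p : T4) (v : R4) (hv : v ∈ Euu p) : D f p v ∈ Euu (f p) := by
  rw [← hf.hyperbolic.invariant_uu p]
  exact ⟨v, hv, rfl⟩

theorem D_symm_uu (hf : IsPartiallyHyperbolicSkewProduct α f f₂ g Ess Ec Euu χss χm χp χuu)
    (p : T4) (v : R4) (hv : v ∈ Euu p) : D f.symm p v ∈ Euu (f.symm p) ∧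
      gnorm g (f.symm p) (D f.symm p v) ≤ χuu⁻¹ * gnorm g p v := by
  obtain ⟨q, rfl⟩ := f.surjective p
  rw [← hf.hyperbolic.invariant_uu q] at hv
  obtain ⟨w, hw, rfl⟩ := hv
  have h0 : D f.symm (f q) ((D f q).toLinearMap w) = w :=
    D_symm_apply_D hf.isCn hf.isCn_symm two_ne_zero q w
  rw [h0, Equiv.symm_apply_apply]
  refine ⟨hw, ?_⟩
  rw [le_inv_mul_iff₀ (zero_lt_one.trans hf.hyperbolic.one_lt_uu)]
  exact hf.hyperbolic.conorm_uu q w hw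

theorem D_symm_ss (hf : IsPartiallyHyperbolicSkewProduct α f f₂ g Ess Ec Euu χss χm χp χuu)
    (p : T4) (v : R4) (hv : v ∈ Ess p) : D f.symm p v ∈ Ess (f.symm p) ∧
      gnorm g p v ≤ χss * gnorm g (f.symm p) (D f.symm p v) := by
  obtain ⟨q, rfl⟩ := f.surjective p
  rw [← hf.hyperbolic.invariant_ss q] at hv
  obtain ⟨w, hw, rfl⟩ := hv
  have h0 : D f.symm (f q) ((D f q).toLinearMap w) = w :=
    D_symm_apply_D hf.isCn hf.isCn_symm two_ne_zero q w
  rw [h0, Equiv.symm_apply_apply]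
  exact ⟨hw, hf.hyperbolic.norm_ss q w hw⟩

theorem D_prodMk_zero (hf : IsPartiallyHyperbolicSkewProduct α f f₂ g Ess Ec Euu χss χm χp χuu)
    (p : T4) (v : R2) : D f p (v, 0) = (fibreD f p v, 0) := by
  refine Prod.ext (fibreD_apply hf.isCn two_ne_zero p v).symm ?_
  exact hf.mem_centre.1 (hf.D_mem_c p (v, 0) (hf.mem_centre.2 rfl))

theorem exists_fibreBounds
    (hf : IsPartiallyHyperbolicSkewProduct α f f₂ g Ess Ec Euu χss χm χp χuu)
    (hα : 0 < α) (hα1 : α < 1) (hb : CenterUnstableBunched α χm χp χuu) :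
    ∃ K, FibreBounds f f₂ (fun p v => gnorm g p (v, 0)) α χm χp χuu K := by
  have hh := hf.hyperbolic
  have hcn := hf.isCn
  have hm : 0 < χm := hh.ss_pos.trans hh.ss_lt_m
  have hp : 0 < χp := hm.trans_le hh.m_le_p
  have hu : 0 < χuu := zero_lt_one.trans hh.one_lt_uu
  obtain ⟨K, hK1, hK⟩ := hh.metric.exists_equiv
  have hK0 := zero_le_one.trans hK1
  have hD2c : Continuous (D2 f) := hf.skew.diffeo.1.continuous_D2 hα
  obtain ⟨M₁, hM₁⟩ := exists_norm_le_of_continuous (hcn.continuous_D two_ne_zero)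
  obtain ⟨M₂, hM₂⟩ := exists_norm_le_of_continuous
    (V := R4 →L[ℝ] R4 →L[ℝ] R4) (F := D2 f) hD2c
  obtain ⟨C, hC⟩ := hf.skew.diffeo.1.2
  have hM₁0 : 0 ≤ M₁ := (norm_nonneg (D f 0)).trans (hM₁ 0)
  have hM₂0 : 0 ≤ M₂ := (norm_nonneg (D2 f 0)).trans (hM₂ 0)
  -- One constant dominating all requirements; 2K² comes from `iterate_lip`, the other terms from
  -- bounds on Df, D²f and the Hölder constant.
  set L := 2 * K ^ 2 + 2 * M₁ + 2 * M₂ + |C| with hL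
  have hK2 : 1 ≤ K ^ 2 := one_le_pow₀ hK1
  have hKK : K ≤ K ^ 2 := le_self_pow₀ hK1 two_ne_zero
  have hC0 := abs_nonneg C
  have fibre : ∀ b, ∃ k : T2 ≃ T2, IsC2HolderDiffeo α k ∧ ∀ x, k x = fibreMap f b x :=
    hf.skew.fibre_diffeo
  refine ⟨L, ⟨hf.skew.semiconj, fun b => ?_, fun b => ?_, hcn.continuous,
    hf.isCn_symm.continuous, hf.skew.base_diffeo.2.1.continuous, continuous_fibreD hcn,
    continuous_fibreD2 hcn hD2c, continuous_fibreD hf.isCn_symm,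
    continuous_fibreD2 hf.isCn_symm (hf.skew.diffeo.2.continuous_D2 hα), hα, hα1.le, hm,
    hh.m_le_p, hh.one_lt_uu, (div_lt_one hu).2 hh.p_lt_uu, ?_, ?_, by linarith,
    fun x b b' => ?_, fun p => ?_, fun p q => ?_, fun p q => ?_, fun p v w => ?_,
    fun p v => gnorm_nonneg _ _, fun p v => ?_, fun p v => ?_, fun p v => ?_, fun p v => ?_,
    fun n y y' b => ?_⟩⟩
  · obtain ⟨k, hk, hkf⟩ := fibre b
    have : fibreMap f b = k := funext fun x => (hkf x).symm
    rw [this]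
    exact hk.1.1
  -- The fibre map of `f.symm` over `b` inverts that of `f` over `f₂.symm b`, hence the shifted base
  -- point.
  · obtain ⟨k, hk, hkf⟩ := fibre (f₂.symm b)
    have : fibreMap f.symm b = k.symm := funext fun x => by
      rw [Equiv.eq_symm_apply, hkf, fibreMap_fibreMap_symm hf.skew.semiconj]
    rw [this]
    exact hk.2.1
  · rw [div_lt_one hu]
    -- As χp/χm ≥ 1, it is at most its square, which the first bunching inequality bounds by χuu.
    have h1 : 1 ≤ χp / χm := (one_le_div hm).2 hh.m_le_p
    have := hb.1
    nlinarith
  · rw [div_lt_one (by positivity)]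
    exact hb.2
  · have h1 := dist_map_le hcn two_ne_zero hM₁ ((x, b) : T4) (x, b')
    have h2 : dist (fibreMap f b x) (fibreMap f b' x) ≤ dist (f (x, b)) (f (x, b')) := by
      rw [Prod.dist_eq]
      exact le_max_left _ _
    have h3 : dist ((x, b) : T4) (x, b') = dist b b' := by
      rw [Prod.dist_eq, dist_self, max_eq_right dist_nonneg]
    rw [h3] at h1
    refine h2.trans (h1.trans ?_)
    gcongr
    linarith
  · refine (norm_fibreD2_le hcn p).trans ((hM₂ p).trans ?_)
    linarith
  · refine (norm_fibreD_sub_le hcn p q).trans ((hcn.norm_D_sub_le hM₂ p q).trans ?_)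
    gcongr
    linarith
  · refine (norm_fibreD2_sub_le hcn p q).trans ((hC p q).trans ?_)
    gcongr
    linarith [le_abs_self C]
  · have h1 := hh.metric.gnorm_add_le p (v, 0) (w, 0)
    rwa [Prod.mk_add_mk, add_zero] at h1
  · refine (hK p (v, 0)).1.trans ?_
    rw [norm_prodMk_zero]
    gcongr
    linarith
  · have h1 := (hK p (v, 0)).2
    rw [norm_prodMk_zero] at h1
    refine h1.trans ?_
    have := gnorm_nonneg (g := g) p (v, 0)
    gcongr
    linarith
  · have h1 := hh.norm_c p (v, 0) (hf.mem_centre.2 rfl)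
    rwa [hf.D_prodMk_zero] at h1
  · have h1 := hh.conorm_c p (v, 0) (hf.mem_centre.2 rfl)
    rwa [hf.D_prodMk_zero] at h1
  -- A straight segment in a fibre is a centre curve, so `dist_iterate_le` applies with growth rate
  -- χp.
  · obtain ⟨v, hv, hy', hvel⟩ := exists_segment y y'
    have hvel' : ∀ t : ℝ, HasVelocityAt (fun s : ℝ => ((y + FlatTorus.proj (s • v), b) : T4))
        ((v, 0) : R4) t := fun t => (hvel t).prodMk (hasVelocityAt_const b t)
    have h1 := dist_iterate_le (g := g) hcn two_ne_zero hf.D_mem_c hh.metric hp.le hh.norm_c hK0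
      (fun p v => (hK p v).2) hvel' continuous_const (fun t _ => hf.mem_centre.2 rfl) n
      (t := 1) ⟨zero_le_one, le_rfl⟩
    simp only [hy', zero_smul, proj_zero, add_zero] at h1
    have h2 : ∫ s in (0 : ℝ)..1, gnorm g (y + FlatTorus.proj (s • v), b) (v, 0) ≤
        ∫ s in (0 : ℝ)..1, K * (2 * dist y y') := by
      refine intervalIntegral.integral_mono_on zero_le_one ?_ (by simp) fun s _ => ?_
      · refine Continuous.intervalIntegrable ?_ _ _
        have := continuous_proj (X := T2) (E := R2)
        exact hh.metric.continuous_gnorm.comp (f := fun s : ℝ =>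
          (((y + FlatTorus.proj (s • v), b) : T4), ((v, 0) : R4))) (by fun_prop)
      · refine (hK _ _).1.trans ?_
        rw [norm_prodMk_zero]
        gcongr
    rw [intervalIntegral.integral_const, sub_zero, one_smul] at h2
    have h3 : dist (f^[n] (y, b)).1 (f^[n] (y', b)).1 ≤ dist (f^[n] (y, b)) (f^[n] (y', b)) := by
      rw [Prod.dist_eq]
      exact le_max_left _ _
    have hpn : 0 ≤ χp ^ n := by positivity
    calc dist (f^[n] (y, b)).1 (f^[n] (y', b)).1
        ≤ K * χp ^ n * (K * (2 * dist y y')) := h3.trans (h1.trans (by gcongr))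
      _ = 2 * K ^ 2 * (χp ^ n * dist y y') := by ring
      _ ≤ L * (χp ^ n * dist y y') := by gcongr; linarith
      _ = _ := by ring

end IsPartiallyHyperbolicSkewProduct

end Main

/-! ### The limit maps follow the unstable leaves -/

section Main

variable {α : ℝ} {f : T4 ≃ T4} {f₂ : T2 ≃ T2} {g : T4 → R4 →L[ℝ] R4 →L[ℝ] ℝ}
  {Ess Ec Euu : T4 → Submodule ℝ R4} {χss χm χp χuu : ℝ}

theorem transfer_self (hs : ∀ p, (f p).2 = f₂ p.2) (n : ℕ) (b x : T2) :
    transfer f f₂ n b b x = x := by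
  have h : (f.symm^[n] (x, b)).2 = f₂.symm^[n] b := iterate_snd (symm_semiconj hs) n _
  rw [transfer, ← h]
  exact congrArg Prod.fst (iterate_symm_iterate f n (x, b))

theorem IsTangentCurve.hasVelocityAt {p q : T4} {c : ℝ → R4} (hc : IsTangentCurve Euu p q c)
    (t : ℝ) : HasVelocityAt (fun s => (FlatTorus.proj (c s) : T4)) (deriv c t) t :=
  HasDerivAt.hasVelocityAt
    ((hc.contDiff.differentiable one_ne_zero) t).hasDerivAt

theorem IsTangentCurve.continuous_deriv {p q : T4} {c : ℝ → R4} (hc : IsTangentCurve Euu p q c) :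
    Continuous (deriv c) := hc.contDiff.continuous_deriv le_rfl

/-- A tangent curve can be reparametrised so as to be tangent for all times. -/
theorem IsTangentCurve.exists_reparam {p q : T4} {c : ℝ → R4} (hc : IsTangentCurve Euu p q c) :
    ∃ c' : ℝ → R4, IsTangentCurve Euu p q c' ∧
      (∀ t, deriv c' t ∈ Euu (FlatTorus.proj (c' t))) ∧ ∀ t, ∃ s ∈ Icc (0 : ℝ) 1, c' t = c s := by
  -- This smooth function fixes 0 and 1 and maps ℝ into [0, 1], so tangency on [0, 1] becomes
  -- tangency at all times.
  set s : ℝ → ℝ := fun t => (1 - Real.cos (Real.pi * t)) / 2 with hs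
  have hsd : ContDiff ℝ 1 s := by
    rw [hs]
    exact ((contDiff_const.sub (Real.contDiff_cos.comp (contDiff_const.mul contDiff_id))).div_const
      2)
  have hmem : ∀ t, s t ∈ Icc (0 : ℝ) 1 := fun t => by
    have h1 := Real.neg_one_le_cos (Real.pi * t)
    have h2 := Real.cos_le_one (Real.pi * t)
    constructor <;> simp only [hs] <;> linarith
  have hder : ∀ t, deriv (c ∘ s) t = deriv s t • deriv c (s t) := fun t =>
    deriv.scomp t ((hc.contDiff.differentiable one_ne_zero) _)
      ((hsd.differentiable one_ne_zero) t)
  have htan : ∀ t, deriv (c ∘ s) t ∈ Euu (FlatTorus.proj ((c ∘ s) t)) := fun t => by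
    rw [hder]
    exact Submodule.smul_mem _ _ (hc.tangent _ (hmem t))
  refine ⟨c ∘ s, ⟨hc.contDiff.comp hsd, ?_, ?_, fun t _ => htan t⟩, htan,
    fun t => ⟨s t, hmem t, rfl⟩⟩
  · simp [hs, hc.source]
  · have : s 1 = 1 := by simp [hs]
    simp [this, hc.target]

namespace IsPartiallyHyperbolicSkewProduct

theorem exists_dist_backward_le
    (hf : IsPartiallyHyperbolicSkewProduct α f f₂ g Ess Ec Euu χss χm χp χuu) :
    ∃ K, 0 < K ∧ ∀ p q c, IsTangentCurve Euu p q c → ∀ n : ℕ, ∀ t ∈ Icc (0 : ℝ) 1,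
      dist (f.symm^[n] p) (f.symm^[n] (FlatTorus.proj (c t))) ≤
        K * (∫ s in (0 : ℝ)..1, gnorm g (FlatTorus.proj (c s)) (deriv c s)) * χuu⁻¹ ^ n := by
  have hh := hf.hyperbolic
  have hu : 0 < χuu := zero_lt_one.trans hh.one_lt_uu
  obtain ⟨K, hK1, hK⟩ := hh.metric.exists_equiv
  have hK0 := zero_lt_one.trans_le hK1
  refine ⟨K, hK0, fun p q c hc n t ht => ?_⟩
  have h1 := dist_iterate_le (g := g) hf.isCn_symm two_ne_zero (fun p v hv => (hf.D_symm_uu p v hv).1)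
    hh.metric (inv_nonneg.2 hu.le) (fun p v hv => (hf.D_symm_uu p v hv).2) hK0.le
    (fun p v => (hK p v).2) hc.hasVelocityAt hc.continuous_deriv hc.tangent n ht
  rw [hc.source] at h1
  linarith

/-- Backward iterates contract unstable curves at rate χuu⁻¹, and projecting to the base does not
increase distances. The constant is uniform over all curves of length at most `R`. -/
theorem exists_backwardClose
    (hf : IsPartiallyHyperbolicSkewProduct α f f₂ g Ess Ec Euu χss χm χp χuu) :
    ∃ K, 0 < K ∧ ∀ p q c, IsTangentCurve Euu p q c → ∀ R,
      ∫ s in (0 : ℝ)..1, gnorm g (FlatTorus.proj (c s)) (deriv c s) ≤ R → ∀ t ∈ Icc (0 : ℝ) 1,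
      BackwardClose f₂ χuu (K * R) p.2 (FlatTorus.proj (c t) : T4).2 := by
  obtain ⟨K, hK0, hK⟩ := hf.exists_dist_backward_le
  have hu : 0 < χuu := zero_lt_one.trans hf.hyperbolic.one_lt_uu
  refine ⟨K, hK0, fun p q c hc R hR t ht n => ?_⟩
  have h1 := hK p q c hc n t ht
  rw [← iterate_snd (symm_semiconj hf.skew.semiconj), ← iterate_snd (symm_semiconj hf.skew.semiconj)]
  have h2 : dist (f.symm^[n] p).2 (f.symm^[n] (FlatTorus.proj (c t))).2 ≤
      dist (f.symm^[n] p) (f.symm^[n] (FlatTorus.proj (c t))) := by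
    rw [Prod.dist_eq]
    exact le_max_right _ _
  refine h2.trans (h1.trans ?_)
  gcongr

/-- Over the n-th preimage of `b'`, the fibre coordinates of the backward orbits of x and y differ
by O(χuu⁻ⁿ), and returning costs at most χpⁿ. So the transfer maps at x converge to y, which gives
uniqueness in the holonomy. -/
theorem eq_transferLim_of_mem_leaf
    (hf : IsPartiallyHyperbolicSkewProduct α f f₂ g Ess Ec Euu χss χm χp χuu)
    {N : T4 → R2 → ℝ} {K : ℝ} (h : FibreBounds f f₂ N α χm χp χuu K) {b b' x y : T2}
    (hy : (y, b') ∈ leaf Euu (x, b)) : y = transferLim f f₂ b b' x := by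
  obtain ⟨c, hc⟩ := hy
  obtain ⟨K', hK'0, hK'⟩ := hf.exists_dist_backward_le
  set L := ∫ s in (0 : ℝ)..1, gnorm g (FlatTorus.proj (c s)) (deriv c s)
  have hp := h.p_pos
  have hu := h.uu_pos
  have hs := h.semiconj
  have key : ∀ n, dist (transfer f f₂ n b b' x) y ≤ K * K' * L * (χp / χuu) ^ n := fun n => by
    have h1 := hK' _ _ c hc n 1 ⟨zero_le_one, le_rfl⟩
    rw [hc.target] at h1
    have h2 : (f.symm^[n] (y, b')).2 = f₂.symm^[n] b' := iterate_snd (symm_semiconj hs) n _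
    have h3 : y = (f^[n] ((f.symm^[n] (y, b')).1, f₂.symm^[n] b')).1 := by
      rw [← h2]
      exact (congrArg Prod.fst (iterate_symm_iterate f n (y, b'))).symm
    have h4 : dist (f.symm^[n] (x, b)).1 (f.symm^[n] (y, b')).1 ≤
        dist (f.symm^[n] (x, b)) (f.symm^[n] (y, b')) := by
      rw [Prod.dist_eq]
      exact le_max_left _ _
    have hK0 : 0 ≤ K := zero_le_one.trans h.one_le_K
    conv_lhs => rw [h3]
    calc _ ≤ K * χp ^ n * dist (f.symm^[n] (x, b)).1 (f.symm^[n] (y, b')).1 := h.iterate_lip _ _ _ _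
      _ ≤ K * χp ^ n * (K' * L * χuu⁻¹ ^ n) := by gcongr; exact h4.trans h1
      _ = _ := by rw [div_pow, inv_pow]; field_simp
  have hlim : Tendsto (fun n => transfer f f₂ n b b' x) atTop (𝓝 y) := by
    rw [tendsto_iff_dist_tendsto_zero]
    refine squeeze_zero (fun _ => dist_nonneg) key ?_
    simpa using (tendsto_pow_atTop_nhds_zero_of_lt_one (by positivity) h.p_lt).const_mul
      (K * K' * L)
  exact hlim.limUnder_eq.symm

/-- Data derived from the splitting: the bounded continuous projection to the unstable bundle, and
the fact that the projection of the unstable bundle to the base is constant on the fibres. -/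
theorem exists_unstable_lift
    (hf : IsPartiallyHyperbolicSkewProduct α f f₂ g Ess Ec Euu χss χm χp χuu) :
    ∃ (πc πu : T4 → R4 →L[ℝ] R4) (M : ℝ), Continuous πu ∧ 0 ≤ M ∧ (∀ p, ‖πc p‖ ≤ M) ∧
      (∀ p, ‖πu p‖ ≤ M) ∧ (∀ p v, πc p v ∈ Ec p) ∧ (∀ p v, πu p v ∈ Euu p) ∧
      (∀ p, ∀ v ∈ Euu p, πu p (0, v.2) = v) ∧
      ∀ p p' : T4, p.2 = p'.2 → ∀ v ∈ Euu p', πc p (0, v.2) + πu p (0, v.2) = (0, v.2) := by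
  have hh := hf.hyperbolic
  obtain ⟨πs, πc, πu, hsc, hcc, huc, hπ⟩ := exists_continuous_projections hh.subbundle_ss
    hh.subbundle_c hh.subbundle_uu hh.splitting
  obtain ⟨Ms, hMs⟩ := exists_norm_le_of_continuous hsc
  obtain ⟨Mc, hMc⟩ := exists_norm_le_of_continuous hcc
  obtain ⟨Mu, hMu⟩ := exists_norm_le_of_continuous huc
  have hMs0 : 0 ≤ Ms := (norm_nonneg _).trans (hMs 0)
  have hMc0 : 0 ≤ Mc := (norm_nonneg _).trans (hMc 0)
  have hMu0 : 0 ≤ Mu := (norm_nonneg _).trans (hMu 0)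
  have hcsum : ∀ e : R4, ((-e.1, 0) : R4) + e = (0, e.2) := fun e =>
    Prod.ext (by simp) (by simp)
  -- Modulo the centre bundle a vector is its base component, so stable and unstable vectors are
  -- recovered from theirs by the bounded projections.
  have hs_of : ∀ p, ∀ v ∈ Ess p, πs p (0, v.2) = v := fun p v hv => by
    obtain ⟨a1, a2, a3, a4⟩ := hπ p (0, v.2)
    refine (decomposition_unique (hh.splitting p) a1 a2 a3 hv
      (hf.mem_centre.2 rfl : ((-v.1, 0) : R4) ∈ Ec p) (Euu p).zero_mem ?_).1
    rw [a4, ← hcsum v]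
    abel
  have hu_of : ∀ p, ∀ v ∈ Euu p, πu p (0, v.2) = v := fun p v hv => by
    obtain ⟨a1, a2, a3, a4⟩ := hπ p (0, v.2)
    refine (decomposition_unique (hh.splitting p) a1 a2 a3 (Ess p).zero_mem
      (hf.mem_centre.2 rfl : ((-v.1, 0) : R4) ∈ Ec p) hv ?_).2.2
    rw [a4, ← hcsum v]
    abel
  refine ⟨πc, πu, Mc + Mu, huc, by positivity, fun p => (hMc p).trans (by linarith),
    fun p => (hMu p).trans (by linarith), fun p v => (hπ p v).2.1, fun p v => (hπ p v).2.2.1,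
    hu_of, fun p p' hpp v hv => ?_⟩
  obtain ⟨hsm, hcm, hum, hsum⟩ := hπ p (0, v.2)
  suffices h0 : πs p (0, v.2) = 0 by rwa [h0, zero_add] at hsum
  -- The base component of `s` is a difference of base components of unstable vectors, hence stays
  -- bounded under backward iteration. A nonzero stable vector would grow at least like χss⁻ⁿ while
  -- being controlled by its base component, so `s` vanishes.
  set s := πs p (0, v.2)
  set u := πu p (0, v.2)
  obtain ⟨K, hK1, hK⟩ := hh.metric.exists_equiv
  have hK0 := zero_le_one.trans hK1
  have hu0 : 0 < χuu := zero_lt_one.trans hh.one_lt_uu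
  have hs2 : s.2 = v.2 - u.2 := by
    have h1 := congrArg Prod.snd hsum
    rw [Prod.snd_add, Prod.snd_add, hf.mem_centre.1 hcm, add_zero] at h1
    exact eq_sub_of_add_eq h1
  set G := gnorm g p' v + gnorm g p u with hG
  have hG0 : 0 ≤ G := add_nonneg (gnorm_nonneg _ _) (gnorm_nonneg _ _)
  have hcn := hf.isCn_symm
  have hcn₂ := hf.skew.base_diffeo.2.1
  have hsemi := symm_semiconj hf.skew.semiconj
  have hback : ∀ (n : ℕ) (q : T4) (w : R4), w ∈ Euu q →
      ‖D f₂.symm^[n] q.2 w.2‖ ≤ K * gnorm g q w := fun n q w hw => by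
    rw [← D_snd (hcn.iterate n) (hcn₂.iterate n) two_ne_zero two_ne_zero
      (iterate_snd (f := f.symm) (f₂ := f₂.symm) hsemi n) q w]
    refine (norm_snd_le _).trans (((hK (f.symm^[n] q) _).2).trans ?_)
    gcongr
    refine (D_iterate_bound hcn two_ne_zero (fun p v hv => (hf.D_symm_uu p v hv).1)
      (ν := gnorm g) (inv_nonneg.2 hu0.le) (fun p v hv => (hf.D_symm_uu p v hv).2) n q hw).trans ?_
    refine mul_le_of_le_one_left (gnorm_nonneg _ _) (pow_le_one₀ (inv_nonneg.2 hu0.le) ?_)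
    exact inv_le_one_of_one_le₀ hh.one_lt_uu.le
  have key : ∀ n : ℕ, gnorm g p s ≤ χss ^ n * (K * (Ms * (K * G))) := fun n => by
    refine (D_iterate_bound' hcn two_ne_zero (fun p v hv => (hf.D_symm_ss p v hv).1)
      (ν := gnorm g) hh.ss_pos.le (fun p v hv => (hf.D_symm_ss p v hv).2) n p hsm).trans ?_
    have hpos := hh.ss_pos
    gcongr
    refine (hK _ _).1.trans ?_
    gcongr
    have h1 := D_iterate_mem hcn two_ne_zero (fun p v hv => (hf.D_symm_ss p v hv).1) n p hsm
    rw [← hs_of _ _ h1]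
    refine (ContinuousLinearMap.le_opNorm _ _).trans ?_
    gcongr
    · exact hMs _
    · rw [Prod.norm_def, norm_zero, max_eq_right (norm_nonneg _),
        D_snd (hcn.iterate n) (hcn₂.iterate n) two_ne_zero two_ne_zero
        (iterate_snd (f := f.symm) (f₂ := f₂.symm) hsemi n), hs2, map_sub, hG, mul_add]
      refine (norm_sub_le _ _).trans (add_le_add ?_ (hback n p u hum))
      have := hback n p' v hv
      rwa [← hpp] at this
  have hlim : Tendsto (fun n : ℕ => χss ^ n * (K * (Ms * (K * G)))) atTop (𝓝 0) := by
    simpa using (tendsto_pow_atTop_nhds_zero_of_lt_one hh.ss_pos.le hh.ss_lt_one).mul_const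
      (K * (Ms * (K * G)))
  have h1 : gnorm g p s ≤ 0 := ge_of_tendsto' hlim key
  have h2 := (hK p s).2
  have h3 : ‖s‖ ≤ 0 := h2.trans (mul_nonpos_of_nonneg_of_nonpos hK0 h1)
  exact norm_le_zero_iff.1 h3

/-- Existence of the holonomy point: the unstable curve from `p` to `q` is transported to start at x
by applying the transfer maps along its base projection, and the limit curve is shown to be C¹ and
unstable. -/
theorem transferLim_mem_leaf
    (hf : IsPartiallyHyperbolicSkewProduct α f f₂ g Ess Ec Euu χss χm χp χuu)
    {N : T4 → R2 → ℝ} {K : ℝ} (h : FibreBounds f f₂ N α χm χp χuu K) {p q : T4}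
    (hq : q ∈ leaf Euu p) (x : T2) :
    (transferLim f f₂ p.2 q.2 x, q.2) ∈ leaf Euu (x, p.2) := by
  obtain ⟨c₀, hc₀⟩ := hq
  obtain ⟨c, hc, htan, hrange⟩ := hc₀.exists_reparam
  obtain ⟨K₁, hK₁0, hK₁⟩ := hf.exists_backwardClose
  obtain ⟨πc, πu, M, hπuc, hM0, hπcM, hπuM, hπc, hπu, hπu_of, hlift⟩ := hf.exists_unstable_lift
  obtain ⟨K, hK1, hK⟩ := hf.hyperbolic.metric.exists_equiv
  have hK0 := zero_le_one.trans hK1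
  have hh := hf.hyperbolic
  have hs := h.semiconj
  have hp := h.p_pos
  have hu := h.uu_pos
  have hcn := hf.isCn
  have hcn' := hf.isCn_symm
  have hcn₂ := hf.skew.base_diffeo.1.1
  set R := K₁ * ∫ s in (0 : ℝ)..1, gnorm g (FlatTorus.proj (c₀ s)) (deriv c₀ s) with hR
  set b := p.2 with hb
  set u : ℝ → T4 := fun t => FlatTorus.proj (c t) with hu_def
  -- The reparametrised curve stays in the image of `c₀` on [0, 1], so the length of `c₀` gives one
  -- closeness constant for all times.
  have hclose : ∀ t, BackwardClose f₂ χuu R b (u t).2 := fun t => by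
    obtain ⟨s, hs, e⟩ := hrange t
    simp only [hu_def, e]
    exact hK₁ p q c₀ hc₀ _ le_rfl s hs
  have hR0 : 0 ≤ R := (hclose 0).nonneg
  have huc : Continuous u := continuous_proj.comp hc.contDiff.continuous
  set v' : ℝ → R4 := deriv c with hv'
  have hv'c : Continuous v' := hc.continuous_deriv
  set w : ℕ → ℝ → R4 := fun n t => D f.symm^[n] (u t) (v' t) with hw
  have hwmem : ∀ n t, w n t ∈ Euu (f.symm^[n] (u t)) := fun n t =>
    D_iterate_mem hcn' two_ne_zero (fun p v hv => (hf.D_symm_uu p v hv).1) n _ (htan t)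
  have hwnorm : ∀ n t, ‖w n t‖ ≤ K * (χuu⁻¹ ^ n * (K * ‖v' t‖)) := fun n t => by
    refine (hK (f.symm^[n] (u t)) _).2.trans ?_
    gcongr
    refine (D_iterate_bound hcn' two_ne_zero (fun p v hv => (hf.D_symm_uu p v hv).1)
      (ν := gnorm g) (inv_nonneg.2 hu.le) (fun p v hv => (hf.D_symm_uu p v hv).2) n _
      (htan t)).trans ?_
    gcongr
    exact (hK _ _).1
  have hwc : ∀ n, Continuous (w n) := fun n =>
    (((hcn'.iterate n).continuous_D two_ne_zero).comp huc).clm_apply hv'c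
  -- At time `-n` the fibre coordinate is frozen and only the base moves, so the velocity is
  -- horizontal and as small as the pulled-back unstable vector `w n t`.
  set k : ℕ → ℝ → T4 := fun n t => ((f.symm^[n] (x, b)).1, (f.symm^[n] (u t)).2) with hk
  have hkvel : ∀ n t, HasVelocityAt (k n) ((0, (w n t).2) : R4) t := fun n t =>
    (hasVelocityAt_const _ t).prodMk ((hc.hasVelocityAt t).map (hcn'.iterate n) two_ne_zero).snd
  have hkc : ∀ n, Continuous (k n) := fun n =>
    continuous_const.prodMk (((hcn'.iterate n).continuous.comp huc).snd)
  set a : ℕ → ℝ → R4 := fun n t => D f^[n] (k n t) (0, (w n t).2) with ha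
  have hac : ∀ n, Continuous (a n) := fun n =>
    (((hcn.iterate n).continuous_D two_ne_zero).comp (hkc n)).clm_apply
      (continuous_const.prodMk (hwc n).snd)
  have hmk : ∀ n t, f^[n] (k n t) = (transfer f f₂ n b (u t).2 x, (u t).2) := fun n t => by
    rw [← transfer_mk hs, hk]
    simp only [iterate_snd (symm_semiconj hs)]
  have hmvel : ∀ n t, HasVelocityAt (fun t => f^[n] (k n t)) (a n t) t := fun n t =>
    (hkvel n t).map (hcn.iterate n) two_ne_zero
  have hu0 : (u 0).2 = b := by simp only [hu_def, hc.source, hb]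
  have hint : ∀ n t, (transfer f f₂ n b (u t).2 x, (u t).2) =
      (FlatTorus.proj (FlatTorus.rep ((x, b) : T4) + ∫ s in (0 : ℝ)..t, a n s) : T4) :=
    fun n t => by
    rw [← hmk]
    refine eq_proj_integral (hmvel n) (hac n) ?_ t
    rw [IsFlatTorus.proj_rep, hmk, hu0, transfer_self hs]
  -- Only the centre part of the horizontal velocity spoils tangency: it starts at size O(χuu⁻ⁿ) and
  -- grows by at most χpⁿ. The unstable part lands on the unique unstable vector over `(v' t).2`.
  have hest : ∀ n t, ‖a n t - πu (f^[n] (k n t)) (0, (v' t).2)‖ ≤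
      K * (K * (M * (K * K))) * (χp / χuu) ^ n * ‖v' t‖ := fun n t => by
    have h1 := hlift (k n t) (f.symm^[n] (u t)) rfl (w n t) (hwmem n t)
    set c1 := πc (k n t) (0, (w n t).2)
    set u1 := πu (k n t) (0, (w n t).2)
    have hc1 : c1 ∈ Ec (k n t) := hπc _ _
    have hu1 : u1 ∈ Euu (k n t) := hπu _ _
    have hc1' : D f^[n] (k n t) c1 ∈ Ec (f^[n] (k n t)) :=
      D_iterate_mem hcn two_ne_zero hf.D_mem_c n _ hc1
    have hu1' : D f^[n] (k n t) u1 ∈ Euu (f^[n] (k n t)) :=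
      D_iterate_mem hcn two_ne_zero hf.D_mem_uu n _ hu1
    have h2 : a n t = D f^[n] (k n t) c1 + D f^[n] (k n t) u1 := by
      rw [← map_add, h1]
    have h3 : (D f^[n] (k n t) u1).2 = (v' t).2 := by
      have h4 : (a n t).2 = (D f^[n] (k n t) u1).2 := by
        rw [h2, Prod.snd_add, hf.mem_centre.1 hc1', zero_add]
      rw [← h4]
      have h5 := D_snd (hcn.iterate n) (hcn₂.iterate n) two_ne_zero two_ne_zero (iterate_snd hs n)
      have h6 := D_iterate_apply_D_symm_iterate hcn hcn' two_ne_zero n (u t) (v' t)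
      rw [ha]
      simp only
      rw [h5, ← h6, h5]
    have h4 : πu (f^[n] (k n t)) (0, (v' t).2) = D f^[n] (k n t) u1 := by
      rw [← h3]
      exact hπu_of _ _ hu1'
    rw [h4, h2, add_sub_cancel_right]
    have h5 : ‖c1‖ ≤ M * (K * (χuu⁻¹ ^ n * (K * ‖v' t‖))) := by
      refine (ContinuousLinearMap.le_opNorm _ _).trans ?_
      gcongr
      · exact hπcM _
      · rw [Prod.norm_def, norm_zero, max_eq_right (norm_nonneg _)]
        exact (norm_snd_le (w n t)).trans (hwnorm n t)
    calc ‖D f^[n] (k n t) c1‖ ≤ K * gnorm g (f^[n] (k n t)) (D f^[n] (k n t) c1) := (hK _ _).2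
      _ ≤ K * (χp ^ n * gnorm g (k n t) c1) := by
        gcongr
        exact D_iterate_bound hcn two_ne_zero hf.D_mem_c (ν := gnorm g) hp.le hh.norm_c n _ hc1
      _ ≤ K * (χp ^ n * (K * (M * (K * (χuu⁻¹ ^ n * (K * ‖v' t‖)))))) := by
        gcongr
        exact (hK _ _).1.trans (by gcongr)
      _ = _ := by rw [div_pow, inv_pow]; field_simp
  set m : ℝ → T4 := fun t => (transferLim f f₂ b (u t).2 x, (u t).2) with hm
  have hmlim : ∀ t, Tendsto (fun n => f^[n] (k n t)) atTop (𝓝 (m t)) := fun t => by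
    simp only [hmk]
    exact ((h.tendstoUniformly_transfer (hclose t)).tendsto_at x).prodMk_nhds tendsto_const_nhds
  have hmc : Continuous m := by
    have h1 := (h.continuousOn_jet2_transferLim hR0).comp_continuous
      (f := fun t : ℝ => ((b, (u t).2), x)) (by fun_prop) hclose
    exact h1.fst.prodMk huc.snd
  set A : ℝ → R4 := fun t => πu (m t) (0, (v' t).2) with hA
  have hAc : Continuous A :=
    (hπuc.comp hmc).clm_apply (continuous_const.prodMk hv'c.snd)
  have hρ0 : 0 ≤ χp / χuu := by positivity
  set C := K * (K * (M * (K * K))) with hC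
  have hC0 : 0 ≤ C := by positivity
  have halim : ∀ t, Tendsto (fun n => a n t) atTop (𝓝 (A t)) := fun t => by
    have h1 : Tendsto (fun n => πu (f^[n] (k n t)) (0, (v' t).2)) atTop (𝓝 (A t)) :=
      ((hπuc.clm_apply continuous_const).tendsto (m t)).comp (hmlim t)
    have h2 : Tendsto (fun n => a n t - πu (f^[n] (k n t)) (0, (v' t).2)) atTop (𝓝 0) := by
      refine squeeze_zero_norm (fun n => hest n t) ?_
      simpa using ((tendsto_pow_atTop_nhds_zero_of_lt_one hρ0 h.p_lt).const_mul C).mul_const ‖v' t‖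
    simpa using h2.add h1
  have habd : ∀ n t, ‖a n t‖ ≤ (C + M) * ‖v' t‖ := fun n t => by
    have h1 : ‖πu (f^[n] (k n t)) (0, (v' t).2)‖ ≤ M * ‖v' t‖ := by
      refine (ContinuousLinearMap.le_opNorm _ _).trans ?_
      gcongr
      · exact hπuM _
      · rw [Prod.norm_def, norm_zero, max_eq_right (norm_nonneg _)]
        exact norm_snd_le (v' t)
    have h2 : C * (χp / χuu) ^ n * ‖v' t‖ ≤ C * ‖v' t‖ := by
      gcongr
      exact mul_le_of_le_one_right hC0 (pow_le_one₀ hρ0 h.p_lt.le)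
    have h3 := norm_le_norm_sub_add (a n t) (πu (f^[n] (k n t)) (0, (v' t).2))
    have h4 := hest n t
    linarith
  -- The candidate lift integrates the limit velocities; dominated convergence shows that it
  -- projects to the limit curve `m`, and tangency is then built into its derivative.
  set c' : ℝ → R4 := fun t => FlatTorus.rep ((x, b) : T4) + ∫ s in (0 : ℝ)..t, A s with hc'
  have hproj : ∀ t, (FlatTorus.proj (c' t) : T4) = m t := fun t => by
    have h1 : Tendsto (fun n => ∫ s in (0 : ℝ)..t, a n s) atTop (𝓝 (∫ s in (0 : ℝ)..t, A s)) := by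
      refine intervalIntegral.tendsto_integral_filter_of_dominated_convergence
        (fun t => (C + M) * ‖v' t‖) (Eventually.of_forall fun n => (hac n).aestronglyMeasurable)
        (Eventually.of_forall fun n => Eventually.of_forall fun t _ => habd n t) ?_
        (Eventually.of_forall fun t _ => halim t)
      exact (continuous_const.mul hv'c.norm).intervalIntegrable _ _
    have h2 : Tendsto (fun n => (FlatTorus.proj (FlatTorus.rep ((x, b) : T4) +
        ∫ s in (0 : ℝ)..t, a n s) : T4)) atTop (𝓝 (FlatTorus.proj (c' t))) :=
      (continuous_proj.tendsto _).comp (h1.const_add _)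
    simp only [← hint, ← hmk] at h2
    exact tendsto_nhds_unique h2 (hmlim t)
  have hder : ∀ t, HasDerivAt c' (A t) t := fun t =>
    (intervalIntegral.integral_hasDerivAt_right (hAc.intervalIntegrable _ _)
      (hAc.stronglyMeasurableAtFilter _ _) hAc.continuousAt).const_add _
  have hderiv : deriv c' = A := funext fun t => (hder t).deriv
  refine ⟨c', ?_, ?_, ?_, fun t _ => ?_⟩
  · rw [contDiff_one_iff_deriv, hderiv]
    exact ⟨fun t => (hder t).differentiableAt, hAc⟩
  · simp [hc', IsFlatTorus.proj_rep]
  · rw [hproj, hm]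
    simp only [hu_def, hc.target]
  · rw [hderiv, hproj]
    exact hπu _ _

theorem isHolonomy_transferLim
    (hf : IsPartiallyHyperbolicSkewProduct α f f₂ g Ess Ec Euu χss χm χp χuu)
    {N : T4 → R2 → ℝ} {K : ℝ} (h : FibreBounds f f₂ N α χm χp χuu K) {p q : T4}
    (hq : q ∈ leaf Euu p) : IsHolonomy Euu p q (transferLim f f₂ p.2 q.2) := fun x _ =>
  ⟨fun hy => hf.eq_transferLim_of_mem_leaf h hy, fun e => e ▸ hf.transferLim_mem_leaf h hq x⟩

end IsPartiallyHyperbolicSkewProduct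

end Main

end SkewProduct

end

/-! ### Assembly of the holonomies -/

theorem mainTheorem11 (α : ℝ) (hα : 0 < α) (hα1 : α < 1)
    (f : T4 ≃ T4) (f₂ : T2 ≃ T2) (g : T4 → R4 →L[ℝ] R4 →L[ℝ] ℝ)
    (Ess Ec Euu : T4 → Submodule ℝ R4) (χss χm χp χuu : ℝ)
    (hf : IsPartiallyHyperbolicSkewProduct α f f₂ g Ess Ec Euu χss χm χp χuu)
    (hb : CenterUnstableBunched α χm χp χuu) (R : ℝ) (hR : 0 < R) :
    ∃ H : T4 × T4 → (T2 ≃ T2),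
      (∀ p, ∀ q ∈ leafDisc g Euu R p,
        IsHolonomy Euu p q (H (p, q)) ∧ IsCnDiffeo 2 (H (p, q))) ∧
      (∀ z ∈ {z : T4 × T4 | z.2 ∈ leafDisc g Euu R z.1},
        TendstoUniformly (fun z' => jet2 (H z')) (jet2 (H z))
          (𝓝[{z : T4 × T4 | z.2 ∈ leafDisc g Euu R z.1}] z)) ∧
      ContinuousOn (fun z => c2Norm (H z)) {z : T4 × T4 | z.2 ∈ leafDisc g Euu R z.1} := by
  classical
  obtain ⟨K, h⟩ := hf.exists_fibreBounds hα hα1 hb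
  obtain ⟨K₁, hK₁0, hK₁⟩ := hf.exists_backwardClose
  set R₁ := K₁ * R
  have hR₁ : 0 ≤ R₁ := by positivity
  have hclose : ∀ p, ∀ q ∈ leafDisc g Euu R p, BackwardClose f₂ χuu R₁ p.2 q.2 := by
    rintro p q ⟨c, hc, hl⟩
    have h1 := hK₁ p q c hc R hl 1 ⟨zero_le_one, le_rfl⟩
    rwa [hc.target] at h1
  set S := {z : T4 × T4 | z.2 ∈ leafDisc g Euu R z.1} with hS
  -- The holonomy depends only on the base points. The default `Equiv.refl` is never met on `S`, by
  -- `hclose`.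
  set H : T4 × T4 → (T2 ≃ T2) := fun z =>
    if hz : BackwardClose f₂ χuu R₁ z.1.2 z.2.2 then h.transferEquiv hz else Equiv.refl T2 with hH
  have hHe : ∀ p, ∀ q ∈ leafDisc g Euu R p,
      ∃ hz : BackwardClose f₂ χuu R₁ p.2 q.2, H (p, q) = h.transferEquiv hz := fun p q hq =>
    ⟨hclose p q hq, dif_pos (hclose p q hq)⟩
  have hcont : ContinuousOn (fun z : (T4 × T4) × T2 => jet2 (H z.1) z.2) (S ×ˢ univ) := by
    have h1 := (h.continuousOn_jet2_transferLim hR₁).comp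
      (f := fun z : (T4 × T4) × T2 => ((z.1.1.2, z.1.2.2), z.2)) (s := S ×ˢ univ)
      (by fun_prop) fun z hz => hclose z.1.1 z.1.2 hz.1
    refine h1.congr fun z hz => ?_
    obtain ⟨hz', e⟩ := hHe z.1.1 z.1.2 hz.1
    simp only [Function.comp]
    rw [show z.1 = (z.1.1, z.1.2) from rfl, e]
    rfl
  refine ⟨H, fun p q hq => ?_, continuousOn_c2 hcont⟩
  obtain ⟨hz, e⟩ := hHe p q hq
  rw [e]
  obtain ⟨c, hc, _⟩ := hq
  exact ⟨hf.isHolonomy_transferLim h ⟨c, hc⟩, h.isCnDiffeo_transferEquiv hz⟩
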